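/- Let $d\ge 2$, let $\mathbb B$ be the open Euclidean unit ball of $\mathbb R^d$ and equip $\partial\mathbb B$ with its surface measure; all $L^2$ and Sobolev spaces are complex. For $C\in\mathbb B$ and $0<R<1-|C|$ let $\Lambda_{C,R}:H^{1/2}(\partial\mathbb B)\to H^{-1/2}(\partial\mathbb B)$, $f\mapsto \nu\cdot\nabla u|_{\partial\mathbb B}$, be the Dirichlet-to-Neumann map of a perfectly conducting inclusion $B(C,R)$, where $u\in H^1(\mathbb B\setminus\overline{B(C,R)})$ is the weak solution of $\Delta u=0$ in $\mathbb B\setminus\overline{B(C,R)}$, $u=0$ on $\partial B(C,R)$, $u=f$ on $\partial\mathbb B$. Let $\Lambda_1$ be the Dirichlet-to-Neumann map of the inclusion-free problem $\Delta w=0$ in $\mathbb B$, $w=f$ on $\partial\mathbb B$. The difference $\Lambda_{C,R}-\Lambda_1$ is identified with its unique extension to a bounded operator on $L^2(\partial\mathbb B)$, and $\|\cdot\|$ denotes the operator norm in $\mathscr L(L^2(\partial\mathbb B))$. Let $a\in\mathbb B\setminus\{0\}$, $\rho=|a|$, and let $I_a$ be the inversion in the sphere with center $\hat a=a/|a|^2$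 and radius $(\rho^{-2}-1)^{1/2}$, that is $I_a(x)=(\rho^{-2}-1)\frac{x-\hat a}{|x-\hat a|^2}+\hat a$. For each $r\in(0,1)$ let $B(C,R)=I_a(B(0,r))$, so $C=C(r)$ and $R=R(r)$ depend on $r$ (and $a$). **Theorem.** For every $r\in(0,1)$ the extensions to $L^2(\partial\mathbb B)$ of $\Lambda_{0,r}-\Lambda_1$ and $\Lambda_{C,R}-\Lambda_1$ exist and are unique, the set of eigenvalues of $\Lambda_{0,r}-\Lambda_1$ is $\{\lambda_n\}_{n\ge0}$, where $$\lambda_n=\frac{2n+d-2}{r^{2-d-2n}-1}\ \text{ if } d>2 \text{ or } n\ge1,\qquad \lambda_0=-\frac1{\log r}\ \text{ if } d=2,$$ and $$\frac{1-\rho}{1+\rho}\le\frac{\|\Lambda_{0,r}-\Lambda_1\|}{\|\Lambda_{C,R}-\Lambda_1\|}\le\left[\frac{(1-\rho^2)^2d}{(1+\rho^2)^2d+4\rho^2\frac{\lambda_1}{\lambda_0}\left(\frac{\lambda_1}{\lambda_0}+2\right)}\right]^{1/2}\le\frac{1-\rho^2}{1+\rho^2}.$$ The outer bounds are optimal: for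 fixed $a$, $$\inf_{r\in(0,1)}\frac{\|\Lambda_{0,r}-\Lambda_1\|}{\|\Lambda_{C,R}-\Lambda_1\|}=\frac{1-\rho}{1+\rho},\qquad \sup_{r\in(0,1)}\frac{\|\Lambda_{0,r}-\Lambda_1\|}{\|\Lambda_{C,R}-\Lambda_1\|}=\frac{1-\rho^2}{1+\rho^2},$$ and the ratio tends to the first value as $r\to1^-$ and to the second as $r\to0^+$. -/

import Mathlib

open MeasureTheory Filter Topology
open scoped ContDiff

noncomputable section

namespace DepthEIT

/-- The Euclidean space `ℝ^d`. -/
abbrev E (d : ℕ) : Type := EuclideanSpace ℝ (Fin d)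

/-- The boundary `∂𝔹` of the unit ball. -/
abbrev S (d : ℕ) : Type := Metric.sphere (0 : E d) 1

/-- The (unnormalized) surface measure on `∂𝔹`. -/
abbrev surf (d : ℕ) : Measure (S d) := (volume : Measure (E d)).toSphere

/-- The complex Hilbert space `L²(∂𝔹)`. -/
abbrev L2S (d : ℕ) : Type := Lp ℂ 2 (surf d)

/-- The partial derivative `∂ᵢ φ`. -/
def pd {d : ℕ} (i : Fin d) (φ : E d → ℂ) (x : E d) : ℂ :=
  fderiv ℝ φ x (EuclideanSpace.single i 1)

/-- Test functions `φ ∈ C_c^∞(Ω)`. -/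
def IsTest {d : ℕ} (Ω : Set (E d)) (φ : E d → ℂ) : Prop :=
  ContDiff ℝ ∞ φ ∧ HasCompactSupport φ ∧ tsupport φ ⊆ Ω

/-- `u ∈ H¹(Ω)` with weak gradient `G = (G₁, …, G_d)`. -/
def IsH1 {d : ℕ} (Ω : Set (E d)) (u : E d → ℂ) (G : Fin d → E d → ℂ) : Prop :=
  MemLp u 2 (volume.restrict Ω) ∧
  (∀ i, MemLp (G i) 2 (volume.restrict Ω)) ∧
  ∀ φ, IsTest Ω φ → ∀ i, ∫ x in Ω, u x * pd i φ x = - ∫ x in Ω, G i x * φ x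

/-- The function `u ∈ H¹(Ω)` with weak gradient `G` has the trace `f` on the sphere
`S(c, s)` (a component of `∂Ω`), the sphere being parametrized by `∂𝔹 ∋ θ ↦ c + s θ`.
The trace operator is the continuous extension of the restriction of functions smooth up to the
boundary: smooth functions approximate `u` in `H¹(Ω)`, and their restrictions converge to `f`
in `L²` of the sphere. -/
def HasTrace {d : ℕ} (Ω : Set (E d)) (u : E d → ℂ) (G : Fin d → E d → ℂ)
    (c : E d) (s : ℝ) (f : S d → ℂ) : Prop :=
  ∃ v : ℕ → E d → ℂ, (∀ k, ContDiff ℝ ∞ (v k)) ∧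
    Tendsto (fun k => eLpNorm (fun x => v k x - u x) 2 (volume.restrict Ω)) atTop (𝓝 0) ∧
    (∀ i, Tendsto (fun k => eLpNorm (fun x => pd i (v k) x - G i x) 2 (volume.restrict Ω))
      atTop (𝓝 0)) ∧
    Tendsto (fun k => eLpNorm (fun θ : S d => v k (c + s • (θ : E d)) - f θ) 2 (surf d))
      atTop (𝓝 0)

/-- `Δ u = 0` in `Ω` in the weak sense, for `u ∈ H¹(Ω)` with weak gradient `G`. -/
def IsWeaklyHarmonic {d : ℕ} (Ω : Set (E d)) (G : Fin d → E d → ℂ) : Prop :=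
  ∀ φ, IsTest Ω φ → ∫ x in Ω, ∑ i, G i x * pd i φ x = 0

/-- The Neumann trace `ν · ∇u` on `∂𝔹` of a weakly harmonic `u ∈ H¹(Ω)` with weak gradient `G`,
as a distribution `ℓ` on `∂𝔹`, given by Green's formula
`⟨ν · ∇u, Φ|_{∂𝔹}⟩ = ∫_Ω ∇u · ∇Φ` for all smooth `Φ` that vanish on the rest `Γ` of `∂Ω`.
Only the values of `ℓ` at smooth functions on `∂𝔹` are relevant. -/
def IsNeumannTrace {d : ℕ} (Ω Γ : Set (E d)) (G : Fin d → E d → ℂ)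
    (ℓ : (S d → ℂ) → ℂ) : Prop :=
  ∀ Φ : E d → ℂ, ContDiff ℝ ∞ Φ → (∀ x ∈ Γ, Φ x = 0) →
    ℓ (fun θ => Φ θ) = ∫ x in Ω, ∑ i, G i x * pd i Φ x

/-- The domain `𝔹 \ closure B(C, R)`. -/
def dom {d : ℕ} (C : E d) (R : ℝ) : Set (E d) :=
  Metric.ball 0 1 \ Metric.closedBall C R

/-- The graph of the Dirichlet-to-Neumann map `Λ_{C,R}` (perfectly conducting inclusion `B(C,R)`):
`ℓ = Λ_{C,R} f`. -/
def IsDN {d : ℕ} (C : E d) (R : ℝ) (f : L2S d) (ℓ : (S d → ℂ) → ℂ) : Prop :=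
  ∃ u G, IsH1 (dom C R) u G ∧ IsWeaklyHarmonic (dom C R) G ∧
    HasTrace (dom C R) u G C R (fun _ => 0) ∧
    HasTrace (dom C R) u G 0 1 f ∧
    IsNeumannTrace (dom C R) (Metric.sphere C R) G ℓ

/-- The graph of the Dirichlet-to-Neumann map `Λ₁` of the inclusion-free ball: `ℓ = Λ₁ f`. -/
def IsDNFree {d : ℕ} (f : L2S d) (ℓ : (S d → ℂ) → ℂ) : Prop :=
  ∃ w G, IsH1 (Metric.ball 0 1) w G ∧ IsWeaklyHarmonic (Metric.ball 0 1) G ∧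
    HasTrace (Metric.ball 0 1) w G 0 1 f ∧
    IsNeumannTrace (Metric.ball 0 1) ∅ G ℓ

/-- The bounded operator `T` on `L²(∂𝔹)` extends `Λ_{C,R} - Λ₁`: for every `f` in the common
domain `H^{1/2}(∂𝔹)`, the distribution `Λ_{C,R} f - Λ₁ f` on `∂𝔹` is the function `T f`. -/
def ExtendsDNDiff {d : ℕ} (C : E d) (R : ℝ) (T : L2S d →L[ℂ] L2S d) : Prop :=
  ∀ (f : L2S d) (ℓ ℓ₁ : (S d → ℂ) → ℂ), IsDN C R f ℓ → IsDNFree f ℓ₁ →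
    ∀ φ : E d → ℂ, ContDiff ℝ ∞ φ →
      ∫ θ : S d, T f θ * φ θ ∂(surf d) = ℓ (fun θ => φ θ) - ℓ₁ (fun θ => φ θ)

open Classical in
/-- `Λ_{C,R} - Λ₁` as an element of `ℒ(L²(∂𝔹))`. -/
def dnDiff {d : ℕ} (C : E d) (R : ℝ) : L2S d →L[ℂ] L2S d :=
  if h : ∃ T, ExtendsDNDiff C R T then h.choose else 0

/-- The inversion `I_a` in the sphere with center `a / |a|²` and radius `(|a|⁻² - 1)^{1/2}`. -/
def inv {d : ℕ} (a : E d) : E d → E d :=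
  EuclideanGeometry.inversion ((‖a‖ ^ 2)⁻¹ • a) (Real.sqrt ((‖a‖ ^ 2)⁻¹ - 1))

/-- The numbers `λ_n` enumerating the eigenvalues of `Λ_{0,r} - Λ₁`. -/
def eig (d : ℕ) (r : ℝ) (n : ℕ) : ℝ :=
  if d = 2 ∧ n = 0 then -1 / Real.log r
  else (2 * n + d - 2) / (r ^ (2 - (d : ℤ) - 2 * (n : ℤ)) - 1)

/-- The ratio `‖Λ_{0,r} - Λ₁‖ / ‖Λ_{C,R} - Λ₁‖` of operator norms on `L²(∂𝔹)`. -/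
def ratio {d : ℕ} (r : ℝ) (C : E d) (R : ℝ) : ℝ :=
  ‖dnDiff (0 : E d) r‖ / ‖dnDiff C R‖

end DepthEIT

end

/-! The inversion `I_a` has centre `b = a/|a|²` and preserves the unit ball. Since it is conformal,
the Kelvin transform `u ↦ k^(d-2) · (u ∘ I_a)`, where `k(x) = √(|b|²-1)/|x-b|`, preserves
harmonicity (`lap_kelvin`) and carries solutions for the concentric inclusion to solutions for
`B(C,R)`. Its normal derivative on the sphere has a zero-order part that depends only on the
Dirichlet data. This part cancels in the difference of the two Dirichlet-to-Neumann maps, so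
`Λ_{C,R} - Λ₁ = V T W` with `T = Λ_{0,r} - Λ₁`, `W g = k^(d-2) · (g ∘ I_a)` and `V g = k^d · (g ∘
I_a)` (`SmoothDNData.kelvin`, `extendsDNDiff_kelvin_iff`).

The operator `T` is diagonal on spherical harmonics, with decreasing eigenvalues `λ_n`; hence `‖T‖ =
λ_0`. The surface measure transforms under `I_a` with density `k^(2d-2)` (`integral_wcomp`), so `‖W
g‖² = ∫ k²|g|²` and `‖V g‖² = ∫ k⁻²|g|²`. Both weights have supremum `(|b|+1)/(|b|-1) =
(1+ρ)/(1-ρ)`, which gives the lower bound for the ratio. For the upper bound, `V T W` is tested on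
`V 1`: here `W V 1 = k⁻²` is an affine function on the sphere, so only `λ_0` and `λ_1` enter and all
norms are moments of `⟨b,θ⟩` of degree at most three (`norm_kelvinConj_ge`).

As `r → 1`, `λ_n/λ_0 → 1` for each `n`, so `T/λ_0` tends strongly to the identity; as `W` is an
involution, the quotient `‖V f‖/‖W f‖` governs the limit, and it comes close to the supremum when
`f` concentrates where `k⁻²` is maximal (`tendsto_norm_kelvinConj_one`). As `r → 0`, `λ_1/λ_0 → 0`,
so `T/λ_0` tends in norm to the projection onto constants, and `V T W/λ_0` to a rank-one operator of
known norm (`tendsto_norm_kelvinConj_zero`). These limits make the outer bounds optimal.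

The link with the weak boundary value problems is `extendsDNDiff_iff`: a symmetric operator with the
right values on data that have solutions smooth up to the boundary is the unique extension, provided
such data are dense in a `C¹` sense. Green's formula needs smoothness only of the test solution, so
no existence theory for weak solutions is required. -/

namespace DepthEIT

variable {d : ℕ}

/-! ### Polar coordinates -/

section Polar

open Measure Set

lemma integral_eq_integral_sphere_prod [NeZero d] (f : E d → ℂ) :
    ∫ x, f x = ∫ p : S d × Ioi (0 : ℝ), f ((p.2 : ℝ) • (p.1 : E d))
      ∂((surf d).prod (.volumeIoiPow (d - 1))) := by
  have h1 : ∫ x, f x = ∫ x : ({(0)}ᶜ : Set (E d)), f x.1 ∂((volume : Measure (E d)).comap (↑)) := by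
    rw [integral_subtype_comap (measurableSet_singleton _).compl fun x ↦ f x,
        restrict_compl_singleton]
  rw [h1]
  have := (volume : Measure (E d)).measurePreserving_homeomorphUnitSphereProd.integral_comp
        (Homeomorph.measurableEmbedding _) (fun p => f ((p.2 : ℝ) • (p.1 : E d)))
  simp only [finrank_euclideanSpace, Fintype.card_fin] at this
  rw [← this]
  refine integral_congr_ae (Eventually.of_forall fun x => ?_)
  simp only [homeomorphUnitSphereProd_apply_snd_coe, homeomorphUnitSphereProd_apply_fst_coe]
  have : ‖(x : E d)‖ ≠ 0 := norm_ne_zero_iff.2 x.2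
  simp [smul_smul, this]

lemma integrable_sphere_prod [NeZero d] {f : E d → ℂ} (hf : Integrable f) :
    Integrable (fun p : S d × Ioi (0 : ℝ) => f ((p.2 : ℝ) • (p.1 : E d)))
      ((surf d).prod (.volumeIoiPow (d - 1))) := by
  have := (volume : Measure (E d)).measurePreserving_homeomorphUnitSphereProd.integrable_comp_emb
        (Homeomorph.measurableEmbedding _) (g := fun p => f ((p.2 : ℝ) • (p.1 : E d)))
  simp only [finrank_euclideanSpace, Fintype.card_fin] at this
  rw [← this]
  have h2 : Integrable (fun x : ({(0)}ᶜ : Set (E d)) => f x.1)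
      ((volume : Measure (E d)).comap (↑)) := by
    have := (integrableOn_iff_comap_subtypeVal (f := f) (μ := (volume : Measure (E d)))
      (measurableSet_singleton (0 : E d)).compl).1 hf.integrableOn
    exact this
  refine h2.congr (Eventually.of_forall fun x => ?_)
  simp only [homeomorphUnitSphereProd_apply_snd_coe, homeomorphUnitSphereProd_apply_fst_coe,
    Function.comp]
  have : ‖(x : E d)‖ ≠ 0 := norm_ne_zero_iff.2 x.2
  simp [smul_smul, this]

/-- Integration in polar coordinates. -/
lemma integral_polar [NeZero d] {f : E d → ℂ} (hf : Integrable f) :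
    ∫ x, f x = ∫ t in Ioi (0 : ℝ), (t ^ (d - 1) : ℝ) • ∫ θ : S d, f (t • (θ : E d)) ∂(surf d) := by
  rw [integral_eq_integral_sphere_prod, integral_prod_symm _ (integrable_sphere_prod hf)]
  simp only [Measure.volumeIoiPow, ENNReal.ofReal]
  rw [integral_withDensity_eq_integral_smul,
    integral_subtype_comap measurableSet_Ioi fun a ↦ Real.toNNReal (a ^ (d - 1)) •
      ∫ θ : S d, f (a • (θ : E d)) ∂(surf d), setIntegral_congr_fun measurableSet_Ioi fun x hx ↦ ?_]
  · simp only [NNReal.smul_def, Real.coe_toNNReal _ (pow_nonneg (le_of_lt hx) _)]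
  · exact (measurable_subtype_coe.pow_const _).real_toNNReal

end Polar

/-! ### Partial derivatives, the Laplacian and integration by parts -/

section Partial

lemma pd_eq_of_hasFDerivAt {φ : E d → ℂ} {x : E d} {L : E d →L[ℝ] ℂ} (h : HasFDerivAt φ L x)
    (i : Fin d) : pd i φ x = L (EuclideanSpace.single i 1) := by
  rw [pd, h.fderiv]

lemma pd_add {f g : E d → ℂ} {x : E d} (i : Fin d) (hf : DifferentiableAt ℝ f x)
    (hg : DifferentiableAt ℝ g x) : pd i (fun y => f y + g y) x = pd i f x + pd i g x := by
  rw [show (fun y => f y + g y) = f + g from rfl, pd_eq_of_hasFDerivAt (hf.hasFDerivAt.add hg.hasFDerivAt)]; rfl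

lemma pd_sub {f g : E d → ℂ} {x : E d} (i : Fin d) (hf : DifferentiableAt ℝ f x)
    (hg : DifferentiableAt ℝ g x) : pd i (fun y => f y - g y) x = pd i f x - pd i g x := by
  rw [show (fun y => f y - g y) = f - g from rfl, pd_eq_of_hasFDerivAt (hf.hasFDerivAt.sub hg.hasFDerivAt)]; rfl

lemma pd_mul {f g : E d → ℂ} {x : E d} (i : Fin d) (hf : DifferentiableAt ℝ f x)
    (hg : DifferentiableAt ℝ g x) :
    pd i (fun y => f y * g y) x = pd i f x * g x + f x * pd i g x := by
  rw [show (fun y => f y * g y) = f * g from rfl, pd_eq_of_hasFDerivAt (hf.hasFDerivAt.mul hg.hasFDerivAt)]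
  simp [pd]; ring

lemma pd_const (c : ℂ) (x : E d) (i : Fin d) : pd i (fun _ => c) x = 0 := by
  simp [pd]

lemma pd_const_mul {g : E d → ℂ} {x : E d} (i : Fin d) (c : ℂ)
    (hg : DifferentiableAt ℝ g x) : pd i (fun y => c * g y) x = c * pd i g x := by
  rw [pd_mul i (differentiableAt_const c) hg, pd_const]; ring

lemma pd_sum {ι : Type*} (s : Finset ι) {f : ι → E d → ℂ} {x : E d} (i : Fin d)
    (hf : ∀ j ∈ s, DifferentiableAt ℝ (f j) x) :
    pd i (fun y => ∑ j ∈ s, f j y) x = ∑ j ∈ s, pd i (f j) x := by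
  rw [pd_eq_of_hasFDerivAt (HasFDerivAt.fun_sum fun j hj => (hf j hj).hasFDerivAt)]
  simp [pd]

lemma pd_congr {f g : E d → ℂ} {x : E d} (i : Fin d) (h : f =ᶠ[𝓝 x] g) : pd i f x = pd i g x := by
  rw [pd, pd, h.fderiv_eq]

lemma contDiff_pd {φ : E d → ℂ} {m n : WithTop ℕ∞} (h : ContDiff ℝ n φ) (hmn : m + 1 ≤ n)
    (i : Fin d) : ContDiff ℝ m (pd i φ) :=
  (h.fderiv_right hmn).clm_apply contDiff_const

lemma contDiff_pd_infty {φ : E d → ℂ} (h : ContDiff ℝ ∞ φ) (i : Fin d) :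
    ContDiff ℝ ∞ (pd i φ) := contDiff_pd h (by simp) i

lemma continuous_pd {φ : E d → ℂ} (h : ContDiff ℝ ∞ φ) (i : Fin d) :
    Continuous (pd i φ) := (contDiff_pd_infty h i).continuous

lemma sum_pd_mul_coord (φ : E d → ℂ) (x y : E d) :
    ∑ i, (y i : ℂ) * pd i φ x = fderiv ℝ φ x y := by
  conv_rhs => rw [← (EuclideanSpace.basisFun (Fin d) ℝ).sum_repr y]
  simp [pd]

/-- The Laplacian `Δφ`. -/
noncomputable def lap (φ : E d → ℂ) (x : E d) : ℂ := ∑ i, pd i (pd i φ) x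

lemma continuous_lap {φ : E d → ℂ} (h : ContDiff ℝ ∞ φ) : Continuous (lap φ) :=
  continuous_finsetSum _ fun i _ => continuous_pd (contDiff_pd_infty h i) i

lemma lap_congr {f g : E d → ℂ} {x : E d} (h : f =ᶠ[𝓝 x] g) : lap f x = lap g x := by
  refine Finset.sum_congr rfl fun i _ => pd_congr i ?_
  filter_upwards [h.eventuallyEq_nhds] with y hy using pd_congr i hy

lemma integral_pd_mul_eq_neg {f g : E d → ℂ} (hf : ContDiff ℝ 1 f) (hg : ContDiff ℝ 1 g)
    (hfs : HasCompactSupport f) (i : Fin d) :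
    ∫ x, g x * pd i f x = - ∫ x, pd i g x * f x := by
  have hfc : HasCompactSupport (pd i f) := by
    have := hfs.fderiv (𝕜 := ℝ)
    exact this.comp_left (g := fun L : E d →L[ℝ] ℂ => L (EuclideanSpace.single i 1)) (by simp)
  have c1 : Continuous (pd i f) := (contDiff_pd (m := 0) hf (by simp) i).continuous
  have c2 : Continuous (pd i g) := (contDiff_pd (m := 0) hg (by simp) i).continuous
  refine integral_mul_fderiv_eq_neg_fderiv_mul_of_integrable ?_ ?_ ?_ ?_ ?_
  · exact (c2.mul hf.continuous).integrable_of_hasCompactSupport hfs.mul_left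
  · exact (hg.continuous.mul c1).integrable_of_hasCompactSupport hfc.mul_left
  · exact (hg.continuous.mul hf.continuous).integrable_of_hasCompactSupport hfs.mul_left
  · exact fun x _ => (hg.differentiable (by simp)) x
  · exact fun x _ => (hf.differentiable (by simp)) x

end Partial

end DepthEIT

namespace DepthEIT

variable {d : ℕ}

/-! ### The divergence theorem on balls -/

section Divergence

open Set Metric

/-- The value here is the global minimum `0`, so the derivative vanishes as at any extremum. This
covers the junction point without one-sided derivatives. -/
lemma deriv_smoothTransition_of_nonpos {x : ℝ} (hx : x ≤ 0) : deriv Real.smoothTransition x = 0 := by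
  refine IsLocalMin.deriv_eq_zero (Eventually.of_forall fun y => ?_)
  rw [Real.smoothTransition.zero_of_nonpos hx]; exact Real.smoothTransition.nonneg y

lemma deriv_smoothTransition_of_one_le {x : ℝ} (hx : 1 ≤ x) :
    deriv Real.smoothTransition x = 0 := by
  refine IsLocalMax.deriv_eq_zero (Eventually.of_forall fun y => ?_)
  rw [Real.smoothTransition.one_of_one_le hx]; exact Real.smoothTransition.le_one y

/-- Smooth radial cutoffs increasing to the indicator of the unit ball. -/
noncomputable def radialCutoff (n : ℕ) (t : ℝ) : ℝ := Real.smoothTransition ((n + 1) * (1 - t ^ 2))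

lemma radialCutoff_hasDerivAt (n : ℕ) (t : ℝ) : HasDerivAt (radialCutoff n)
    (deriv Real.smoothTransition ((n + 1) * (1 - t ^ 2)) * ((n + 1) * (-2 * t))) t := by
  have h1 : HasDerivAt (fun t : ℝ => ((n : ℝ) + 1) * (1 - t ^ 2)) ((n + 1) * (-2 * t)) t := by
    have := (((hasDerivAt_id t).pow 2).const_sub 1).const_mul ((n : ℝ) + 1)
    simpa using this
  have h2 : DifferentiableAt ℝ Real.smoothTransition ((n + 1) * (1 - t ^ 2)) :=
    (Real.smoothTransition.contDiff (n := 1)).differentiable (by simp) _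
  exact h2.hasDerivAt.comp t h1

lemma deriv_radialCutoff (n : ℕ) (t : ℝ) : deriv (radialCutoff n) t =
    deriv Real.smoothTransition ((n + 1) * (1 - t ^ 2)) * ((n + 1) * (-2 * t)) :=
  (radialCutoff_hasDerivAt n t).deriv

lemma continuous_deriv_radialCutoff (n : ℕ) : Continuous (deriv (radialCutoff n)) := by
  have : deriv (radialCutoff n) = fun t => _ := funext (deriv_radialCutoff n)
  rw [this]
  have h := (Real.smoothTransition.contDiff (n := 1)).continuous_deriv (by simp)
  fun_prop

lemma deriv_radialCutoff_nonpos (n : ℕ) {t : ℝ} (ht : 0 ≤ t) : deriv (radialCutoff n) t ≤ 0 := by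
  rw [deriv_radialCutoff]
  have h1 : 0 ≤ deriv Real.smoothTransition ((n + 1) * (1 - t ^ 2)) :=
    Real.smoothTransition.monotone.deriv_nonneg
  have h2 : ((n : ℝ) + 1) * (-2 * t) ≤ 0 := by
    have : 0 ≤ ((n : ℝ) + 1) * (2 * t) := by positivity
    linarith
  exact mul_nonpos_of_nonneg_of_nonpos h1 h2

lemma deriv_radialCutoff_of_one_le (n : ℕ) {t : ℝ} (ht : 1 ≤ t) : deriv (radialCutoff n) t = 0 := by
  rw [deriv_radialCutoff, deriv_smoothTransition_of_nonpos, zero_mul]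
  refine mul_nonpos_of_nonneg_of_nonpos (by positivity) ?_
  nlinarith

/-- The derivatives of the radial cutoffs concentrate at `1`. -/
lemma tendsto_integral_deriv_radialCutoff {A : ℝ → ℂ} (hA : Continuous A) :
    Tendsto (fun n : ℕ => ∫ t in Ioi (0 : ℝ), (-deriv (radialCutoff n) t) • A t) atTop
      (𝓝 (A 1)) := by
  have h0 : ∀ n : ℕ, ∫ t in Ioi (0 : ℝ), (-deriv (radialCutoff n) t) • A t
      = ∫ t in Ioc (0 : ℝ) 1, (-deriv (radialCutoff n) t) • A t := by
    intro n
    refine (setIntegral_eq_of_subset_of_forall_sdiff_eq_zero measurableSet_Ioi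
      Ioc_subset_Ioi_self fun t ht => ?_)
    have : 1 ≤ t := by
      by_contra h
      exact ht.2 ⟨ht.1, (not_le.1 h).le⟩
    rw [deriv_radialCutoff_of_one_le n this]; simp
  simp only [h0]
  -- The functions `-χ_n'` form an approximate identity at `1` from the left: they are nonnegative,
  -- have total mass `1` on `(0,1]`, and vanish on `(0,1-δ]` as soon as `n + 1 ≥ 1/δ`.
  refine tendsto_setIntegral_peak_smul_of_integrableOn_of_tendsto (t := Ioc (0 : ℝ) 1) (x₀ := 1)
    measurableSet_Ioc measurableSet_Ioc le_rfl self_mem_nhdsWithin (by simp) ?_ ?_ ?_ ?_ ?_ ?_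
  · refine Eventually.of_forall fun n x hx => ?_
    have := deriv_radialCutoff_nonpos n hx.1.le
    linarith
  · intro u hu h1
    obtain ⟨δ, hδ, hball⟩ := Metric.isOpen_iff.1 hu 1 h1
    rw [Metric.tendstoUniformlyOn_iff]
    intro ε hε
    obtain ⟨N, hN⟩ := exists_nat_gt (1 / δ)
    filter_upwards [eventually_ge_atTop N] with n hn t ht
    have h2 : t ≤ 1 - δ := by
      by_contra h
      refine ht.2 (hball ?_)
      rw [Metric.mem_ball, Real.dist_eq, abs_lt]
      constructor <;> linarith [ht.1.2]
    have h3 : deriv (radialCutoff n) t = 0 := by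
      rw [deriv_radialCutoff, deriv_smoothTransition_of_one_le, zero_mul]
      have h4 : (1 / δ) ≤ (n : ℝ) + 1 := by
        have : (N : ℝ) ≤ n := by exact_mod_cast hn
        linarith
      have h5 : δ ≤ 1 - t ^ 2 := by nlinarith [ht.1.1]
      calc (1 : ℝ) = (1 / δ) * δ := by field_simp
        _ ≤ _ := by gcongr
    simp [h3, hε]
  · refine tendsto_const_nhds.congr fun n => ?_
    rw [← intervalIntegral.integral_of_le zero_le_one, intervalIntegral.integral_neg,
      intervalIntegral.integral_deriv_eq_sub (fun x _ => (radialCutoff_hasDerivAt n x).differentiableAt)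
        ((continuous_deriv_radialCutoff n).intervalIntegrable _ _)]
    · have : (1 : ℝ) ≤ n + 1 := by
        have : (0 : ℝ) ≤ n := by positivity
        linarith
      simp [radialCutoff, Real.smoothTransition.one_of_one_le this]
  · exact Eventually.of_forall fun n => (continuous_deriv_radialCutoff n).neg.aestronglyMeasurable
  · exact (hA.continuousOn.integrableOn_compact isCompact_Icc).mono_set Ioc_subset_Icc_self
  · exact hA.continuousWithinAt

lemma pd_radialCutoff_norm (n : ℕ) (i : Fin d) (x : E d) :
    pd i (fun x : E d => ((radialCutoff n ‖x‖ : ℝ) : ℂ)) x =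
      ((deriv Real.smoothTransition ((n + 1) * (1 - ‖x‖ ^ 2)) * ((n + 1) * (-2 * x i)) : ℝ) : ℂ) := by
  have h1 : HasFDerivAt (fun x : E d => ((n : ℝ) + 1) * (1 - ‖x‖ ^ 2))
      (((n : ℝ) + 1) • -(2 • innerSL ℝ x : E d →L[ℝ] ℝ)) x :=
    (((hasStrictFDerivAt_norm_sq x).hasFDerivAt).const_sub 1).const_mul _
  have h2 : DifferentiableAt ℝ Real.smoothTransition ((n + 1) * (1 - ‖x‖ ^ 2)) :=
    (Real.smoothTransition.contDiff (n := 1)).differentiable (by simp) _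
  have h3 := h2.hasDerivAt.comp_hasFDerivAt x h1
  have h4 := Complex.ofRealCLM.hasFDerivAt.comp x h3
  rw [show (fun x : E d => ((radialCutoff n ‖x‖ : ℝ) : ℂ)) = Complex.ofRealCLM ∘
    (Real.smoothTransition ∘ fun x : E d => ((n : ℝ) + 1) * (1 - ‖x‖ ^ 2)) from rfl,
    pd_eq_of_hasFDerivAt h4]
  simp [EuclideanSpace.inner_single_right]

lemma contDiff_radialCutoff_norm (n : ℕ) :
    ContDiff ℝ 1 (fun x : E d => ((radialCutoff n ‖x‖ : ℝ) : ℂ)) := by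
  have h1 : ContDiff ℝ 1 (fun x : E d => ((n : ℝ) + 1) * (1 - ‖x‖ ^ 2)) :=
    contDiff_const.mul (contDiff_const.sub (contDiff_norm_sq ℝ))
  exact Complex.ofRealCLM.contDiff.comp (Real.smoothTransition.contDiff.comp h1)

lemma radialCutoff_eq_zero (n : ℕ) {t : ℝ} (ht : 1 ≤ t) : radialCutoff n t = 0 := by
  refine Real.smoothTransition.zero_of_nonpos (mul_nonpos_of_nonneg_of_nonpos (by positivity) ?_)
  nlinarith

lemma tendsto_radialCutoff {t : ℝ} (ht0 : 0 ≤ t) (ht : t < 1) :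
    Tendsto (fun n => radialCutoff n t) atTop (𝓝 1) := by
  refine tendsto_const_nhds.congr' ?_
  obtain ⟨N, hN⟩ := exists_nat_gt (1 / (1 - t ^ 2))
  filter_upwards [eventually_ge_atTop N] with n hn
  have h5 : 0 < 1 - t ^ 2 := by nlinarith
  refine (Real.smoothTransition.one_of_one_le ?_).symm
  have h4 : 1 / (1 - t ^ 2) ≤ (n : ℝ) + 1 := by
    have : (N : ℝ) ≤ n := by exact_mod_cast hn
    linarith
  calc (1 : ℝ) = (1 / (1 - t ^ 2)) * (1 - t ^ 2) := by field_simp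
        _ ≤ _ := by gcongr

/-- The divergence theorem on the unit ball. -/
theorem integral_div_ball [NeZero d] {F : Fin d → E d → ℂ} (hF : ∀ i, ContDiff ℝ 1 (F i)) :
    ∫ x in ball (0 : E d) 1, ∑ i, pd i (F i) x =
      ∫ θ : S d, ∑ i, ((θ : E d) i : ℂ) * F i θ ∂(surf d) := by
  set χ : ℕ → E d → ℂ := fun n x => ((radialCutoff n ‖x‖ : ℝ) : ℂ) with hχ
  have hχs : ∀ n, HasCompactSupport (χ n) := fun n => by
    refine HasCompactSupport.of_support_subset_isCompact (isCompact_closedBall (0 : E d) 1) ?_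
    intro x hx
    by_contra h
    have h' : 1 ≤ ‖x‖ := by
      rw [mem_closedBall_zero_iff, not_le] at h; exact h.le
    exact hx (by simp [hχ, radialCutoff_eq_zero n h'])
  have cF : ∀ i, Continuous (pd i (F i)) := fun i => (contDiff_pd (m := 0) (hF i) (by simp) i).continuous
  have cχ : ∀ n i, Continuous (pd i (χ n)) := fun n i =>
    (contDiff_pd (m := 0) (contDiff_radialCutoff_norm n) (by simp) i).continuous
  have sχ : ∀ n i, HasCompactSupport (pd i (χ n)) := fun n i =>
    ((hχs n).fderiv (𝕜 := ℝ)).comp_left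
      (g := fun L : E d →L[ℝ] ℂ => L (EuclideanSpace.single i 1)) (by simp)
  -- Integration by parts turns the integral of the divergence against the cutoff into one against
  -- its gradient, which concentrates on the unit sphere.
  have step1 : ∀ n, ∫ x, (∑ i, pd i (F i) x) * χ n x = - ∫ x, ∑ i, F i x * pd i (χ n) x := by
    intro n
    simp only [Finset.sum_mul]
    rw [integral_finsetSum, integral_finsetSum, ← Finset.sum_neg_distrib]
    · refine Finset.sum_congr rfl fun i _ => ?_
      rw [integral_pd_mul_eq_neg (contDiff_radialCutoff_norm n) (hF i) (hχs n) i, neg_neg]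
    · exact fun i _ => ((hF i).continuous.mul (cχ n i)).integrable_of_hasCompactSupport
        (sχ n i).mul_left
    · exact fun i _ => ((cF i).mul (contDiff_radialCutoff_norm n).continuous
        ).integrable_of_hasCompactSupport (hχs n).mul_left
  have lim1 : Tendsto (fun n => ∫ x, (∑ i, pd i (F i) x) * χ n x) atTop
      (𝓝 (∫ x in ball (0 : E d) 1, ∑ i, pd i (F i) x)) := by
    rw [← integral_indicator measurableSet_ball]
    have cs : Continuous fun x => ∑ i, pd i (F i) x := continuous_finsetSum _ fun i _ => cF i
    refine tendsto_integral_of_dominated_convergence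
      ((closedBall (0 : E d) 1).indicator fun x => ‖∑ i, pd i (F i) x‖) ?_ ?_ ?_ ?_
    · exact fun n => (cs.mul (contDiff_radialCutoff_norm n).continuous).aestronglyMeasurable
    · rw [integrable_indicator_iff measurableSet_closedBall]
      exact cs.norm.continuousOn.integrableOn_compact (isCompact_closedBall _ _)
    · refine fun n => Eventually.of_forall fun x => ?_
      by_cases hx : x ∈ closedBall (0 : E d) 1
      · rw [indicator_of_mem hx, norm_mul]
        refine mul_le_of_le_one_right (norm_nonneg _) ?_
        simp only [hχ, Complex.norm_real, Real.norm_eq_abs, radialCutoff]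
        rw [abs_of_nonneg (Real.smoothTransition.nonneg _)]
        exact Real.smoothTransition.le_one _
      · have h' : 1 ≤ ‖x‖ := by
          rw [mem_closedBall_zero_iff, not_le] at hx; exact hx.le
        simp [hχ, radialCutoff_eq_zero n h', indicator_of_notMem hx]
    · refine Eventually.of_forall fun x => ?_
      by_cases hx : x ∈ ball (0 : E d) 1
      · rw [indicator_of_mem hx]
        have := (tendsto_radialCutoff (norm_nonneg x) (mem_ball_zero_iff.1 hx)).ofReal
        simpa [hχ] using this.const_mul (∑ i, pd i (F i) x)
      · have h' : 1 ≤ ‖x‖ := by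
          rw [mem_ball_zero_iff, not_lt] at hx; exact hx
        simp [hχ, radialCutoff_eq_zero _ h', indicator_of_notMem hx]
  -- `A t` is the flux of `F` through the sphere of radius `t`; the factor `t^(d-1)` comes from
  -- polar coordinates, and `A 1` is the desired boundary integral.
  set A : ℝ → ℂ := fun t => ((t ^ (d - 1) : ℝ) : ℂ) *
    ∫ θ : S d, ∑ i, ((θ : E d) i : ℂ) * F i (t • (θ : E d)) ∂(surf d) with hA
  have cA : Continuous A := by
    refine Continuous.mul (by fun_prop) ?_
    have : Continuous (Function.uncurry fun (t : ℝ) (θ : S d) =>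
        ∑ i, ((θ : E d) i : ℂ) * F i (t • (θ : E d))) := by
      refine continuous_finsetSum _ fun i _ => Continuous.mul ?_ ?_
      · fun_prop
      · exact (hF i).continuous.comp (by fun_prop)
    have h := continuous_parametric_integral_of_continuous (μ := surf d) this isCompact_univ
    simpa using h
  have step2 : ∀ n, ∫ x, (∑ i, pd i (F i) x) * χ n x =
      ∫ t in Ioi (0 : ℝ), (-deriv (radialCutoff n) t) • A t := by
    intro n
    rw [step1, integral_polar, ← integral_neg]
    · refine setIntegral_congr_fun measurableSet_Ioi fun t ht => ?_
      have ht' : (0 : ℝ) < t := ht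
      simp only [hA]
      rw [neg_smul, neg_inj, ← integral_smul, deriv_radialCutoff, Complex.real_smul,
        ← integral_const_mul, ← integral_const_mul]
      refine integral_congr_ae (Eventually.of_forall fun θ => ?_)
      simp only [hχ, pd_radialCutoff_norm, Finset.mul_sum, Complex.real_smul]
      refine Finset.sum_congr rfl fun i _ => ?_
      have : ‖t • (θ : E d)‖ = t := by
        rw [norm_smul, Real.norm_of_nonneg ht'.le]; simp
      rw [this]
      push_cast
      simp
      ring
    · refine Continuous.integrable_of_hasCompactSupport ?_ ?_
      · exact continuous_finsetSum _ fun i _ => (hF i).continuous.mul (cχ n i)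
      · refine HasCompactSupport.of_support_subset_isCompact (isCompact_closedBall (0 : E d) 1) ?_
        intro x hx
        by_contra h
        refine hx (Finset.sum_eq_zero fun i _ => ?_)
        rw [mem_closedBall_zero_iff, not_le] at h
        simp only [hχ]
        rw [pd_radialCutoff_norm, deriv_smoothTransition_of_nonpos]
        · simp
        · refine mul_nonpos_of_nonneg_of_nonpos (by positivity) ?_
          nlinarith
  have lim2 := tendsto_integral_deriv_radialCutoff cA
  simp only [← step2] at lim2
  have := tendsto_nhds_unique lim1 lim2
  simpa [hA] using this

/-- The divergence theorem on a ball. -/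
lemma integral_div_ball_general [NeZero d] {F : Fin d → E d → ℂ} (hF : ∀ i, ContDiff ℝ 1 (F i))
    (c : E d) {s : ℝ} (hs : 0 < s) :
    ∫ x in ball c s, ∑ i, pd i (F i) x =
      ((s ^ (d - 1) : ℝ) : ℂ) *
        ∫ θ : S d, ∑ i, ((θ : E d) i : ℂ) * F i (c + s • (θ : E d)) ∂(surf d) := by
  have haff : ∀ x : E d, HasFDerivAt (fun x : E d => c + s • x) (s • ContinuousLinearMap.id ℝ (E d)) x :=
    fun x => (((hasFDerivAt_id x).const_smul s).const_add c)
  have hcd : ContDiff ℝ 1 (fun x : E d => c + s • x) := by fun_prop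
  have hpd : ∀ i x, pd i (fun x => F i (c + s • x)) x = s * pd i (F i) (c + s • x) := by
    intro i x
    have h := (((hF i).differentiable (by simp)) (c + s • x)).hasFDerivAt.comp x (haff x)
    rw [show (fun x => F i (c + s • x)) = F i ∘ (fun x => c + s • x) from rfl,
      pd_eq_of_hasFDerivAt h]
    simp [pd]
  have h1 := integral_div_ball (F := fun i x => F i (c + s • x)) (fun i => (hF i).comp hcd)
  simp only [hpd, ← Finset.mul_sum] at h1
  rw [← h1, integral_const_mul]
  have h2 : ∫ x in ball (0 : E d) 1, (fun y => ∑ i, pd i (F i) y) (c + s • x) =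
      ((s ^ d)⁻¹ : ℝ) • ∫ x in ball c s, ∑ i, pd i (F i) x := by
    rw [← integral_indicator measurableSet_ball, ← integral_indicator measurableSet_ball]
    have h3 := Measure.integral_comp_smul (volume : Measure (E d))
      (fun y => (ball c s).indicator (fun y => ∑ i, pd i (F i) y) (c + y)) s
    rw [integral_add_left_eq_self
      (fun y => (ball c s).indicator (fun y => ∑ i, pd i (F i) y) y) c] at h3
    rw [finrank_euclideanSpace, Fintype.card_fin, abs_of_nonneg (by positivity)] at h3
    rw [← h3]
    refine integral_congr_ae (Eventually.of_forall fun x => ?_)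
    have hiff : x ∈ ball (0 : E d) 1 ↔ c + s • x ∈ ball c s := by
      rw [mem_ball_zero_iff, mem_ball_iff_norm, add_sub_cancel_left, norm_smul,
        Real.norm_of_nonneg hs.le]
      constructor
      · intro h; nlinarith
      · intro h; by_contra h'; nlinarith
    by_cases hx : x ∈ ball (0 : E d) 1
    · simp only [indicator_of_mem hx, indicator_of_mem (hiff.1 hx)]
    · simp only [indicator_of_notMem hx, indicator_of_notMem (fun h => hx (hiff.2 h))]
  rw [h2, Complex.real_smul, ← mul_assoc, ← mul_assoc]
  have hd : (s : ℝ) ^ d = s ^ (d - 1) * s := by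
    rw [← pow_succ, Nat.sub_add_cancel (Nat.one_le_iff_ne_zero.2 (NeZero.ne d))]
  rw [hd]
  have : (s : ℂ) ≠ 0 := by exact_mod_cast hs.ne'
  push_cast
  field_simp

end Divergence

end DepthEIT

namespace DepthEIT

variable {d : ℕ}

/-! ### Green's identities on balls -/

section Green

open Set Metric

lemma integrableOn_ball_of_continuous {f : E d → ℂ} (hf : Continuous f) (c : E d) (s : ℝ) :
    IntegrableOn f (ball c s) :=
  (hf.continuousOn.integrableOn_compact (isCompact_closedBall c s)).mono_set ball_subset_closedBall

/-- Green's first identity on a ball. -/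
theorem green_ball [NeZero d] {v Φ : E d → ℂ} (hv : ContDiff ℝ ∞ v) (hΦ : ContDiff ℝ ∞ Φ)
    (c : E d) {s : ℝ} (hs : 0 < s) :
    ∫ x in ball c s, ∑ i, pd i v x * pd i Φ x =
      ((s ^ (d - 1) : ℝ) : ℂ) * ∫ θ : S d, v (c + s • (θ : E d)) *
        fderiv ℝ Φ (c + s • (θ : E d)) θ ∂(surf d) - ∫ x in ball c s, v x * lap Φ x := by
  have h := integral_div_ball_general (F := fun i x => v x * pd i Φ x)
    (fun i => (hv.mul (contDiff_pd_infty hΦ i)).of_le (by exact_mod_cast le_top)) c hs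
  have h1 : ∀ x, ∑ i, pd i (fun x => v x * pd i Φ x) x =
      (∑ i, pd i v x * pd i Φ x) + v x * lap Φ x := by
    intro x
    rw [lap, Finset.mul_sum, ← Finset.sum_add_distrib]
    exact Finset.sum_congr rfl fun i _ => pd_mul i (hv.differentiable (by simp) x)
      ((contDiff_pd_infty hΦ i).differentiable (by simp) x)
  simp only [h1] at h
  rw [integral_add, ← eq_sub_iff_add_eq] at h
  · rw [h]
    congr 3
    ext θ
    rw [← sum_pd_mul_coord, Finset.mul_sum]
    exact Finset.sum_congr rfl fun i _ => by ring
  · exact integrableOn_ball_of_continuous (continuous_finsetSum _ fun i _ =>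
      (continuous_pd hv i).mul (continuous_pd hΦ i)) c s
  · exact integrableOn_ball_of_continuous (hv.continuous.mul (continuous_lap hΦ)) c s

theorem green_unit_ball [NeZero d] {v Φ : E d → ℂ} (hv : ContDiff ℝ ∞ v) (hΦ : ContDiff ℝ ∞ Φ) :
    ∫ x in ball (0 : E d) 1, ∑ i, pd i v x * pd i Φ x =
      ∫ θ : S d, v θ * fderiv ℝ Φ θ θ ∂(surf d) - ∫ x in ball (0 : E d) 1, v x * lap Φ x := by
  simpa using green_ball hv hΦ 0 one_pos

/-- The normal derivatives of harmonic functions are symmetric. -/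
theorem integral_mul_fderiv_comm [NeZero d] {v Φ : E d → ℂ} (hv : ContDiff ℝ ∞ v)
    (hΦ : ContDiff ℝ ∞ Φ) (lv : ∀ x ∈ ball (0 : E d) 1, lap v x = 0)
    (lΦ : ∀ x ∈ ball (0 : E d) 1, lap Φ x = 0) :
    ∫ θ : S d, v θ * fderiv ℝ Φ θ θ ∂(surf d) = ∫ θ : S d, Φ θ * fderiv ℝ v θ θ ∂(surf d) := by
  have z : ∀ {f g : E d → ℂ}, (∀ x ∈ ball (0 : E d) 1, lap g x = 0) →
      ∫ x in ball (0 : E d) 1, f x * lap g x = 0 := fun h =>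
    setIntegral_eq_zero_of_forall_eq_zero fun x hx => by rw [h x hx, mul_zero]
  have h1 := green_unit_ball hv hΦ
  have h2 := green_unit_ball hΦ hv
  rw [z lΦ, sub_zero] at h1
  rw [z lv, sub_zero] at h2
  rw [← h1, ← h2]
  simp only [mul_comm]

end Green

/-! ### Harmonic polynomials and their decomposition on the sphere -/

section Polynomials

open MvPolynomial

/-- The polynomial function attached to a polynomial. -/
noncomputable def ev (P : MvPolynomial (Fin d) ℂ) (x : E d) : ℂ := eval (fun i => (x i : ℂ)) P

@[simp] lemma ev_add (P Q : MvPolynomial (Fin d) ℂ) (x : E d) : ev (P + Q) x = ev P x + ev Q x := by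
  simp [ev]

@[simp] lemma ev_sub (P Q : MvPolynomial (Fin d) ℂ) (x : E d) : ev (P - Q) x = ev P x - ev Q x := by
  simp [ev]

@[simp] lemma ev_mul (P Q : MvPolynomial (Fin d) ℂ) (x : E d) : ev (P * Q) x = ev P x * ev Q x := by
  simp [ev]

@[simp] lemma ev_pow (P : MvPolynomial (Fin d) ℂ) (n : ℕ) (x : E d) : ev (P ^ n) x = ev P x ^ n := by
  simp [ev]

@[simp] lemma ev_C (c : ℂ) (x : E d) : ev (C c) x = c := by simp [ev]

@[simp] lemma ev_X (i : Fin d) (x : E d) : ev (X i) x = x i := by simp [ev]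

@[simp] lemma ev_zero (x : E d) : ev 0 x = 0 := by simp [ev]

@[simp] lemma ev_one (x : E d) : ev 1 x = 1 := by simp [ev]

lemma ev_sum {ι : Type*} (s : Finset ι) (P : ι → MvPolynomial (Fin d) ℂ) (x : E d) :
    ev (∑ j ∈ s, P j) x = ∑ j ∈ s, ev (P j) x := by simp [ev]

lemma contDiff_coord (i : Fin d) : ContDiff ℝ ∞ (fun x : E d => (x i : ℂ)) :=
  Complex.ofRealCLM.contDiff.comp (EuclideanSpace.proj (𝕜 := ℝ) i).contDiff

lemma contDiff_ev (P : MvPolynomial (Fin d) ℂ) : ContDiff ℝ ∞ (ev P) := by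
  induction P using MvPolynomial.induction_on with
  | C a =>
    rw [show ev (C a : MvPolynomial (Fin d) ℂ) = fun _ => a from funext (ev_C a)]
    exact contDiff_const
  | add P Q hP hQ =>
    rw [show ev (P + Q) = fun x => ev P x + ev Q x from funext (ev_add P Q)]
    exact hP.add hQ
  | mul_X P i hP =>
    rw [show ev (P * X i) = fun x => ev P x * (x i : ℂ) from funext fun x => by simp]
    exact hP.mul (contDiff_coord i)

lemma differentiableAt_ev (P : MvPolynomial (Fin d) ℂ) (x : E d) : DifferentiableAt ℝ (ev P) x :=
  (contDiff_ev P).differentiable (by simp) x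

lemma pd_coord (i j : Fin d) (x : E d) :
    pd i (fun x : E d => (x j : ℂ)) x = if i = j then 1 else 0 := by
  have h := Complex.ofRealCLM.hasFDerivAt.comp x (EuclideanSpace.proj j : E d →L[ℝ] ℝ).hasFDerivAt
  rw [show (fun x : E d => (x j : ℂ)) =
    Complex.ofRealCLM ∘ (EuclideanSpace.proj j : E d →L[ℝ] ℝ) from rfl]
  rw [pd_eq_of_hasFDerivAt h]
  by_cases hij : i = j <;> simp [hij, eq_comm]

lemma pd_ev (i : Fin d) (P : MvPolynomial (Fin d) ℂ) (x : E d) :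
    pd i (ev P) x = ev (pderiv i P) x := by
  induction P using MvPolynomial.induction_on with
  | C a =>
    rw [show ev (C a : MvPolynomial (Fin d) ℂ) = fun _ => a from funext (ev_C a), pd_const]
    simp
  | add P Q hP hQ =>
    rw [show ev (P + Q) = fun x => ev P x + ev Q x from funext (ev_add P Q),
      pd_add i (differentiableAt_ev P x) (differentiableAt_ev Q x), hP, hQ]
    simp
  | mul_X P j hP =>
    rw [show ev (P * X j) = fun x => ev P x * (x j : ℂ) from funext fun x => by simp,
      pd_mul i (differentiableAt_ev P x) ((contDiff_coord j).differentiable (by simp) x), hP, pd_coord]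
    by_cases h : i = j
    · subst h; simp; ring
    · simp [pderiv_X_of_ne (Ne.symm h), h]; ring

/-- The Laplacian on polynomials. -/
noncomputable def lapP : MvPolynomial (Fin d) ℂ →ₗ[ℂ] MvPolynomial (Fin d) ℂ :=
  ∑ i, (pderiv i).toLinearMap ∘ₗ (pderiv i).toLinearMap

lemma lapP_apply (P : MvPolynomial (Fin d) ℂ) : lapP P = ∑ i, pderiv i (pderiv i P) := by
  simp [lapP]

lemma lap_ev (P : MvPolynomial (Fin d) ℂ) (x : E d) : lap (ev P) x = ev (lapP P) x := by
  rw [lap, lapP_apply, ev_sum]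
  refine Finset.sum_congr rfl fun i _ => ?_
  rw [show pd i (ev P) = ev (pderiv i P) from funext (pd_ev i P), pd_ev]

/-- The polynomial `|x|²`. -/
noncomputable def normSqP (d : ℕ) : MvPolynomial (Fin d) ℂ := ∑ i, X i ^ 2

lemma ev_normSqP (x : E d) : ev (normSqP d) x = ((‖x‖ ^ 2 : ℝ) : ℂ) := by
  rw [normSqP, ev_sum, EuclideanSpace.norm_sq_eq]
  simp

lemma isHomogeneous_normSqP : (normSqP d).IsHomogeneous 2 :=
  IsHomogeneous.sum _ _ _ fun i _ => isHomogeneous_X_pow i 2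

lemma lapP_isHomogeneous {P : MvPolynomial (Fin d) ℂ} {n : ℕ} (h : P.IsHomogeneous n) :
    (lapP P).IsHomogeneous (n - 2) := by
  rw [lapP_apply]
  exact IsHomogeneous.sum _ _ _ fun i _ => by simpa [Nat.sub_sub] using h.pderiv.pderiv

lemma pderiv_normSqP (i : Fin d) : pderiv i (normSqP d) = 2 * X i := by
  classical
  rw [normSqP, map_sum, Finset.sum_eq_single i]
  · rw [pow_two, pderiv_mul, pderiv_X_self]; ring
  · intro j _ hj
    rw [pow_two, pderiv_mul, pderiv_X_of_ne hj]; ring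
  · simp

/-- The product rule has the cross term `4 ∑ x_i ∂_i Q`, and Euler's identity makes it `4mQ`. This
commutation relation drives the harmonic decomposition. -/
lemma lapP_normSqP_mul {Q : MvPolynomial (Fin d) ℂ} {m : ℕ} (h : Q.IsHomogeneous m) :
    lapP (normSqP d * Q) = (2 * d + 4 * m : ℂ) • Q + normSqP d * lapP Q := by
  have h2 : ∀ i : Fin d, pderiv i (2 : MvPolynomial (Fin d) ℂ) = 0 := fun i => by
    have := (pderiv i : Derivation ℂ (MvPolynomial (Fin d) ℂ) _).map_natCast 2
    simpa using this
  have h1 : ∀ i : Fin d, pderiv i (pderiv i (normSqP d * Q)) =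
      2 * Q + 4 * (X i * pderiv i Q) + normSqP d * pderiv i (pderiv i Q) := by
    intro i
    simp only [pderiv_mul, map_add, pderiv_normSqP, pderiv_X_self, h2]
    ring
  rw [lapP_apply, lapP_apply]
  simp only [h1, Finset.sum_add_distrib, ← Finset.mul_sum, h.sum_X_mul_pderiv]
  simp [add_smul, smul_eq_C_mul, show (C 2 : MvPolynomial (Fin d) ℂ) = 2 from map_ofNat C 2,
    show (C 4 : MvPolynomial (Fin d) ℂ) = 4 from map_ofNat C 4]
  ring

/-- `P` is a homogeneous harmonic polynomial of degree `n`. -/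
def IsHarm (n : ℕ) (P : MvPolynomial (Fin d) ℂ) : Prop := P.IsHomogeneous n ∧ lapP P = 0

/-- The operator `a + |x|²Δ` is surjective in each degree. The ansatz `Q = a⁻¹P + |x|²Q'` reduces
the equation to `(a + 2d + 4(m-2))Q' + |x|²ΔQ' = -a⁻¹ΔP`, which has the same form in degree `m - 2`
with a constant that is again positive. The induction therefore quantifies over `a`. -/
lemma exists_smul_add_normSqP_mul_lapP (m : ℕ) : ∀ (a : ℝ) (_ : 0 < a) (P : MvPolynomial (Fin d) ℂ),
    P.IsHomogeneous m → ∃ Q : MvPolynomial (Fin d) ℂ, Q.IsHomogeneous m ∧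
      (a : ℂ) • Q + normSqP d * lapP Q = P := by
  induction m using Nat.strong_induction_on with
  | _ m ih =>
    intro a ha P hP
    have ha' : (a : ℂ) ≠ 0 := by exact_mod_cast ha.ne'
    by_cases hm : m < 2
    · have h0 : lapP P = 0 := by
        rw [lapP_apply]
        refine Finset.sum_eq_zero fun i _ => ?_
        have h1 := hP.pderiv (i := i)
        rw [show m - 1 = 0 by omega, ← totalDegree_zero_iff_isHomogeneous,
          totalDegree_eq_zero_iff_eq_C] at h1
        rw [h1, pderiv_C]
      refine ⟨(a : ℂ)⁻¹ • P, ?_, ?_⟩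
      · rw [smul_eq_C_mul]; exact hP.C_mul _
      · rw [map_smul, h0, smul_smul, mul_inv_cancel₀ ha']; simp
    · obtain ⟨Q, hQ, hQe⟩ := ih (m - 2) (by omega) (a + 2 * d + 4 * (m - 2 : ℕ)) (by positivity)
        (-(a : ℂ)⁻¹ • lapP P) (by rw [smul_eq_C_mul]; exact (lapP_isHomogeneous hP).C_mul _)
      refine ⟨(a : ℂ)⁻¹ • P + normSqP d * Q, ?_, ?_⟩
      · refine IsHomogeneous.add (by rw [smul_eq_C_mul]; exact hP.C_mul _) ?_
        have := isHomogeneous_normSqP.mul hQ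
        rwa [show 2 + (m - 2) = m by omega] at this
      · have e1 : normSqP d * ((a + 2 * d + 4 * (m - 2 : ℕ) : ℂ) • Q + normSqP d * lapP Q) =
            normSqP d * (-(a : ℂ)⁻¹ • lapP P) := by
          rw [← hQe]; push_cast; rfl
        rw [map_add, map_smul, lapP_normSqP_mul hQ, smul_add, smul_smul, mul_inv_cancel₀ ha', one_smul]
        simp only [smul_eq_C_mul, map_add, map_neg] at e1 ⊢
        linear_combination e1

/-- For `n ≥ 2` it suffices to solve `Δ(|x|²Q) = ΔP`, an equation of the form just treated. For `n <
2` the polynomial `P` is itself harmonic; `Q = 0` is recorded because `n - 2` is truncated there. -/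
lemma exists_harm_add_normSqP_mul [NeZero d] {n : ℕ} {P : MvPolynomial (Fin d) ℂ}
    (hP : P.IsHomogeneous n) : ∃ h Q : MvPolynomial (Fin d) ℂ, IsHarm n h ∧ Q.IsHomogeneous (n - 2) ∧
      P = h + normSqP d * Q ∧ (n < 2 → Q = 0) := by
  by_cases hn : n < 2
  · refine ⟨P, 0, ⟨hP, ?_⟩, isHomogeneous_zero _ _ _, by simp, fun _ => rfl⟩
    rw [lapP_apply]
    refine Finset.sum_eq_zero fun i _ => ?_
    have h1 := hP.pderiv (i := i)
    rw [show n - 1 = 0 by omega, ← totalDegree_zero_iff_isHomogeneous,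
      totalDegree_eq_zero_iff_eq_C] at h1
    rw [h1, pderiv_C]
  · have hd : 0 < d := Nat.pos_of_ne_zero (NeZero.ne d)
    obtain ⟨Q, hQ, hQe⟩ := exists_smul_add_normSqP_mul_lapP (n - 2) (2 * d + 4 * (n - 2 : ℕ))
      (by positivity) (lapP P) (lapP_isHomogeneous hP)
    refine ⟨P - normSqP d * Q, Q, ⟨?_, ?_⟩, hQ, by ring, fun h => absurd h hn⟩
    · refine hP.sub ?_
      have := isHomogeneous_normSqP.mul hQ
      rwa [show 2 + (n - 2) = n by omega] at this
    · rw [map_sub, lapP_normSqP_mul hQ, ← hQe]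
      push_cast
      simp

/-- On the unit sphere, every polynomial is a sum of harmonic homogeneous polynomials. -/
theorem sphere_harmonic_induction [NeZero d] {p : (S d → ℂ) → Prop}
    (add : ∀ f g, p f → p g → p (fun θ => f θ + g θ))
    (harm : ∀ (n : ℕ) (P : MvPolynomial (Fin d) ℂ), IsHarm n P → p (fun θ : S d => ev P θ)) (P : MvPolynomial (Fin d) ℂ) :
    p (fun θ : S d => ev P θ) := by
  have hom : ∀ n (P : MvPolynomial (Fin d) ℂ), P.IsHomogeneous n → p (fun θ : S d => ev P θ) := by
    intro n
    induction n using Nat.strong_induction_on with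
    | _ n ih =>
      intro P hP
      obtain ⟨h, Q, hh, hQ, e, h2⟩ := exists_harm_add_normSqP_mul hP
      by_cases hn : n < 2
      · rw [e, h2 hn, mul_zero, add_zero]; exact harm n h hh
      · have e' : (fun θ : S d => ev P θ) = fun θ : S d => ev h θ + ev Q θ := by
          ext θ; rw [e]; simp [ev_normSqP]
        rw [e']
        exact add _ _ (harm n h hh) (ih (n - 2) (by omega) Q hQ)
  rw [← sum_homogeneousComponent P]
  have : ∀ s : Finset ℕ, p (fun θ : S d => ev (∑ i ∈ s, homogeneousComponent i P) θ) := by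
    intro s
    induction s using Finset.induction_on with
    | empty => simpa using hom 0 0 (isHomogeneous_zero _ _ _)
    | insert a s ha ih =>
      simp only [Finset.sum_insert ha, ev_add]
      exact add _ _ (hom a _ (homogeneousComponent_isHomogeneous a P)) ih
  exact this _

lemma IsHarm.lap_eq_zero {n : ℕ} {P : MvPolynomial (Fin d) ℂ} (h : IsHarm n P) (x : E d) :
    lap (ev P) x = 0 := by rw [lap_ev, h.2, ev_zero]

lemma fderiv_ev_self {n : ℕ} {P : MvPolynomial (Fin d) ℂ} (h : P.IsHomogeneous n) (x : E d) :
    fderiv ℝ (ev P) x x = n * ev P x := by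
  rw [← sum_pd_mul_coord]
  simp only [pd_ev]
  have := congrArg (fun Q => ev Q x) h.sum_X_mul_pderiv
  have e : ev (n : MvPolynomial (Fin d) ℂ) x = n := by simp [ev]
  simpa [ev_sum, e] using this

/-- By Euler's identity the normal derivatives on the unit sphere are `nP` and `mQ`, so Green's
symmetry gives `(m - n)∫PQ = 0`. -/
lemma integral_harm_mul_harm [NeZero d] {n m : ℕ} (hnm : n ≠ m) {P Q : MvPolynomial (Fin d) ℂ}
    (hP : IsHarm n P) (hQ : IsHarm m Q) : ∫ θ : S d, ev P θ * ev Q θ ∂(surf d) = 0 := by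
  have h := integral_mul_fderiv_comm (contDiff_ev P) (contDiff_ev Q) (fun x _ => hP.lap_eq_zero x)
    (fun x _ => hQ.lap_eq_zero x)
  simp only [fderiv_ev_self hP.1, fderiv_ev_self hQ.1] at h
  have e1 : ∀ θ : S d, ev P θ * (m * ev Q θ) = (m : ℂ) * (ev P θ * ev Q θ) := fun θ => by ring
  have e2 : ∀ θ : S d, ev Q θ * (n * ev P θ) = (n : ℂ) * (ev P θ * ev Q θ) := fun θ => by ring
  simp only [e1, e2, integral_const_mul] at h
  have h3 : ((m : ℂ) - n) * ∫ θ : S d, ev P θ * ev Q θ ∂(surf d) = 0 := by rw [sub_mul, h, sub_self]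
  refine (mul_eq_zero.1 h3).resolve_left (sub_ne_zero.2 ?_)
  exact_mod_cast hnm.symm

/-- The power `(x₀ + i x₁)^n` provides, in every degree, a harmonic polynomial that does not vanish
on the sphere. It is harmonic because the gradient of the linear form is isotropic. -/
lemma isHarm_pow_add_I_mul (hd : 2 ≤ d) (n : ℕ) :
    IsHarm n ((X ⟨0, by omega⟩ + C Complex.I * X ⟨1, by omega⟩ : MvPolynomial (Fin d) ℂ) ^ n) := by
  set L : MvPolynomial (Fin d) ℂ := X ⟨0, by omega⟩ + C Complex.I * X ⟨1, by omega⟩ with hL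
  have hLh : L.IsHomogeneous 1 := (isHomogeneous_X _ _).add (by
    simpa using (isHomogeneous_X ℂ (⟨1, by omega⟩ : Fin d)).C_mul Complex.I)
  refine ⟨by simpa using hLh.pow n, ?_⟩
  have hc : ∀ i, ∃ c : ℂ, pderiv i L = C c := by
    intro i
    have h1 := hLh.pderiv (i := i)
    rw [Nat.sub_self, ← totalDegree_zero_iff_isHomogeneous, totalDegree_eq_zero_iff_eq_C] at h1
    exact ⟨_, h1⟩
  choose c hc using hc
  -- This is `1 + i² = 0`; all the remaining partial derivatives of the linear form are zero.
  have key : ∑ i, C (c i) ^ 2 = (0 : MvPolynomial (Fin d) ℂ) := by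
    have h01 : (⟨0, by omega⟩ : Fin d) ≠ ⟨1, by omega⟩ := by simp
    have hi : ∀ i, pderiv i L = (if i = ⟨0, by omega⟩ then 1 else 0) +
        C Complex.I * (if i = ⟨1, by omega⟩ then 1 else 0) := by
      intro i
      rw [hL, map_add, pderiv_mul, pderiv_C, zero_mul, zero_add, pderiv_X, pderiv_X]
      simp [Pi.single_apply, eq_comm]
    rw [← Finset.sum_subset (Finset.subset_univ {⟨0, by omega⟩, ⟨1, by omega⟩}), Finset.sum_pair h01]
    · rw [← hc, ← hc, hi, hi]
      simp only [if_true, if_neg h01, if_neg h01.symm]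
      have : (C Complex.I : MvPolynomial (Fin d) ℂ) ^ 2 = -1 := by
        rw [← C_pow, Complex.I_sq, map_neg, C_1]
      linear_combination this
    · intro i _ hi'
      rw [Finset.mem_insert, Finset.mem_singleton, not_or] at hi'
      rw [← hc, hi, if_neg hi'.1, if_neg hi'.2]; ring
  rw [lapP_apply]
  have : ∀ i, pderiv i (pderiv i (L ^ n)) = (n * (n - 1 : ℕ) : MvPolynomial (Fin d) ℂ) * L ^ (n - 1 - 1) * C (c i) ^ 2 := by
    intro i
    rw [Derivation.leibniz_pow, hc, Derivation.map_smul_of_tower, smul_eq_mul, Derivation.leibniz, pderiv_C, Derivation.leibniz_pow, hc]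
    simp
    ring
  simp only [this, ← Finset.mul_sum, key, mul_zero]

lemma isHarm_one : IsHarm 0 (1 : MvPolynomial (Fin d) ℂ) :=
  ⟨isHomogeneous_one _ _, by simp [lapP_apply]⟩

/-- The complex conjugate polynomial. -/
noncomputable def conjP : MvPolynomial (Fin d) ℂ →+* MvPolynomial (Fin d) ℂ := map (starRingEnd ℂ)

lemma ev_conjP (P : MvPolynomial (Fin d) ℂ) (x : E d) : ev (conjP P) x = starRingEnd ℂ (ev P x) := by
  rw [ev, ev, conjP, eval_map, eval, coe_eval₂Hom, hom_eval₂]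
  simp

lemma IsHarm.conjP {n : ℕ} {P : MvPolynomial (Fin d) ℂ} (h : IsHarm n P) : IsHarm n (conjP P) := by
  refine ⟨h.1.map _, ?_⟩
  have : lapP (DepthEIT.conjP P) = DepthEIT.conjP (lapP P) := by
    simp only [lapP_apply, map_sum, DepthEIT.conjP, pderiv_map]
  rw [this, h.2, map_zero]

end Polynomials

end DepthEIT

namespace DepthEIT

variable {d : ℕ}

/-! ### Density of polynomials in `L²(∂𝔹)` and the bilinear pairing -/

section L2

/-- The inclusion of continuous functions into `L²(∂𝔹)`. -/
noncomputable abbrev toL2 : C(S d, ℂ) →L[ℂ] L2S d := ContinuousMap.toLp 2 (surf d) ℂ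

lemma coeFn_toL2 (g : C(S d, ℂ)) : toL2 g =ᵐ[surf d] g := ContinuousMap.coeFn_toLp _ g

/-- The restriction of a polynomial to the unit sphere. -/
noncomputable def evS (P : MvPolynomial (Fin d) ℂ) : C(S d, ℂ) :=
  ⟨fun θ => ev P θ, (contDiff_ev P).continuous.comp continuous_subtype_val⟩

@[simp] lemma evS_apply (P : MvPolynomial (Fin d) ℂ) (θ : S d) : evS P θ = ev P θ := rfl

lemma toL2_denseRange : DenseRange (toL2 : C(S d, ℂ) → L2S d) :=
  ContinuousMap.toLp_denseRange _ _ _ (by simp)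

/-- Stone–Weierstrass applies: conjugating the coefficients keeps polynomials closed under complex
conjugation, and the coordinates separate points. -/
lemma evS_denseRange : DenseRange (evS : MvPolynomial (Fin d) ℂ → C(S d, ℂ)) := by
  let A : StarSubalgebra ℂ C(S d, ℂ) :=
    { carrier := Set.range evS
      mul_mem' := by
        rintro _ _ ⟨P, rfl⟩ ⟨Q, rfl⟩
        exact ⟨P * Q, by ext θ; simp⟩
      add_mem' := by
        rintro _ _ ⟨P, rfl⟩ ⟨Q, rfl⟩
        exact ⟨P + Q, by ext θ; simp⟩
      algebraMap_mem' := fun c => ⟨MvPolynomial.C c, by ext θ; simp⟩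
      star_mem' := by
        rintro _ ⟨P, rfl⟩
        exact ⟨conjP P, by ext θ; simp [ev_conjP]⟩ }
  have hA : A.SeparatesPoints := by
    intro x y hxy
    obtain ⟨i, hi⟩ : ∃ i, (x : E d) i ≠ (y : E d) i := by
      by_contra! h
      exact hxy (Subtype.ext (by ext i; exact h i))
    exact ⟨_, ⟨evS (MvPolynomial.X i), ⟨_, rfl⟩, rfl⟩, by simpa using hi⟩
  have h := ContinuousMap.starSubalgebra_topologicalClosure_eq_top_of_separatesPoints A hA
  intro g
  have : g ∈ (A.topologicalClosure : Set C(S d, ℂ)) := by rw [h]; trivial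
  rwa [StarSubalgebra.topologicalClosure_coe] at this

lemma toL2_evS_denseRange :
    DenseRange (fun P : MvPolynomial (Fin d) ℂ => (toL2 (evS P) : L2S d)) :=
  toL2_denseRange.comp evS_denseRange toL2.continuous

lemma L2_induction {p : L2S d → Prop} (hc : IsClosed {f | p f})
    (h : ∀ P : MvPolynomial (Fin d) ℂ, p (toL2 (evS P))) (f : L2S d) : p f :=
  toL2_evS_denseRange.induction_on f hc h

lemma evS_induction [NeZero d] {p : C(S d, ℂ) → Prop} (add : ∀ f g, p f → p g → p (f + g))
    (harm : ∀ (n : ℕ) (P : MvPolynomial (Fin d) ℂ), IsHarm n P → p (evS P))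
    (P : MvPolynomial (Fin d) ℂ) : p (evS P) := by
  obtain ⟨_, h⟩ := sphere_harmonic_induction
    (p := fun g => ∃ hg : Continuous g, p ⟨g, hg⟩)
    (fun f g ⟨hf, pf⟩ ⟨hg, pg⟩ => ⟨hf.add hg, add _ _ pf pg⟩)
    (fun n P hP => ⟨(evS P).continuous, harm n P hP⟩) P
  exact h

/-- Spherical harmonics span the polynomials on the sphere, which are dense. Checking identities of
bounded operators on them replaces the choice of an orthonormal basis. -/
lemma L2_ext_harm [NeZero d] {F : Type*} [NormedAddCommGroup F] [NormedSpace ℂ F]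
    {T T' : L2S d →L[ℂ] F}
    (h : ∀ (n : ℕ) (P : MvPolynomial (Fin d) ℂ), IsHarm n P → T (toL2 (evS P)) = T' (toL2 (evS P))) :
    T = T' := by
  ext1 f
  refine L2_induction (p := fun f => T f = T' f) (isClosed_eq T.continuous T'.continuous) ?_ f
  intro P
  exact evS_induction (p := fun g => T (toL2 g) = T' (toL2 g))
    (fun f g hf hg => by rw [map_add, map_add, map_add, hf, hg]) h P

/-- The bilinear pairing on `L²(∂𝔹)`. -/
noncomputable def pair (f g : L2S d) : ℂ := ∫ θ, f θ * g θ ∂(surf d)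

/-- Neumann traces act on test functions without conjugation, so symmetry is expressed with the
bilinear pairing. This relation transfers the Hilbert space facts to it. -/
lemma pair_eq_inner (f g : L2S d) : pair f g = inner ℂ (star f) g := by
  rw [L2.inner_def, pair]
  refine integral_congr_ae ?_
  filter_upwards [Lp.coeFn_star f] with θ hθ
  rw [hθ]
  simp [mul_comm]

lemma pair_comm (f g : L2S d) : pair f g = pair g f := by simp [pair, mul_comm]

lemma continuous_pair_right (f : L2S d) : Continuous (pair f) := by
  rw [show pair f = fun g => inner ℂ (star f) g from funext (pair_eq_inner f)]
  fun_prop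

lemma continuous_pair_left (g : L2S d) : Continuous (fun f => pair f g) := by
  simp only [pair_comm _ g]; exact continuous_pair_right g

lemma pair_sub_right (f g h : L2S d) : pair f (g - h) = pair f g - pair f h := by
  simp only [pair_eq_inner, inner_sub_right]

lemma pair_smul_right (c : ℂ) (f g : L2S d) : pair f (c • g) = c * pair f g := by
  simp only [pair_eq_inner, inner_smul_right]

lemma pair_smul_left (c : ℂ) (f g : L2S d) : pair (c • f) g = c * pair f g := by
  simp only [pair_comm _ g, pair_smul_right]

lemma pair_toL2_right (f : L2S d) (g : C(S d, ℂ)) :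
    pair f (toL2 g) = ∫ θ, f θ * g θ ∂(surf d) := by
  refine integral_congr_ae ?_
  filter_upwards [coeFn_toL2 g] with θ hθ
  rw [hθ]

lemma pair_toL2 (f g : C(S d, ℂ)) : pair (toL2 f) (toL2 g) = ∫ θ, f θ * g θ ∂(surf d) := by
  refine integral_congr_ae ?_
  filter_upwards [coeFn_toL2 g, coeFn_toL2 f] with θ hθ hθ'
  rw [hθ, hθ']

lemma norm_toL2_sq (g : C(S d, ℂ)) : ‖toL2 g‖ ^ 2 = ∫ θ, ‖g θ‖ ^ 2 ∂(surf d) := by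
  have h := L2.inner_def (𝕜 := ℂ) (toL2 g) (toL2 g)
  rw [inner_self_eq_norm_sq_to_K] at h
  have h2 : ∫ θ, inner ℂ ((toL2 g : L2S d) θ) ((toL2 g : L2S d) θ) ∂(surf d) =
      ((∫ θ, ‖g θ‖ ^ 2 ∂(surf d) : ℝ) : ℂ) := by
    rw [← integral_complex_ofReal]
    refine integral_congr_ae ?_
    filter_upwards [coeFn_toL2 g] with θ hθ
    rw [hθ, inner_self_eq_norm_sq_to_K]
    norm_cast
  rw [h2] at h
  apply Complex.ofReal_injective
  simpa using h

/-- The bilinear pairing is nondegenerate. -/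
lemma eq_zero_of_pair_eq_zero {f : L2S d}
    (h : ∀ P : MvPolynomial (Fin d) ℂ, pair f (toL2 (evS P)) = 0) : f = 0 := by
  have h1 : ∀ g, pair f g = 0 :=
    L2_induction (isClosed_eq (continuous_pair_right f) continuous_const) h
  have h2 := h1 (star f)
  rw [pair_eq_inner, inner_self_eq_zero] at h2
  rw [Lp.eq_zero_iff_ae_eq_zero] at h2 ⊢
  filter_upwards [h2, Lp.coeFn_star f] with θ h3 h4
  rw [h4] at h3
  simpa using h3

/-- Extension of an `L²`-bounded operator on continuous functions to `L²(∂𝔹)`. -/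
lemma exists_L2_extension {F : Type*} [NormedAddCommGroup F] [NormedSpace ℂ F] [CompleteSpace F]
    (A : C(S d, ℂ) →ₗ[ℂ] F) (K : ℝ) (hK : 0 ≤ K) (hA : ∀ g, ‖A g‖ ≤ K * ‖toL2 g‖) :
    ∃ T : L2S d →L[ℂ] F, (∀ g, T (toL2 g) = A g) ∧ ‖T‖ ≤ K := by
  refine ⟨A.extendOfNorm (toL2 : C(S d, ℂ) →L[ℂ] L2S d).toLinearMap, fun g => ?_, ?_⟩
  · exact LinearMap.extendOfNorm_eq (e := (toL2 : C(S d, ℂ) →L[ℂ] L2S d).toLinearMap)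
      toL2_denseRange ⟨K, hA⟩ g
  · refine ContinuousLinearMap.opNorm_le_bound _ hK fun x => ?_
    exact LinearMap.norm_extendOfNorm_apply_le (e := (toL2 : C(S d, ℂ) →L[ℂ] L2S d).toLinearMap)
      toL2_denseRange K hA x

end L2

end DepthEIT

namespace DepthEIT

variable {d : ℕ}

/-! ### Green's formula for weak solutions in the perforated ball -/

section Domain

open Set Metric

lemma measurableSet_dom (C : E d) (R : ℝ) : MeasurableSet (dom C R) :=
  measurableSet_ball.diff measurableSet_closedBall

lemma dom_subset (C : E d) (R : ℝ) : dom C R ⊆ ball (0 : E d) 1 := sdiff_subset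

lemma closedBall_subset_unitBall {C : E d} {R : ℝ} (hC : ‖C‖ + R < 1) :
    closedBall C R ⊆ ball (0 : E d) 1 := by
  intro x hx
  rw [mem_ball_zero_iff]
  rw [mem_closedBall_iff_norm] at hx
  calc ‖x‖ = ‖C + (x - C)‖ := by congr 1; abel
    _ ≤ ‖C‖ + ‖x - C‖ := norm_add_le _ _
    _ < 1 := by linarith

lemma integral_dom [NeZero d] {C : E d} {R : ℝ} (hC : ‖C‖ + R < 1) {f : E d → ℂ}
    (hf : Continuous f) :
    ∫ x in dom C R, f x = (∫ x in ball (0 : E d) 1, f x) - ∫ x in ball C R, f x := by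
  rw [dom, setIntegral_sdiff measurableSet_closedBall (integrableOn_ball_of_continuous hf 0 1)
    (closedBall_subset_unitBall hC)]
  congr 1
  refine setIntegral_congr_set ?_
  have h : ball C R ⊆ closedBall C R := ball_subset_closedBall
  refine (LE.le.eventuallyLE h).antisymm ?_ |>.symm
  rw [ae_le_set, closedBall_sdiff_ball]
  exact Measure.addHaar_sphere _ _ _

/-- Green's first identity on the domain with an inclusion. -/
theorem green_dom [NeZero d] {C : E d} {R : ℝ} (hR : 0 < R) (hC : ‖C‖ + R < 1) {v Φ : E d → ℂ}
    (hv : ContDiff ℝ ∞ v) (hΦ : ContDiff ℝ ∞ Φ) :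
    ∫ x in dom C R, ∑ i, pd i v x * pd i Φ x =
      (∫ θ : S d, v θ * fderiv ℝ Φ θ θ ∂(surf d)) -
      ((R ^ (d - 1) : ℝ) : ℂ) * (∫ θ : S d, v (C + R • (θ : E d)) *
        fderiv ℝ Φ (C + R • (θ : E d)) θ ∂(surf d)) - ∫ x in dom C R, v x * lap Φ x := by
  rw [integral_dom hC (f := fun x => ∑ i, pd i v x * pd i Φ x)
      (continuous_finsetSum _ fun i _ => (continuous_pd hv i).mul (continuous_pd hΦ i)),
    integral_dom hC (f := fun x => v x * lap Φ x) (hv.continuous.mul (continuous_lap hΦ)), green_unit_ball hv hΦ, green_ball hv hΦ C hR]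
  ring

lemma memLp_of_continuous {Ω : Set (E d)} (hΩ : Ω ⊆ ball (0 : E d) 1) {f : E d → ℂ}
    (hf : Continuous f) : MemLp f 2 (volume.restrict Ω) := by
  have h1 : MemLp f 2 (volume.restrict (closedBall (0 : E d) 1)) := by
    have : IsFiniteMeasure (volume.restrict (closedBall (0 : E d) 1)) :=
      ⟨by simpa using measure_closedBall_lt_top⟩
    obtain ⟨K, hK⟩ := (isCompact_closedBall (0 : E d) 1).exists_bound_of_continuousOn hf.continuousOn
    refine MemLp.of_bound hf.aestronglyMeasurable K ?_
    filter_upwards [ae_restrict_mem measurableSet_closedBall] with x hx using hK x hx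
  exact h1.mono_measure (Measure.restrict_mono (hΩ.trans ball_subset_closedBall) le_rfl)

lemma memLp_sphere_of_continuous {f : S d → ℂ} (hf : Continuous f) : MemLp f 2 (surf d) := by
  obtain ⟨K, hK⟩ := isCompact_univ.exists_bound_of_continuousOn hf.continuousOn
  exact MemLp.of_bound hf.aestronglyMeasurable K (Eventually.of_forall fun x => hK x trivial)

lemma tendsto_integral_mul_of_eLpNorm {α : Type*} [MeasurableSpace α] {μ : Measure α} {u ψ : α → ℂ}
    {v : ℕ → α → ℂ} (hu : MemLp u 2 μ) (hv : ∀ k, MemLp (v k) 2 μ) (hψ : MemLp ψ 2 μ)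
    (h : Tendsto (fun k => eLpNorm (fun x => v k x - u x) 2 μ) atTop (𝓝 0)) :
    Tendsto (fun k => ∫ x, v k x * ψ x ∂μ) atTop (𝓝 (∫ x, u x * ψ x ∂μ)) := by
  refine tendsto_integral_of_L1' _ (hu.1.mul hψ.1)
    (Eventually.of_forall fun k => (hv k).integrable_mul hψ) ?_
  have hb : Tendsto (fun k => eLpNorm (fun x => v k x - u x) 2 μ * eLpNorm ψ 2 μ) atTop (𝓝 0) := by
    have := ENNReal.Tendsto.mul_const h (Or.inr hψ.2.ne) (b := eLpNorm ψ 2 μ)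
    simpa using this
  refine tendsto_of_tendsto_of_tendsto_of_le_of_le tendsto_const_nhds hb (fun _ => bot_le) ?_
  intro k
  have := eLpNorm_smul_le_mul_eLpNorm (p := 2) (q := 2) (r := 1) (f := ψ)
    (φ := fun x => v k x - u x) hψ.1 ((hv k).1.sub hu.1)
  refine le_trans (le_of_eq (congrArg (fun F => eLpNorm F 1 μ) ?_)) this
  ext x
  simp [sub_mul]

/-- For fixed smooth `Φ` every term is continuous in `v` for the convergences supplied by
`HasTrace`. The assumed identity has a boundary term on one sphere only, because the approximating
sequence controls the trace on that sphere alone. -/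
lemma trace_green {Ω : Set (E d)} (hΩ : Ω ⊆ ball (0 : E d) 1) {u : E d → ℂ}
    {G : Fin d → E d → ℂ} (hu : IsH1 Ω u G) {c : E d} {s : ℝ} {f : S d → ℂ}
    (ht : HasTrace Ω u G c s f) (hf : MemLp f 2 (surf d)) {Φ : E d → ℂ} (hΦ : ContDiff ℝ ∞ Φ)
    (a : ℂ) (id : ∀ v, ContDiff ℝ ∞ v → ∫ x in Ω, ∑ i, pd i v x * pd i Φ x =
      a * (∫ θ : S d, v (c + s • (θ : E d)) * fderiv ℝ Φ (c + s • (θ : E d)) θ ∂(surf d)) -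
        ∫ x in Ω, v x * lap Φ x) :
    ∫ x in Ω, ∑ i, G i x * pd i Φ x =
      a * (∫ θ : S d, f θ * fderiv ℝ Φ (c + s • (θ : E d)) θ ∂(surf d)) -
        ∫ x in Ω, u x * lap Φ x := by
  obtain ⟨v, hv, h1, h2, h3⟩ := ht
  have l1 : Tendsto (fun k => ∫ x in Ω, ∑ i, pd i (v k) x * pd i Φ x) atTop
      (𝓝 (∫ x in Ω, ∑ i, G i x * pd i Φ x)) := by
    have e1 : ∀ k, ∫ x in Ω, ∑ i, pd i (v k) x * pd i Φ x =
        ∑ i, ∫ x in Ω, pd i (v k) x * pd i Φ x := fun k =>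
      integral_finsetSum _ fun i _ => (memLp_of_continuous hΩ (continuous_pd (hv k) i)).integrable_mul
        (memLp_of_continuous hΩ (continuous_pd hΦ i))
    have e2 : ∫ x in Ω, ∑ i, G i x * pd i Φ x = ∑ i, ∫ x in Ω, G i x * pd i Φ x :=
      integral_finsetSum _ fun i _ => (hu.2.1 i).integrable_mul
        (memLp_of_continuous hΩ (continuous_pd hΦ i))
    simp only [e1, e2]
    exact tendsto_finsetSum _ fun i _ => tendsto_integral_mul_of_eLpNorm (hu.2.1 i)
      (fun k => memLp_of_continuous hΩ (continuous_pd (hv k) i))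
      (memLp_of_continuous hΩ (continuous_pd hΦ i)) (h2 i)
  have l2 := tendsto_integral_mul_of_eLpNorm hu.1 (fun k => memLp_of_continuous hΩ (hv k).continuous)
      (memLp_of_continuous hΩ (continuous_lap hΦ)) h1
  have cN : Continuous fun θ : S d => fderiv ℝ Φ (c + s • (θ : E d)) θ :=
    ((hΦ.continuous_fderiv (by simp)).comp (by fun_prop)).clm_apply continuous_subtype_val
  have l3 := tendsto_integral_mul_of_eLpNorm hf
    (fun k => memLp_sphere_of_continuous ((hv k).continuous.comp (by fun_prop)))
      (memLp_sphere_of_continuous cN) h3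
  have l4 := (l3.const_mul a).sub l2
  refine tendsto_nhds_unique l1 (l4.congr fun k => ?_)
  exact (id (v k) (hv k)).symm

/-- A smooth cutoff that is `1` near the inclusion and `0` near the complement of the ball. -/
lemma exists_inclusion_cutoff {C : E d} {R : ℝ} (hR : 0 < R) (hC : ‖C‖ + R < 1) :
    ∃ b : E d → ℂ, ContDiff ℝ ∞ b ∧ (∀ x ∈ closedBall C R, b =ᶠ[𝓝 x] fun _ => 1) ∧
      ∀ x, 1 ≤ ‖x‖ → b =ᶠ[𝓝 x] fun _ => 0 := by
  set ε := (1 - (‖C‖ + R)) / 3 with hε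
  have hε0 : 0 < ε := by rw [hε]; linarith
  let B : ContDiffBump C := ⟨R + ε, R + 2 * ε, by linarith, by linarith⟩
  refine ⟨fun x => (B x : ℂ), Complex.ofRealCLM.contDiff.comp B.contDiff, ?_, ?_⟩
  · intro x hx
    have : x ∈ ball C (R + ε) := by
      rw [mem_ball]; rw [mem_closedBall] at hx; linarith
    filter_upwards [isOpen_ball.mem_nhds this] with y hy
    have : B y = 1 := B.one_of_mem_closedBall (ball_subset_closedBall hy)
    simp [this]
  · intro x hx
    have h1 : x ∈ {y | R + 2 * ε < dist y C} := by
      have : ‖x‖ ≤ ‖x - C‖ + ‖C‖ := by simpa using norm_add_le (x - C) C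
      rw [Set.mem_ofPred_eq, dist_eq_norm]
      rw [hε] at *
      linarith
    have ho : IsOpen {y | R + 2 * ε < dist y C} := isOpen_lt continuous_const (by fun_prop)
    filter_upwards [ho.mem_nhds h1] with y hy
    have : B y = 0 := B.zero_of_le_dist (le_of_lt hy)
    simp [this]

lemma fderiv_apply_congr {f g : E d → ℂ} {x : E d} (h : f =ᶠ[𝓝 x] g) (y : E d) :
    fderiv ℝ f x y = fderiv ℝ g x y := by rw [h.fderiv_eq]

lemma lap_add {f g : E d → ℂ} (hf : ContDiff ℝ ∞ f) (hg : ContDiff ℝ ∞ g) (x : E d) :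
    lap (fun y => f y + g y) x = lap f x + lap g x := by
  rw [lap, lap, lap, ← Finset.sum_add_distrib]
  refine Finset.sum_congr rfl fun i _ => ?_
  have : pd i (fun y => f y + g y) = fun y => pd i f y + pd i g y :=
    funext fun y => pd_add i (hf.differentiable (by simp) y) (hg.differentiable (by simp) y)
  rw [this]
  exact pd_add i ((contDiff_pd_infty hf i).differentiable (by simp) x)
    ((contDiff_pd_infty hg i).differentiable (by simp) x)

/-- The Neumann trace of a solution, tested with a smooth harmonic function. -/
theorem integral_grad_dom [NeZero d] {C : E d} {R : ℝ} (hR : 0 < R) (hC : ‖C‖ + R < 1) {u : E d → ℂ}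
    {G : Fin d → E d → ℂ} (hu : IsH1 (dom C R) u G) {f : L2S d}
    (h0 : HasTrace (dom C R) u G C R (fun _ => 0)) (h1 : HasTrace (dom C R) u G 0 1 f)
    {Φ : E d → ℂ} (hΦ : ContDiff ℝ ∞ Φ) (hl : ∀ x ∈ dom C R, lap Φ x = 0) :
    ∫ x in dom C R, ∑ i, G i x * pd i Φ x = ∫ θ : S d, f θ * fderiv ℝ Φ θ θ ∂(surf d) := by
  obtain ⟨b, hb, hb1, hb0⟩ := exists_inclusion_cutoff hR hC
  -- The two trace hypotheses come with unrelated approximating sequences. Hence `Φ` is split into a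
  -- part vanishing near the outer sphere and a part vanishing near the inclusion, so that each
  -- Green identity sees one sphere only.
  set Φ₁ : E d → ℂ := fun x => b x * Φ x with hΦ₁
  set Φ₂ : E d → ℂ := fun x => (1 - b x) * Φ x with hΦ₂
  have s1 : ContDiff ℝ ∞ Φ₁ := hb.mul hΦ
  have s2 : ContDiff ℝ ∞ Φ₂ := (contDiff_const.sub hb).mul hΦ
  have es : Φ = fun x => Φ₁ x + Φ₂ x := by ext x; simp only [hΦ₁, hΦ₂]; ring
  have hin : ∀ θ : S d, C + R • (θ : E d) ∈ closedBall C R := fun θ => by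
    rw [mem_closedBall_iff_norm, add_sub_cancel_left, norm_smul, Real.norm_of_nonneg hR.le]; simp
  have hout : ∀ θ : S d, 1 ≤ ‖(θ : E d)‖ := fun θ => by simp
  have d1 : ∀ θ : S d, fderiv ℝ Φ₁ θ θ = 0 := fun θ => by
    have : Φ₁ =ᶠ[𝓝 (θ : E d)] fun _ => 0 := by
      filter_upwards [hb0 θ (hout θ)] with y hy; simp [hΦ₁, hy]
    rw [fderiv_apply_congr this]; simp
  have d2 : ∀ θ : S d, fderiv ℝ Φ₂ (C + R • (θ : E d)) θ = 0 := fun θ => by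
    have : Φ₂ =ᶠ[𝓝 (C + R • (θ : E d))] fun _ => 0 := by
      filter_upwards [hb1 _ (hin θ)] with y hy; simp [hΦ₂, hy]
    rw [fderiv_apply_congr this]; simp
  have d3 : ∀ θ : S d, fderiv ℝ Φ₂ θ θ = fderiv ℝ Φ θ θ := fun θ => by
    refine fderiv_apply_congr ?_ _
    filter_upwards [hb0 θ (hout θ)] with y hy; simp [hΦ₂, hy]
  have g1 := trace_green (dom_subset C R) hu h0 (by simp) s1 (-((R ^ (d - 1) : ℝ) : ℂ)) fun v hv => by
    rw [green_dom hR hC hv s1]; simp [d1]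
  have g2 := trace_green (dom_subset C R) hu h1 (Lp.memLp f) s2 1 fun v hv => by
    rw [green_dom hR hC hv s2]; simp [d2]
  simp only [zero_mul, integral_zero, mul_zero, zero_sub] at g1
  simp only [zero_add, one_smul, d3, one_mul] at g2
  have i1 : ∀ {Ψ : E d → ℂ}, ContDiff ℝ ∞ Ψ →
      Integrable (fun x => ∑ i, G i x * pd i Ψ x) (volume.restrict (dom C R)) := fun hΨ =>
    integrable_finsetSum _ fun i _ => (hu.2.1 i).integrable_mul
      (memLp_of_continuous (dom_subset C R) (continuous_pd hΨ i))
  have e1 : ∫ x in dom C R, ∑ i, G i x * pd i Φ x =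
      (∫ x in dom C R, ∑ i, G i x * pd i Φ₁ x) + ∫ x in dom C R, ∑ i, G i x * pd i Φ₂ x := by
    rw [← integral_add (i1 s1) (i1 s2)]
    refine integral_congr_ae (Eventually.of_forall fun x => ?_)
    simp only
    rw [← Finset.sum_add_distrib]
    refine Finset.sum_congr rfl fun i _ => ?_
    rw [← mul_add, es, pd_add i (s1.differentiable (by simp) x) (s2.differentiable (by simp) x)]
  have i2 : ∀ {Ψ : E d → ℂ}, ContDiff ℝ ∞ Ψ →
      Integrable (fun x => u x * lap Ψ x) (volume.restrict (dom C R)) := fun hΨ =>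
    hu.1.integrable_mul (memLp_of_continuous (dom_subset C R) (continuous_lap hΨ))
  -- The cutoff destroys harmonicity of the two parts, but their volume terms add up to `∫ u ΔΦ =
  -- 0`.
  have e2 : (∫ x in dom C R, u x * lap Φ₁ x) + ∫ x in dom C R, u x * lap Φ₂ x = 0 := by
    rw [← integral_add (i2 s1) (i2 s2)]
    refine setIntegral_eq_zero_of_forall_eq_zero fun x hx => ?_
    have := lap_add s1 s2 x
    rw [← es, hl x hx] at this
    rw [← mul_add, ← this, mul_zero]
  rw [e1, g1, g2]
  linear_combination -e2

theorem integral_grad_ball [NeZero d] {u : E d → ℂ}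
    {G : Fin d → E d → ℂ} (hu : IsH1 (ball (0 : E d) 1) u G) {f : L2S d}
    (h1 : HasTrace (ball (0 : E d) 1) u G 0 1 f)
    {Φ : E d → ℂ} (hΦ : ContDiff ℝ ∞ Φ) (hl : ∀ x ∈ ball (0 : E d) 1, lap Φ x = 0) :
    ∫ x in ball (0 : E d) 1, ∑ i, G i x * pd i Φ x = ∫ θ : S d, f θ * fderiv ℝ Φ θ θ ∂(surf d) := by
  have g := trace_green le_rfl hu h1 (Lp.memLp f) hΦ 1 fun v hv => by
    rw [green_unit_ball hv hΦ]; simp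
  rw [g]
  have : ∫ x in ball (0 : E d) 1, u x * lap Φ x = 0 :=
    setIntegral_eq_zero_of_forall_eq_zero fun x hx => by rw [hl x hx, mul_zero]
  rw [this]; simp

lemma isH1_of_contDiff {Ω : Set (E d)} (hΩ : Ω ⊆ ball (0 : E d) 1) {Φ : E d → ℂ}
    (hΦ : ContDiff ℝ ∞ Φ) : IsH1 Ω Φ (fun i => pd i Φ) := by
  refine ⟨memLp_of_continuous hΩ hΦ.continuous,
    fun i => memLp_of_continuous hΩ (continuous_pd hΦ i), fun φ ⟨hφ, hc, hs⟩ i => ?_⟩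
  have z : ∀ x, x ∉ Ω → φ x = 0 := fun x hx => image_eq_zero_of_notMem_tsupport fun h => hx (hs h)
  have z' : ∀ x, x ∉ Ω → pd i φ x = 0 := fun x hx => by
    rw [pd_congr i (notMem_tsupport_iff_eventuallyEq.1 fun h => hx (hs h))]; exact pd_const 0 x i
  rw [setIntegral_eq_integral_of_forall_compl_eq_zero fun x hx => by rw [z' x hx, mul_zero],
    setIntegral_eq_integral_of_forall_compl_eq_zero fun x hx => by rw [z x hx, mul_zero]]
  exact integral_pd_mul_eq_neg (hφ.of_le (by exact_mod_cast le_top))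
    (hΦ.of_le (by exact_mod_cast le_top)) hc i

lemma isWeaklyHarmonic_of_lap {Ω : Set (E d)} {Φ : E d → ℂ}
    (hΦ : ContDiff ℝ ∞ Φ) (hl : ∀ x ∈ Ω, lap Φ x = 0) :
    IsWeaklyHarmonic Ω (fun i => pd i Φ) := by
  rintro φ ⟨hφ, hc, hs⟩
  have z : ∀ x, x ∉ Ω → φ x = 0 := fun x hx => image_eq_zero_of_notMem_tsupport fun h => hx (hs h)
  have z' : ∀ i x, x ∉ Ω → pd i φ x = 0 := fun i x hx => by
    rw [pd_congr i (notMem_tsupport_iff_eventuallyEq.1 fun h => hx (hs h))]; exact pd_const 0 x i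
  rw [setIntegral_eq_integral_of_forall_compl_eq_zero fun x hx => by simp [z' _ x hx]]
  have hcp : ∀ i, HasCompactSupport (pd i φ) := fun i =>
    (hc.fderiv (𝕜 := ℝ)).comp_left
      (g := fun L : E d →L[ℝ] ℂ => L (EuclideanSpace.single i 1)) (by simp)
  have hint : ∀ i ∈ Finset.univ, Integrable fun x => pd i Φ x * pd i φ x := fun i _ =>
    ((continuous_pd hΦ i).mul (continuous_pd hφ i)).integrable_of_hasCompactSupport (hcp i).mul_left
  rw [integral_finsetSum _ hint]
  have : ∀ i, ∫ x, pd i Φ x * pd i φ x = - ∫ x, pd i (pd i Φ) x * φ x := fun i =>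
    integral_pd_mul_eq_neg (hφ.of_le (by exact_mod_cast le_top))
      ((contDiff_pd_infty hΦ i).of_le (by exact_mod_cast le_top)) hc i
  simp only [this]
  rw [Finset.sum_neg_distrib, ← integral_finsetSum]
  · rw [neg_eq_zero, integral_eq_zero_of_ae]
    refine Eventually.of_forall fun x => ?_
    simp only [Pi.zero_apply]
    rw [← Finset.sum_mul]
    by_cases hx : x ∈ Ω
    · rw [← lap, hl x hx, zero_mul]
    · rw [z x hx, mul_zero]
  · exact fun i _ => ((continuous_pd (contDiff_pd_infty hΦ i) i).mul hφ.continuous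
      ).integrable_of_hasCompactSupport hc.mul_left

lemma hasTrace_of_contDiff {Ω : Set (E d)} {Φ : E d → ℂ} (hΦ : ContDiff ℝ ∞ Φ) {c : E d} {s : ℝ}
    {f : S d → ℂ} (hf : ∀ᵐ θ : S d ∂(surf d), Φ (c + s • (θ : E d)) = f θ) :
    HasTrace Ω Φ (fun i => pd i Φ) c s f := by
  refine ⟨fun _ => Φ, fun _ => hΦ, by simp, by simp, ?_⟩
  refine tendsto_const_nhds.congr fun k => ?_
  rw [eq_comm, eLpNorm_congr_ae (g := fun _ => 0), eLpNorm_zero']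
  filter_upwards [hf] with θ hθ
  rw [hθ, sub_self]

end Domain

end DepthEIT

namespace DepthEIT

variable {d : ℕ}

/-! ### Identification of an operator as the extension of the difference of the Dirichlet-to-Neumann
maps -/

section Criterion

open Set Metric

/-- Bounded pointwise convergence on the closed unit ball, together with the first derivatives. -/
def C1Tendsto (p : ℕ → E d → ℂ) (φ : E d → ℂ) : Prop :=
  (∀ x ∈ closedBall (0 : E d) 1, Tendsto (fun k => p k x) atTop (𝓝 (φ x))) ∧
  (∀ i, ∀ x ∈ closedBall (0 : E d) 1, Tendsto (fun k => pd i (p k) x) atTop (𝓝 (pd i φ x))) ∧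
  ∃ M : ℝ, ∀ k, ∀ x ∈ closedBall (0 : E d) 1, ‖p k x‖ ≤ M ∧ ∀ i, ‖pd i (p k) x‖ ≤ M

lemma exists_bound_C1 {χ : E d → ℂ} (hχ : ContDiff ℝ ∞ χ) : ∃ K : ℝ, 0 ≤ K ∧
    ∀ x ∈ closedBall (0 : E d) 1, ‖χ x‖ ≤ K ∧ ∀ i, ‖pd i χ x‖ ≤ K := by
  have h1 : Continuous fun x => ‖χ x‖ + ∑ i, ‖pd i χ x‖ :=
    hχ.continuous.norm.add (continuous_finsetSum _ fun i _ => (continuous_pd hχ i).norm)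
  obtain ⟨K, hK⟩ := (isCompact_closedBall (0 : E d) 1).exists_bound_of_continuousOn h1.continuousOn
  have h2 : ∀ x, 0 ≤ ∑ i, ‖pd i χ x‖ := fun x => Finset.sum_nonneg fun i _ => norm_nonneg _
  have h3 : ∀ x ∈ closedBall (0 : E d) 1, ‖χ x‖ + ∑ i, ‖pd i χ x‖ ≤ K := fun x hx =>
    (le_abs_self _).trans (hK x hx)
  refine ⟨K, ?_, fun x hx => ⟨?_, fun i => ?_⟩⟩
  · have := h3 0 (by simp)
    have h4 := h2 (0 : E d)
    have h5 := norm_nonneg (χ 0)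
    linarith
  · linarith [h3 x hx, h2 x]
  · have := Finset.single_le_sum (f := fun i => ‖pd i χ x‖) (fun i _ => norm_nonneg _)
      (Finset.mem_univ i)
    linarith [h3 x hx, norm_nonneg (χ x)]

lemma C1Tendsto.mul_left {p : ℕ → E d → ℂ} {φ χ : E d → ℂ} (h : C1Tendsto p φ)
    (hp : ∀ k, ContDiff ℝ ∞ (p k)) (hφ : ContDiff ℝ ∞ φ) (hχ : ContDiff ℝ ∞ χ) :
    C1Tendsto (fun k x => χ x * p k x) (fun x => χ x * φ x) := by
  obtain ⟨h1, h2, M, hM⟩ := h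
  obtain ⟨K, hK0, hK⟩ := exists_bound_C1 hχ
  have e : ∀ {f : E d → ℂ}, ContDiff ℝ ∞ f → ∀ i x, pd i (fun x => χ x * f x) x =
      pd i χ x * f x + χ x * pd i f x := fun hf i x =>
    pd_mul i (hχ.differentiable (by simp) x) (hf.differentiable (by simp) x)
  refine ⟨fun x hx => (h1 x hx).const_mul _, fun i x hx => ?_, K * M + K * M, fun k x hx => ?_⟩
  · simp only [e (hp _), e hφ]
    exact ((h1 x hx).const_mul _).add ((h2 i x hx).const_mul _)
  · obtain ⟨a, b⟩ := hM k x hx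
    obtain ⟨a', b'⟩ := hK x hx
    have hM0 : 0 ≤ M := (norm_nonneg _).trans a
    have t1 : ‖χ x * p k x‖ ≤ K * M := by rw [norm_mul]; gcongr
    refine ⟨t1.trans (by nlinarith), fun i => ?_⟩
    rw [e (hp k)]
    refine (norm_add_le _ _).trans (add_le_add ?_ ?_)
    · rw [norm_mul]; gcongr; exact b' i
    · rw [norm_mul]; gcongr; exact b i

lemma C1Tendsto.tendsto_integral_grad {p : ℕ → E d → ℂ} {φ : E d → ℂ} (h : C1Tendsto p φ)
    (hp : ∀ k, ContDiff ℝ ∞ (p k)) {Ω : Set (E d)} (hΩm : MeasurableSet Ω)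
    (hΩ : Ω ⊆ ball (0 : E d) 1) {G : Fin d → E d → ℂ}
    (hG : ∀ i, MemLp (G i) 2 (volume.restrict Ω)) :
    Tendsto (fun k => ∫ x in Ω, ∑ i, G i x * pd i (p k) x) atTop
      (𝓝 (∫ x in Ω, ∑ i, G i x * pd i φ x)) := by
  obtain ⟨h1, h2, M, hM⟩ := h
  have hΩ' : ∀ x ∈ Ω, x ∈ closedBall (0 : E d) 1 := fun x hx => ball_subset_closedBall (hΩ hx)
  refine tendsto_integral_of_dominated_convergence (fun x => ∑ i, ‖G i x‖ * M) ?_ ?_ ?_ ?_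
  · exact fun k => Finset.aestronglyMeasurable_fun_sum _ fun i _ =>
      (hG i).1.mul (continuous_pd (hp k) i).aestronglyMeasurable
  · have hfin : IsFiniteMeasure (volume.restrict Ω) :=
      ⟨by simpa using (measure_mono hΩ).trans_lt measure_ball_lt_top⟩
    exact integrable_finsetSum _ fun i _ => (((hG i).integrable (by norm_num)).norm).mul_const _
  · intro k
    filter_upwards [ae_restrict_mem hΩm] with x hx
    refine (norm_sum_le _ _).trans (Finset.sum_le_sum fun i _ => ?_)
    rw [norm_mul]
    gcongr
    exact (hM k x (hΩ' x hx)).2 i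
  · filter_upwards [ae_restrict_mem hΩm] with x hx
    exact tendsto_finsetSum _ fun i _ => (h2 i x (hΩ' x hx)).const_mul _

lemma sphere_mem_closedBall (θ : S d) : (θ : E d) ∈ closedBall (0 : E d) 1 :=
  sphere_subset_closedBall θ.2

lemma C1Tendsto.tendsto_integral_sphere {p : ℕ → E d → ℂ} {φ : E d → ℂ} (h : C1Tendsto p φ)
    (hp : ∀ k, ContDiff ℝ ∞ (p k)) (f : L2S d) :
    Tendsto (fun k => ∫ θ : S d, f θ * p k θ ∂(surf d)) atTop
      (𝓝 (∫ θ : S d, f θ * φ θ ∂(surf d))) := by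
  obtain ⟨h1, h2, M, hM⟩ := h
  refine tendsto_integral_of_dominated_convergence (fun θ => ‖f θ‖ * M) ?_ ?_ ?_ ?_
  · exact fun k => (Lp.aestronglyMeasurable f).mul
      ((hp k).continuous.comp continuous_subtype_val).aestronglyMeasurable
  · exact (((Lp.memLp f).integrable (by norm_num)).norm).mul_const _
  · intro k
    refine Eventually.of_forall fun θ => ?_
    rw [norm_mul]
    gcongr
    exact (hM k θ (sphere_mem_closedBall θ)).1
  · exact Eventually.of_forall fun θ => (h1 θ (sphere_mem_closedBall θ)).const_mul _

/-- The restriction of a smooth function to the unit sphere. -/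
noncomputable def resS (p : E d → ℂ) (hp : ContDiff ℝ ∞ p) : C(S d, ℂ) :=
  ⟨fun θ => p θ, hp.continuous.comp continuous_subtype_val⟩

/-- The Dirichlet problems with and without inclusion with boundary values `p` have solutions
`Φ` and `H` that are smooth up to the boundary, and `T` maps the boundary values to the difference
of the normal derivatives. -/
def SmoothDNData (C : E d) (R : ℝ) (T : L2S d →L[ℂ] L2S d) (p : E d → ℂ) : Prop :=
  ∃ hp : ContDiff ℝ ∞ p, ∃ (Φ H : E d → ℂ) (g : C(S d, ℂ)), ContDiff ℝ ∞ Φ ∧ ContDiff ℝ ∞ H ∧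
    (∀ x ∈ ball (0 : E d) 1, lap H x = 0) ∧ (∀ x ∈ dom C R, lap Φ x = 0) ∧
    (∀ x ∈ sphere C R, Φ x = 0) ∧
    (∀ θ : S d, Φ θ = p θ ∧ H θ = p θ ∧ g θ = fderiv ℝ Φ θ θ - fderiv ℝ H θ θ) ∧
    T (toL2 (resS p hp)) = toL2 g

lemma add_smul_mem_sphere {C : E d} {R : ℝ} (hR : 0 < R) (θ : S d) :
    C + R • (θ : E d) ∈ sphere C R := by
  rw [mem_sphere_iff_norm, add_sub_cancel_left, norm_smul, Real.norm_of_nonneg hR.le]; simp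

lemma continuous_fderiv_self {Φ : E d → ℂ} (hΦ : ContDiff ℝ ∞ Φ) :
    Continuous fun θ : S d => fderiv ℝ Φ θ θ :=
  ((hΦ.continuous_fderiv (by simp)).comp continuous_subtype_val).clm_apply continuous_subtype_val

lemma integrable_sphere {f : S d → ℂ} (hf : Continuous f) : Integrable f (surf d) :=
  (memLp_sphere_of_continuous hf).integrable (by norm_num)

/-- The smooth solutions are themselves weak solutions, and Green's formula gives their normal
derivatives as Neumann traces. Every extension is thereby forced to take the prescribed value on
such data. -/
lemma SmoothDNData.apply_eq [NeZero d] {C : E d} {R : ℝ} (hR : 0 < R) (hC : ‖C‖ + R < 1)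
    {T T' : L2S d →L[ℂ] L2S d} {p : E d → ℂ} (h : SmoothDNData C R T p) (hp : ContDiff ℝ ∞ p)
    (hT' : ExtendsDNDiff C R T') : T' (toL2 (resS p hp)) = T (toL2 (resS p hp)) := by
  obtain ⟨_, Φ, H, g, sΦ, sH, lH, lΦ, zΦ, hθ, hT⟩ := h
  set f : L2S d := toL2 (resS p hp) with hf
  have hfae : ∀ᵐ θ : S d ∂(surf d), f θ = p θ := coeFn_toL2 (resS p hp)
  have hdn : IsDN C R f (fun ψ => ∫ θ : S d, ψ θ * fderiv ℝ Φ θ θ ∂(surf d)) := by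
    refine ⟨Φ, _, isH1_of_contDiff (dom_subset C R) sΦ, isWeaklyHarmonic_of_lap sΦ lΦ,
      hasTrace_of_contDiff sΦ (Eventually.of_forall fun θ => zΦ _ (add_smul_mem_sphere hR θ)),
      hasTrace_of_contDiff sΦ ?_, ?_⟩
    · filter_upwards [hfae] with θ h
      rw [h, zero_add, one_smul, (hθ θ).1]
    · intro Ψ sΨ hΨ
      -- Green's identity is used with the test function in the undifferentiated place: since `Ψ`
      -- vanishes on the inner sphere, the unknown normal derivative of `Φ` there drops out.
      have h1 := green_dom hR hC sΨ sΦ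
      have h2 : ∫ x in dom C R, Ψ x * lap Φ x = 0 :=
        setIntegral_eq_zero_of_forall_eq_zero fun x hx => by rw [lΦ x hx, mul_zero]
      rw [h2] at h1
      simp only [hΨ _ (add_smul_mem_sphere hR _), zero_mul, integral_zero, mul_zero, sub_zero] at h1
      refine h1.symm.trans ?_
      simp only [mul_comm]
  have hdn1 : IsDNFree f (fun ψ => ∫ θ : S d, ψ θ * fderiv ℝ H θ θ ∂(surf d)) := by
    refine ⟨H, _, isH1_of_contDiff le_rfl sH, isWeaklyHarmonic_of_lap sH lH,
      hasTrace_of_contDiff sH ?_, ?_⟩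
    · filter_upwards [hfae] with θ h
      rw [h, zero_add, one_smul, (hθ θ).2.1]
    · intro Ψ sΨ _
      have h1 := green_unit_ball sΨ sH
      have h2 : ∫ x in ball (0 : E d) 1, Ψ x * lap H x = 0 :=
        setIntegral_eq_zero_of_forall_eq_zero fun x hx => by rw [lH x hx, mul_zero]
      rw [h2, sub_zero] at h1
      refine h1.symm.trans ?_
      simp only [mul_comm]
  rw [hT, ← sub_eq_zero]
  refine eq_zero_of_pair_eq_zero fun P => ?_
  have h3 := hT' f _ _ hdn hdn1 (ev P) (contDiff_ev P)
  have h4 : pair (T' f) (toL2 (evS P)) = pair (toL2 g) (toL2 (evS P)) := by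
    rw [pair_toL2_right, pair_toL2]
    simp only [evS_apply]
    rw [h3, ← integral_sub]
    · refine integral_congr_ae (Eventually.of_forall fun θ => ?_)
      simp only
      rw [(hθ θ).2.2]; ring
    · exact integrable_sphere (((contDiff_ev P).continuous.comp continuous_subtype_val).mul
        (continuous_fderiv_self sΦ))
    · exact integrable_sphere (((contDiff_ev P).continuous.comp continuous_subtype_val).mul
        (continuous_fderiv_self sH))
  rw [pair_comm, pair_sub_right, pair_comm, h4, pair_comm, sub_self]

/-- A symmetric operator with the right values on sufficiently many smooth boundary data is the
unique extension of the difference of the Dirichlet-to-Neumann maps. -/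
theorem extendsDNDiff_iff [NeZero d] {C : E d} {R : ℝ} (hR : 0 < R) (hC : ‖C‖ + R < 1)
    {T : L2S d →L[ℂ] L2S d} (hT : ∀ f g, pair (T f) g = pair f (T g))
    (hdense : ∀ φ, ContDiff ℝ ∞ φ → ∃ p : ℕ → E d → ℂ,
      (∀ k, SmoothDNData C R T (p k)) ∧ C1Tendsto p φ) (T' : L2S d →L[ℂ] L2S d) :
    ExtendsDNDiff C R T' ↔ T' = T := by
  constructor
  · intro hT'
    rw [← sub_eq_zero]
    ext1 f
    refine L2_induction (p := fun f => (T' - T) f = (0 : L2S d →L[ℂ] L2S d) f)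
      (isClosed_eq (T' - T).continuous continuous_const) (fun P => ?_) f
    obtain ⟨p, hn, hp⟩ := hdense (ev P) (contDiff_ev P)
    have sp : ∀ k, ContDiff ℝ ∞ (p k) := fun k => (hn k).1
    set D := T' - T with hD
    have hz : ∀ k, D (toL2 (resS (p k) (sp k))) = 0 := fun k => by
      rw [hD, sub_apply, (hn k).apply_eq hR hC (sp k) hT', sub_self]
    refine ext_inner_left ℂ fun h => ?_
    -- Passing to the adjoint puts the test data `p k` against a fixed `L²` function, where bounded
    -- pointwise convergence is enough.
    rw [← ContinuousLinearMap.adjoint_inner_left]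
    set w := ContinuousLinearMap.adjoint D h
    have h1 : ∀ q : C(S d, ℂ), inner ℂ w (toL2 q) = ∫ θ, (star w : L2S d) θ * q θ ∂(surf d) := by
      intro q
      rw [← pair_toL2_right, pair_eq_inner, star_star]
    have h2 := hp.tendsto_integral_sphere sp (star w)
    have h3 : ∀ k, ∫ θ : S d, (star w : L2S d) θ * p k θ ∂(surf d) = 0 := fun k => by
      have := h1 (resS (p k) (sp k))
      rw [ContinuousLinearMap.adjoint_inner_left, hz k, inner_zero_right] at this
      exact this.symm
    simp only [h3] at h2
    rw [h1]
    have := tendsto_nhds_unique h2 tendsto_const_nhds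
    simpa using this
  · rintro rfl f ℓ ℓ₁ ⟨u, G, hu, -, h0, h1, hN⟩ ⟨w, G₁, hw, -, hw1, hN1⟩ φ hφ
    obtain ⟨b, hb, hb1, hb0⟩ := exists_inclusion_cutoff hR hC
    have hχ : ContDiff ℝ ∞ fun x => 1 - b x := contDiff_const.sub hb
    -- Multiplication by `1 - b` makes any smooth function admissible for the Neumann trace without
    -- changing its values on `∂𝔹`. The resulting formula for `ℓ` is continuous under `C1Tendsto`.
    have hN' : ∀ ψ : E d → ℂ, ContDiff ℝ ∞ ψ → ℓ (fun θ => ψ θ) =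
        ∫ x in dom C R, ∑ i, G i x * pd i (fun x => (1 - b x) * ψ x) x := by
      intro ψ hψ
      rw [← hN _ (hχ.mul hψ) fun x hx => by
        rw [(hb1 x (sphere_subset_closedBall hx)).self_of_nhds]; simp]
      congr 1
      ext θ
      rw [(hb0 θ (by simp)).self_of_nhds]; simp
    obtain ⟨p, hn, hp⟩ := hdense φ hφ
    have sp : ∀ k, ContDiff ℝ ∞ (p k) := fun k => (hn k).1
    -- For the data `p k` the Neumann traces are tested with the harmonic functions `Φ` and `H`
    -- instead of cutoffs. Green's formula moves the normal derivative onto them, so `ℓ - ℓ₁` at `p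
    -- k` is `∫ f · (T' p_k)`, and symmetry moves `T'` onto `f`.
    have key : ∀ k, ∫ θ : S d, T' f θ * p k θ ∂(surf d) =
        ℓ (fun θ => p k θ) - ℓ₁ (fun θ => p k θ) := by
      intro k
      obtain ⟨hpk, Φ, H, g, sΦ, sH, lH, lΦ, zΦ, hθ, hTg⟩ := hn k
      have e1 : ℓ (fun θ => p k θ) = ∫ θ : S d, f θ * fderiv ℝ Φ θ θ ∂(surf d) := by
        rw [← integral_grad_dom hR hC hu h0 h1 sΦ lΦ, ← hN Φ sΦ zΦ]
        congr 1
        ext θ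
        rw [(hθ θ).1]
      have e2 : ℓ₁ (fun θ => p k θ) = ∫ θ : S d, f θ * fderiv ℝ H θ θ ∂(surf d) := by
        rw [← integral_grad_ball hw hw1 sH lH, ← hN1 H sH (by simp)]
        congr 1
        ext θ
        rw [(hθ θ).2.1]
      have e3 : ∫ θ : S d, T' f θ * p k θ ∂(surf d) = pair (T' f) (toL2 (resS (p k) hpk)) :=
        (pair_toL2_right (T' f) (resS (p k) hpk)).symm
      rw [e1, e2, e3, hT, hTg, pair_toL2_right, ← integral_sub]
      · refine integral_congr_ae (Eventually.of_forall fun θ => ?_)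
        simp only
        rw [(hθ θ).2.2]; ring
      · exact (Lp.memLp f).integrable_mul (memLp_sphere_of_continuous (continuous_fderiv_self sΦ))
      · exact (Lp.memLp f).integrable_mul (memLp_sphere_of_continuous (continuous_fderiv_self sH))
    have l1 := hp.tendsto_integral_sphere sp (T' f)
    have l2 := (hp.mul_left sp hφ hχ).tendsto_integral_grad (fun k => hχ.mul (sp k))
      (measurableSet_dom C R) (dom_subset C R) hu.2.1
    have l3 := hp.tendsto_integral_grad sp measurableSet_ball le_rfl hw.2.1
    have l4 := l2.sub l3
    rw [hN' φ hφ, hN1 φ hφ (by simp)]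
    refine tendsto_nhds_unique l1 (l4.congr fun k => ?_)
    rw [key k, hN' _ (sp k), hN1 _ (sp k) (by simp)]

end Criterion

end DepthEIT

namespace DepthEIT

variable {d : ℕ}

/-! ### `C¹` approximation by polynomials with Landau kernels -/

section PolynomialApproximation

open Set Metric MvPolynomial
open scoped Convolution

/-- Kernels that are polynomial in the first variable and continuous in the second one. -/
def IsPolyKernel (k : E d → E d → ℂ) : Prop :=
  ∃ (ι : Type) (_ : Fintype ι) (P : ι → MvPolynomial (Fin d) ℂ) (b : ι → E d → ℂ),
    (∀ j, Continuous (b j)) ∧ ∀ x y, k x y = ∑ j, ev (P j) x * b j y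

lemma IsPolyKernel.of_mul (P : MvPolynomial (Fin d) ℂ) {b : E d → ℂ} (hb : Continuous b) :
    IsPolyKernel fun x y => ev P x * b y :=
  ⟨Unit, inferInstance, fun _ => P, fun _ => b, fun _ => hb, fun x y => by simp⟩

lemma IsPolyKernel.add {k l : E d → E d → ℂ} (hk : IsPolyKernel k) (hl : IsPolyKernel l) :
    IsPolyKernel fun x y => k x y + l x y := by
  obtain ⟨ι, _, P, b, hb, h⟩ := hk
  obtain ⟨κ, _, Q, c, hc, h'⟩ := hl
  refine ⟨ι ⊕ κ, inferInstance, Sum.elim P Q, Sum.elim b c, ?_, fun x y => ?_⟩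
  · rintro (j | j)
    exacts [hb j, hc j]
  · simp [Fintype.sum_sum_type, h, h']

lemma IsPolyKernel.mul {k l : E d → E d → ℂ} (hk : IsPolyKernel k) (hl : IsPolyKernel l) :
    IsPolyKernel fun x y => k x y * l x y := by
  obtain ⟨ι, _, P, b, hb, h⟩ := hk
  obtain ⟨κ, _, Q, c, hc, h'⟩ := hl
  refine ⟨ι × κ, inferInstance, fun p => P p.1 * Q p.2, fun p y => b p.1 y * c p.2 y,
    fun p => (hb p.1).mul (hc p.2), fun x y => ?_⟩
  simp only
  rw [h, h', Finset.sum_mul_sum, Fintype.sum_prod_type]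
  refine Finset.sum_congr rfl fun i _ => Finset.sum_congr rfl fun j _ => ?_
  simp; ring

lemma IsPolyKernel.sum {ι : Type*} (s : Finset ι) {k : ι → E d → E d → ℂ}
    (hk : ∀ i, IsPolyKernel (k i)) : IsPolyKernel fun x y => ∑ i ∈ s, k i x y := by
  classical
  induction s using Finset.induction_on with
  | empty => simpa using IsPolyKernel.of_mul (d := d) 0 (b := fun _ => 0) continuous_const
  | insert a s ha ih => simpa [Finset.sum_insert ha] using (hk a).add ih

lemma IsPolyKernel.pow {k : E d → E d → ℂ} (hk : IsPolyKernel k) (n : ℕ) :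
    IsPolyKernel fun x y => k x y ^ n := by
  induction n with
  | zero => simpa using IsPolyKernel.of_mul (d := d) 1 (b := fun _ => 1) continuous_const
  | succ n ih => simpa [pow_succ] using ih.mul hk

/-- Integrating out `y` in a finite sum of products leaves a combination of the polynomial factors.
This is why convolution with a Landau kernel yields a polynomial. -/
lemma IsPolyKernel.exists_integral_eq {k : E d → E d → ℂ} (hk : IsPolyKernel k) {ψ : E d → ℂ}
    (hψ : Continuous ψ) (hs : HasCompactSupport ψ) :
    ∃ P : MvPolynomial (Fin d) ℂ, ∀ x, ∫ y, k x y * ψ y = ev P x := by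
  obtain ⟨ι, _, P, b, hb, h⟩ := hk
  refine ⟨∑ j, C (∫ y, b j y * ψ y) * P j, fun x => ?_⟩
  simp only [h, Finset.sum_mul, mul_assoc, ev_sum, ev_mul, ev_C]
  rw [integral_finsetSum]
  · refine Finset.sum_congr rfl fun j _ => ?_
    rw [integral_const_mul, mul_comm]
  · exact fun j _ => (((hb j).mul hψ).integrable_of_hasCompactSupport hs.mul_left).const_mul _

/-- The base of the Landau kernels. -/
noncomputable def landau (x : E d) : ℝ := 1 - ‖x‖ ^ 2 / 16

lemma isPolyKernel_landau : IsPolyKernel fun x y : E d => ((landau (x - y) : ℝ) : ℂ) := by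
  have h1 := IsPolyKernel.of_mul (d := d) (1 - C (1 / 16) * normSqP d) (b := fun _ => 1)
    continuous_const
  have h2 := IsPolyKernel.sum (d := d) Finset.univ fun i : Fin d =>
    IsPolyKernel.of_mul (C (1 / 8) * X i : MvPolynomial (Fin d) ℂ) (b := fun y => (y i : ℂ))
      (contDiff_coord i).continuous
  have h3 := IsPolyKernel.of_mul (d := d) 1 (b := fun y => ((-(‖y‖ ^ 2) / 16 : ℝ) : ℂ))
    (by fun_prop)
  convert! (h1.add h2).add h3 using 3 with x y
  rw [landau, norm_sub_sq_real, PiLp.inner_apply]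
  simp only [ev_sub, ev_one, ev_mul, ev_C, ev_normSqP, ev_X, mul_assoc, ← Finset.mul_sum]
  simp
  rw [show ∑ i, (y i : ℂ) * (x i : ℂ) = ∑ i, (x i : ℂ) * (y i : ℂ) from
    Finset.sum_congr rfl fun i _ => mul_comm _ _]
  ring

lemma continuous_landau : Continuous (landau : E d → ℝ) := by unfold landau; fun_prop

/-- Convolution with the unnormalized `n`-th Landau kernel. -/
noncomputable def landauConv (n : ℕ) (ψ : E d → ℂ) : E d → ℂ :=
  (fun x => landau x ^ n) ⋆[ContinuousLinearMap.lsmul ℝ ℝ, volume] ψ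

lemma exists_landauConv_eq (n : ℕ) {ψ : E d → ℂ} (hψ : Continuous ψ) (hs : HasCompactSupport ψ) :
    ∃ P : MvPolynomial (Fin d) ℂ, landauConv n ψ = ev P := by
  obtain ⟨P, hP⟩ := (isPolyKernel_landau.pow n).exists_integral_eq hψ hs
  refine ⟨P, funext fun x => ?_⟩
  rw [← hP x, landauConv, convolution_eq_swap]
  refine integral_congr_ae (Eventually.of_forall fun y => ?_)
  simp

/-- The derivative falls on `ψ`, so one convergence statement covers both the functions and their
first derivatives. -/
lemma pd_landauConv (n : ℕ) {ψ : E d → ℂ} (hψ : ContDiff ℝ ∞ ψ) (hs : HasCompactSupport ψ)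
    (i : Fin d) (x : E d) : pd i (landauConv n ψ) x = landauConv n (pd i ψ) x := by
  have hl : LocallyIntegrable (fun x : E d => landau x ^ n) :=
    (continuous_landau.pow n).locallyIntegrable
  have h := hs.hasFDerivAt_convolution_right (ContinuousLinearMap.lsmul ℝ ℝ : ℝ →L[ℝ] ℂ →L[ℝ] ℂ)
    hl (hψ.of_le (by exact_mod_cast le_top)) x
  rw [landauConv, pd_eq_of_hasFDerivAt h, convolution_precompR_apply _ hl
    (hs.fderiv (𝕜 := ℝ)) (hψ.continuous_fderiv (by simp))]
  rfl

/-- The normalization of the Landau kernels. -/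
noncomputable def landauMass (d n : ℕ) : ℝ := ∫ x in closedBall (0 : E d) 4, landau x ^ n

lemma landau_nonneg {x : E d} (hx : x ∈ closedBall (0 : E d) 4) : 0 ≤ landau x := by
  rw [mem_closedBall_zero_iff] at hx
  rw [landau]; nlinarith [norm_nonneg x]

/-- If `|x| ≤ 1` and `|t| > 4`, then `|x - t| > 2` and `ψ (x - t) = 0`. The polynomial kernel thus
matters only on the ball of radius `4`, where its base is nonnegative. -/
lemma landauConv_eq {ψ : E d → ℂ} (hs : ∀ x, 2 < ‖x‖ → ψ x = 0) (n : ℕ)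
    {x : E d} (hx : x ∈ closedBall (0 : E d) 1) :
    landauConv n ψ x = ∫ t in closedBall (0 : E d) 4, landau t ^ n • ψ (x - t) := by
  rw [setIntegral_eq_integral_of_forall_compl_eq_zero]
  · rfl
  · intro t ht
    rw [mem_closedBall_zero_iff, not_le] at ht
    rw [mem_closedBall_zero_iff] at hx
    rw [hs _ _, smul_zero]
    have := norm_sub_norm_le t x
    rw [norm_sub_rev] at this
    linarith

/-- On the ball of radius `4` the base of the kernel has its unique maximum at the origin, so its
normalized powers concentrate there. -/
lemma tendsto_landauConv {ψ : E d → ℂ} (hψ : Continuous ψ) (hs : ∀ x, 2 < ‖x‖ → ψ x = 0)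
    {x : E d} (hx : x ∈ closedBall (0 : E d) 1) :
    Tendsto (fun n => (landauMass d n)⁻¹ • landauConv n ψ x) atTop (𝓝 (ψ x)) := by
  have h := tendsto_setIntegral_pow_smul_of_unique_maximum_of_isCompact_of_continuousOn
    (μ := (volume : Measure (E d))) (isCompact_closedBall (0 : E d) 4)
    (c := landau) (x₀ := 0) (g := fun t => ψ (x - t)) continuous_landau.continuousOn ?_
    (fun x hx => landau_nonneg hx) (by simp [landau]) ?_ (by fun_prop)
  · simpa [landauMass, landauConv_eq hs _ hx] using h
  · intro y _ hy
    have : 0 < ‖y‖ := norm_pos_iff.2 hy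
    simp only [landau, norm_zero]
    have : 0 < ‖y‖ ^ 2 := by positivity
    linarith
  · refine subset_closure (mem_interior.2 ⟨ball 0 4, ball_subset_closedBall, isOpen_ball, by simp⟩)

lemma norm_landauConv_le {ψ : E d → ℂ} (hs : ∀ x, 2 < ‖x‖ → ψ x = 0) {M : ℝ}
    (hM : ∀ x, ‖ψ x‖ ≤ M) (n : ℕ) {x : E d} (hx : x ∈ closedBall (0 : E d) 1) :
    ‖(landauMass d n)⁻¹ • landauConv n ψ x‖ ≤ M := by
  have hM0 : 0 ≤ M := (norm_nonneg _).trans (hM 0)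
  have hc : IntegrableOn (fun x : E d => landau x ^ n) (closedBall 0 4) :=
    (continuous_landau.pow n).continuousOn.integrableOn_compact (isCompact_closedBall _ _)
  have hm : 0 ≤ landauMass d n :=
    setIntegral_nonneg measurableSet_closedBall fun x hx => pow_nonneg (landau_nonneg hx) n
  have h1 : ‖landauConv n ψ x‖ ≤ landauMass d n * M := by
    rw [landauConv_eq hs n hx, landauMass, ← integral_mul_const]
    refine norm_integral_le_of_norm_le (hc.mul_const M) ?_
    filter_upwards [ae_restrict_mem measurableSet_closedBall] with t ht
    rw [norm_smul, Real.norm_of_nonneg (pow_nonneg (landau_nonneg ht) n)]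
    exact mul_le_mul_of_nonneg_left (hM _) (pow_nonneg (landau_nonneg ht) n)
  rw [norm_smul, norm_inv, Real.norm_of_nonneg hm]
  rcases hm.eq_or_lt with h0 | h0
  · rw [← h0]; simpa using hM0
  · rw [inv_mul_le_iff₀ h0]; exact h1

/-- Smooth functions are limits of polynomials in the sense of `C1Tendsto`. -/
theorem exists_polynomial_C1Tendsto {φ : E d → ℂ} (hφ : ContDiff ℝ ∞ φ) :
    ∃ P : ℕ → MvPolynomial (Fin d) ℂ, C1Tendsto (fun n => ev (P n)) φ := by
  -- The cutoff leaves `φ` unchanged in a neighbourhood of the closed unit ball and vanishes outside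
  -- radius `2`, as the Landau estimates require.
  let B : ContDiffBump (0 : E d) := ⟨3 / 2, 2, by norm_num, by norm_num⟩
  have sB : ContDiff ℝ ∞ fun x => (B x : ℂ) := Complex.ofRealCLM.contDiff.comp B.contDiff
  set ψ : E d → ℂ := fun x => (B x : ℂ) * φ x with hψ
  have sψ : ContDiff ℝ ∞ ψ := sB.mul hφ
  have z : ∀ x, 2 < ‖x‖ → ψ x = 0 := fun x hx => by
    have : B x = 0 := B.zero_of_le_dist (by rw [dist_zero_right]; exact hx.le)
    simp [hψ, this]
  have cs : HasCompactSupport ψ :=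
    HasCompactSupport.of_support_subset_isCompact (isCompact_closedBall (0 : E d) 2) fun x hx => by
      rw [mem_closedBall_zero_iff]
      by_contra h
      exact hx (z x (not_le.1 h))
  have zpd : ∀ i x, 2 < ‖x‖ → pd i ψ x = 0 := fun i x hx => by
    have : ψ =ᶠ[𝓝 x] fun _ => 0 := by
      filter_upwards [(isOpen_lt continuous_const continuous_norm).mem_nhds hx] with y hy using z y hy
    rw [pd_congr i this, pd_const]
  have csp : ∀ i, HasCompactSupport (pd i ψ) := fun i =>
    (cs.fderiv (𝕜 := ℝ)).comp_left
      (g := fun L : E d →L[ℝ] ℂ => L (EuclideanSpace.single i 1)) (by simp)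
  have near : ∀ x ∈ closedBall (0 : E d) 1, ψ =ᶠ[𝓝 x] φ := fun x hx => by
    have : x ∈ ball (0 : E d) (3 / 2) := closedBall_subset_ball (by norm_num) hx
    filter_upwards [isOpen_ball.mem_nhds this] with y hy
    have : B y = 1 := B.one_of_mem_closedBall (ball_subset_closedBall hy)
    simp [hψ, this]
  have hex : ∀ n, ∃ P : MvPolynomial (Fin d) ℂ,
      (fun x => (landauMass d n)⁻¹ • landauConv n ψ x) = ev P := fun n => by
    obtain ⟨P, hP⟩ := exists_landauConv_eq n sψ.continuous cs
    exact ⟨C (((landauMass d n)⁻¹ : ℝ) : ℂ) * P, funext fun x => by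
      rw [hP, Complex.real_smul, ev_mul, ev_C]⟩
  choose P hP using hex
  have hpd : ∀ n i x, pd i (ev (P n)) x = (landauMass d n)⁻¹ • landauConv n (pd i ψ) x := by
    intro n i x
    obtain ⟨Q, hQ⟩ := exists_landauConv_eq n sψ.continuous cs
    rw [← hP, ← pd_landauConv n sψ cs, hQ]
    simp only [Complex.real_smul]
    exact pd_const_mul i _ (differentiableAt_ev Q x)
  obtain ⟨M₀, hM₀⟩ := sψ.continuous.bounded_above_of_compact_support cs
  have := fun i => (continuous_pd sψ i).bounded_above_of_compact_support (csp i)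
  choose M hM using this
  have hM0 : ∀ i, 0 ≤ M i := fun i => (norm_nonneg _).trans (hM i 0)
  have hM00 : 0 ≤ M₀ := (norm_nonneg _).trans (hM₀ 0)
  refine ⟨P, fun x hx => ?_, fun i x hx => ?_, M₀ + ∑ i, M i, fun n x hx => ⟨?_, fun i => ?_⟩⟩
  · rw [← (near x hx).self_of_nhds]
    exact (tendsto_landauConv sψ.continuous z hx).congr fun n => congrFun (hP n) x
  · rw [← pd_congr i (near x hx)]
    simp only [hpd]
    exact tendsto_landauConv (continuous_pd sψ i) (zpd i) hx
  · simp only [← hP]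
    exact (norm_landauConv_le z hM₀ n hx).trans
      (le_add_of_nonneg_right (Finset.sum_nonneg fun i _ => hM0 i))
  · rw [hpd]
    refine (norm_landauConv_le (zpd i) (hM i) n hx).trans ?_
    have := Finset.single_le_sum (f := M) (fun i _ => hM0 i) (Finset.mem_univ i)
    linarith

end PolynomialApproximation

end DepthEIT

namespace DepthEIT

variable {d : ℕ}

/-! ### Positivity, monotonicity and asymptotics of the eigenvalues -/

section Eigenvalues

/-- The eigenvalues as a function of `m = 2n + d - 2`. -/
noncomputable def eigAux (r : ℝ) (m : ℕ) : ℝ :=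
  if m = 0 then -1 / Real.log r else m * r ^ m / (1 - r ^ m)

/-- All dimensions are covered by one function of `m = 2n + d - 2`, a subtraction that is not
truncated since `d ≥ 2`. The exceptional case `d = 2`, `n = 0` is `m = 0`, whose value `-1/log r` is
the limit of `m r^m/(1 - r^m)` as the real variable `m` tends to `0`. -/
lemma eig_eq_eigAux (hd : 2 ≤ d) {r : ℝ} (hr : 0 < r) (n : ℕ) :
    eig d r n = eigAux r (2 * n + d - 2) := by
  obtain ⟨e, rfl⟩ := Nat.exists_eq_add_of_le hd
  rw [eig, eigAux, show 2 * n + (2 + e) - 2 = 2 * n + e by omega]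
  by_cases h : 2 * n + e = 0
  · rw [if_pos h, if_pos (by omega)]
  · rw [if_neg h, if_neg (by omega)]
    have h1 : (2 : ℤ) - ((2 + e : ℕ) : ℤ) - 2 * n = -((2 * n + e : ℕ) : ℤ) := by push_cast; ring
    rw [h1, zpow_neg, zpow_natCast]
    have h2 : 0 < r ^ (2 * n + e) := pow_pos hr _
    rw [show (2 * n + ((2 + e : ℕ) : ℝ) - 2) = ((2 * n + e : ℕ) : ℝ) by push_cast; ring,
      ← one_div, div_sub_one h2.ne', div_div_eq_mul_div]

variable {r : ℝ}

lemma one_sub_pow_pos (hr0 : 0 < r) (hr1 : r < 1) {m : ℕ} (hm : m ≠ 0) : 0 < 1 - r ^ m :=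
  sub_pos.2 (pow_lt_one₀ hr0.le hr1 hm)

lemma eigAux_pos (hr0 : 0 < r) (hr1 : r < 1) (m : ℕ) : 0 < eigAux r m := by
  rw [eigAux]
  split_ifs with h
  · exact div_pos_of_neg_of_neg (by norm_num) (Real.log_neg hr0 hr1)
  · have := one_sub_pow_pos hr0 hr1 h
    have : (0 : ℝ) < m := by exact_mod_cast Nat.pos_of_ne_zero h
    positivity

/-- After clearing denominators, the case `m ≥ 1` is `m - (m+1)r + r^(m+1) ≥ 0`, which is
Bernoulli's inequality; the case `m = 0` is `log (1/r) ≤ 1/r - 1`. -/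
lemma eigAux_succ_le (hr0 : 0 < r) (hr1 : r < 1) (m : ℕ) : eigAux r (m + 1) ≤ eigAux r m := by
  rcases Nat.eq_zero_or_pos m with rfl | hm
  · rw [eigAux, eigAux, if_pos rfl, if_neg (by simp)]
    have h1 : 0 < -Real.log r := neg_pos.2 (Real.log_neg hr0 hr1)
    have h2 : -Real.log r ≤ (1 - r) / r := by
      have := Real.log_le_sub_one_of_pos (inv_pos.2 hr0)
      rw [Real.log_inv] at this
      refine this.trans (le_of_eq ?_)
      field_simp
    rw [← neg_div_neg_eq (-1)]
    simp only [neg_neg, zero_add, Nat.cast_one, one_mul, pow_one]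
    have h3 : 0 < 1 - r := sub_pos.2 hr1
    rw [div_le_div_iff₀ h3 h1]
    rw [le_div_iff₀ hr0] at h2
    linarith
  · rw [eigAux, eigAux, if_neg (by omega), if_neg (by omega)]
    rw [div_le_div_iff₀ (one_sub_pow_pos hr0 hr1 (by omega)) (one_sub_pow_pos hr0 hr1 (by omega))]
    have key : ∀ k : ℕ, 0 ≤ (k : ℝ) - (k + 1) * r + r ^ (k + 1) := by
      intro k
      have := one_add_mul_le_pow (a := r - 1) (by linarith) (k + 1)
      push_cast at this
      have e : 1 + (r - 1) = r := by ring
      rw [e] at this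
      nlinarith
    have hp : 0 < r ^ m := pow_pos hr0 m
    have := mul_nonneg hp.le (key m)
    push_cast
    rw [pow_succ] at *
    nlinarith

lemma eigAux_antitone (hr0 : 0 < r) (hr1 : r < 1) : Antitone (eigAux r) :=
  antitone_nat_of_succ_le (eigAux_succ_le hr0 hr1)

lemma summable_eigAux (hr0 : 0 < r) (hr1 : r < 1) : Summable (eigAux r) := by
  rw [← summable_nat_add_iff 1]
  have h1 : Summable fun m : ℕ => (m : ℝ) ^ 1 * r ^ m :=
    summable_pow_mul_geometric_of_norm_lt_one 1 (by rwa [Real.norm_of_nonneg hr0.le])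
  have h2 := ((summable_nat_add_iff 1).2 h1).mul_right (1 - r)⁻¹
  refine Summable.of_nonneg_of_le (fun m => (eigAux_pos hr0 hr1 _).le) (fun m => ?_) h2
  rw [eigAux, if_neg (by omega), pow_one, div_eq_mul_inv]
  have h3 : 0 < 1 - r := sub_pos.2 hr1
  have h4 : r ^ (m + 1) ≤ r := pow_le_of_le_one hr0.le hr1.le (by omega)
  gcongr

lemma eig_pos (hd : 2 ≤ d) (hr0 : 0 < r) (hr1 : r < 1) (n : ℕ) : 0 < eig d r n := by
  rw [eig_eq_eigAux hd hr0]; exact eigAux_pos hr0 hr1 _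

lemma eig_antitone (hd : 2 ≤ d) (hr0 : 0 < r) (hr1 : r < 1) : Antitone (eig d r) := by
  intro n m h
  rw [eig_eq_eigAux hd hr0, eig_eq_eigAux hd hr0]
  exact eigAux_antitone hr0 hr1 (by omega)

lemma summable_eig (hd : 2 ≤ d) (hr0 : 0 < r) (hr1 : r < 1) : Summable (eig d r) := by
  have : eig d r = eigAux r ∘ fun n => 2 * n + d - 2 := funext fun n => eig_eq_eigAux hd hr0 n
  rw [this]
  exact (summable_eigAux hr0 hr1).comp_injective fun a b h => by
    have h' : 2 * a + d - 2 = 2 * b + d - 2 := h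
    omega

/-- Every eigenvalue behaves like `1/(1-r)` near `r = 1`: for `m > 0` because `1 - r^m = (1-r) ∑
r^j`, for `m = 0` because `log` has derivative `1` at `1`. Quotients of eigenvalues of fixed index
therefore tend to `1`. -/
lemma tendsto_mul_eigAux (m : ℕ) :
    Tendsto (fun r : ℝ => (1 - r) * eigAux r m) (𝓝[<] 1) (𝓝 1) := by
  have hIoo : ∀ᶠ r : ℝ in 𝓝[<] 1, r ∈ Set.Ioo (0 : ℝ) 1 := Ioo_mem_nhdsLT one_pos
  rcases Nat.eq_zero_or_pos m with rfl | hm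
  · have h1 : HasDerivAt Real.log 1 1 := by simpa using Real.hasDerivAt_log one_ne_zero
    have h2 := (hasDerivAt_iff_tendsto_slope.1 h1).mono_left
      (nhdsWithin_mono (1 : ℝ) (fun x hx => ne_of_lt hx : Set.Iio (1 : ℝ) ⊆ {1}ᶜ))
    have h3 := h2.inv₀ one_ne_zero
    rw [inv_one] at h3
    refine h3.congr' ?_
    filter_upwards [hIoo] with r hr
    have : Real.log r ≠ 0 := (Real.log_neg hr.1 hr.2).ne
    rw [eigAux, if_pos rfl, slope_def_field, Real.log_one, sub_zero, inv_div]
    field_simp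
    ring
  · have h1 : Tendsto (fun r : ℝ => m * r ^ m / ∑ j ∈ Finset.range m, r ^ j) (𝓝[<] 1) (𝓝 1) := by
      have hc : ContinuousAt (fun r : ℝ => m * r ^ m / ∑ j ∈ Finset.range m, r ^ j) 1 := by
        refine ContinuousAt.div (by fun_prop) (by fun_prop) ?_
        simp; omega
      have := hc.tendsto.mono_left (nhdsWithin_le_nhds (s := Set.Iio (1 : ℝ)))
      have hm' : (m : ℝ) ≠ 0 := by exact_mod_cast hm.ne'
      simpa [hm'] using this
    refine h1.congr' ?_
    filter_upwards [hIoo] with r hr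
    rw [eigAux, if_neg hm.ne']
    have h2 := mul_neg_geom_sum r m
    have h3 : 0 < 1 - r := sub_pos.2 hr.2
    have h4 : 0 < ∑ j ∈ Finset.range m, r ^ j :=
      Finset.sum_pos (fun j _ => pow_pos hr.1 j) (by simp; omega)
    rw [← h2]
    field_simp

lemma tendsto_eig_div_eig (hd : 2 ≤ d) (n : ℕ) :
    Tendsto (fun r : ℝ => eig d r n / eig d r 0) (𝓝[<] 1) (𝓝 1) := by
  have hIoo : ∀ᶠ r : ℝ in 𝓝[<] 1, r ∈ Set.Ioo (0 : ℝ) 1 := Ioo_mem_nhdsLT one_pos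
  have h := (tendsto_mul_eigAux (2 * n + d - 2)).div (tendsto_mul_eigAux (2 * 0 + d - 2)) one_ne_zero
  rw [div_one] at h
  refine h.congr' ?_
  filter_upwards [hIoo] with r hr
  have : 1 - r ≠ 0 := (sub_pos.2 hr.2).ne'
  rw [eig_eq_eigAux hd hr.1, eig_eq_eigAux hd hr.1]
  simp only [Pi.div_apply]
  rw [mul_div_mul_left _ _ this]

/-- The quotient is at most `3r/(1 - r²)`. With `e = d - 2`, this rests on `λ_0 ≥ e r^e` and `e + 2
≤ 3e` when `e ≥ 1`, and on `λ_0 ≥ r`, from `-log r ≤ 1/r`, when `e = 0`. -/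
lemma tendsto_eig_one_div_eig_zero (hd : 2 ≤ d) :
    Tendsto (fun r : ℝ => eig d r 1 / eig d r 0) (𝓝[>] 0) (𝓝 0) := by
  have hIoo : ∀ᶠ r : ℝ in 𝓝[>] 0, r ∈ Set.Ioo (0 : ℝ) 1 := Ioo_mem_nhdsGT one_pos
  have h1 : Tendsto (fun r : ℝ => 3 * r / (1 - r ^ 2)) (𝓝[>] 0) (𝓝 0) := by
    have hc : ContinuousAt (fun r : ℝ => 3 * r / (1 - r ^ 2)) 0 :=
      ContinuousAt.div (by fun_prop) (by fun_prop) (by simp)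
    have := hc.tendsto.mono_left (nhdsWithin_le_nhds (s := Set.Ioi (0 : ℝ)))
    simpa using this
  refine tendsto_of_tendsto_of_tendsto_of_le_of_le' tendsto_const_nhds h1 ?_ ?_
  · filter_upwards [hIoo] with r hr
    exact (div_pos (eig_pos hd hr.1 hr.2 1) (eig_pos hd hr.1 hr.2 0)).le
  · filter_upwards [hIoo] with r hr
    obtain ⟨hr0, hr1⟩ := hr
    rw [div_le_iff₀ (eig_pos hd hr0 hr1 0), eig_eq_eigAux hd hr0, eig_eq_eigAux hd hr0]
    obtain ⟨e, rfl⟩ := Nat.exists_eq_add_of_le hd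
    rw [show 2 * 1 + (2 + e) - 2 = e + 2 by omega, show 2 * 0 + (2 + e) - 2 = e by omega]
    have h2 : 0 < 1 - r ^ 2 := one_sub_pow_pos hr0 hr1 (by omega)
    have h3 : 0 < 1 - r ^ (e + 2) := one_sub_pow_pos hr0 hr1 (by omega)
    have h4 : 1 - r ^ 2 ≤ 1 - r ^ (e + 2) :=
      sub_le_sub_left (pow_le_pow_of_le_one hr0.le hr1.le (by omega)) 1
    have h5 : (e + 2) * r ^ (e + 2) ≤ 3 * r * eigAux r e := by
      rw [eigAux]
      split_ifs with he
      · subst he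
        have h6 : 0 < -Real.log r := neg_pos.2 (Real.log_neg hr0 hr1)
        have h7 : -Real.log r ≤ r⁻¹ := by
          have := Real.log_le_sub_one_of_pos (inv_pos.2 hr0)
          rw [Real.log_inv] at this
          linarith
        rw [← neg_div_neg_eq (-1), neg_neg]
        have h8 : r ≤ 1 / -Real.log r := by
          rw [le_div_iff₀ h6]
          calc r * -Real.log r ≤ r * r⁻¹ := by gcongr
            _ = 1 := mul_inv_cancel₀ hr0.ne'
        have := mul_le_mul_of_nonneg_left h8 (by positivity : 0 ≤ 3 * r)
        simp only [Nat.cast_zero, zero_add]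
        nlinarith [sq_nonneg r]
      · have h9 : 0 < 1 - r ^ e := one_sub_pow_pos hr0 hr1 he
        have he' : (1 : ℝ) ≤ e := by exact_mod_cast Nat.one_le_iff_ne_zero.2 he
        have h10 : (e : ℝ) * r ^ e ≤ e * r ^ e / (1 - r ^ e) := by
          rw [le_div_iff₀ h9]
          have : 0 < r ^ e := pow_pos hr0 e
          nlinarith [mul_pos (lt_of_lt_of_le one_pos he') this]
        have h11 : r ^ (e + 2) = r ^ e * r * r := by ring
        have h12 : 0 < r ^ e * r := by positivity
        calc ((e : ℝ) + 2) * r ^ (e + 2) ≤ 3 * e * (r ^ e * r) := by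
              rw [h11]
              nlinarith [mul_le_mul_of_nonneg_left hr1.le h12.le]
          _ = 3 * r * (e * r ^ e) := by ring
          _ ≤ _ := by gcongr
    have he : 0 < eigAux r e := eigAux_pos hr0 hr1 e
    rw [eigAux, if_neg (by omega)]
    push_cast
    calc (e + 2) * r ^ (e + 2) / (1 - r ^ (e + 2)) ≤ 3 * r * eigAux r e / (1 - r ^ 2) := by
          gcongr
      _ = _ := by ring

end Eigenvalues

end DepthEIT

namespace DepthEIT

variable {d : ℕ}

/-! ### Operators diagonal on spherical harmonics -/

section Multipliers

/-- The closed span of the spherical harmonics of degree `n`. -/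
noncomputable def harmSpace (d n : ℕ) : Submodule ℂ (L2S d) :=
  (Submodule.span ℂ {f | ∃ P : MvPolynomial (Fin d) ℂ, IsHarm n P ∧ toL2 (evS P) = f}).topologicalClosure

instance (n : ℕ) : CompleteSpace (harmSpace d n) := by
  unfold harmSpace; infer_instance

lemma toL2_mem_harmSpace {n : ℕ} {P : MvPolynomial (Fin d) ℂ} (hP : IsHarm n P) :
    toL2 (evS P) ∈ harmSpace d n :=
  Submodule.le_topologicalClosure _ (Submodule.subset_span ⟨P, hP, rfl⟩)

lemma inner_toL2 (f g : C(S d, ℂ)) : inner ℂ (toL2 f) (toL2 g) = pair (toL2 (star f)) (toL2 g) := by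
  rw [pair_toL2, L2.inner_def]
  refine integral_congr_ae ?_
  filter_upwards [coeFn_toL2 f, coeFn_toL2 g] with θ h1 h2
  rw [h1, h2]
  simp [mul_comm]

lemma inner_harm_harm [NeZero d] {n m : ℕ} (hnm : n ≠ m) {P Q : MvPolynomial (Fin d) ℂ}
    (hP : IsHarm n P) (hQ : IsHarm m Q) : inner ℂ (toL2 (evS P)) (toL2 (evS Q)) = 0 := by
  rw [inner_toL2, pair_toL2, ← integral_harm_mul_harm hnm hP.conjP hQ]
  refine integral_congr_ae (Eventually.of_forall fun θ => ?_)
  simp [ev_conjP]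

lemma mem_harmSpace_orthogonal_iff {n : ℕ} {f : L2S d} : f ∈ (harmSpace d n)ᗮ ↔
    ∀ P : MvPolynomial (Fin d) ℂ, IsHarm n P → inner ℂ (toL2 (evS P)) f = 0 := by
  constructor
  · exact fun h P hP => h _ (toL2_mem_harmSpace hP)
  · intro h
    have h1 : harmSpace d n ≤ (ℂ ∙ f)ᗮ := by
      refine Submodule.topologicalClosure_minimal _ (Submodule.span_le.2 ?_)
        (Submodule.isClosed_orthogonal _)
      rintro _ ⟨P, hP, rfl⟩
      exact Submodule.mem_orthogonal_singleton_iff_inner_left.2 (h P hP)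
    intro g hg
    exact Submodule.mem_orthogonal_singleton_iff_inner_left.1 (h1 hg)

lemma starProjection_harm [NeZero d] {n m : ℕ} {P : MvPolynomial (Fin d) ℂ} (hP : IsHarm m P) :
    (harmSpace d n).starProjection (toL2 (evS P)) = if n = m then toL2 (evS P) else 0 := by
  split_ifs with h
  · subst h
    exact Submodule.starProjection_eq_self_iff.2 (toL2_mem_harmSpace hP)
  · have : toL2 (evS P) ∈ (harmSpace d n)ᗮ :=
      mem_harmSpace_orthogonal_iff.2 fun Q hQ => inner_harm_harm h hQ hP
    rw [← Submodule.ker_starProjection] at this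
    exact this

/-- `T` acts on the spherical harmonics of degree `n` as multiplication by `c n`. -/
def IsMultiplier (c : ℕ → ℝ) (T : L2S d →L[ℂ] L2S d) : Prop :=
  ∀ (n : ℕ) (P : MvPolynomial (Fin d) ℂ), IsHarm n P → T (toL2 (evS P)) = (c n : ℂ) • toL2 (evS P)

/-- Summability lets the operator be written as a series `∑ c_n Π_n` of orthogonal projections that
converges absolutely in norm. -/
lemma exists_isMultiplier [NeZero d] {c : ℕ → ℝ} (hc : Summable c) (hc0 : ∀ n, 0 ≤ c n) :
    ∃ T : L2S d →L[ℂ] L2S d, IsMultiplier c T := by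
  have hs : Summable fun n => (c n : ℂ) • (harmSpace d n).starProjection := by
    refine Summable.of_norm_bounded hc fun n => ?_
    rw [norm_smul, Complex.norm_real, Real.norm_of_nonneg (hc0 n)]
    refine mul_le_of_le_one_right (hc0 n) ?_
    exact Submodule.starProjection_norm_le _
  refine ⟨∑' n, (c n : ℂ) • (harmSpace d n).starProjection, fun m P hP => ?_⟩
  have h1 := (ContinuousLinearMap.apply ℂ (L2S d) (toL2 (evS P))).hasSum hs.hasSum
  rw [ContinuousLinearMap.apply_apply] at h1
  rw [← h1.tsum_eq, tsum_eq_single m]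
  · simp only [ContinuousLinearMap.apply_apply, smul_apply, starProjection_harm hP, if_true]
  · intro n hn
    simp only [ContinuousLinearMap.apply_apply, smul_apply, starProjection_harm hP, if_neg hn,
      smul_zero]

lemma evS_add (P Q : MvPolynomial (Fin d) ℂ) : evS (P + Q) = evS P + evS Q := by ext θ; simp

lemma IsHarm.add {n : ℕ} {P Q : MvPolynomial (Fin d) ℂ} (hP : IsHarm n P) (hQ : IsHarm n Q) :
    IsHarm n (P + Q) := ⟨hP.1.add hQ.1, by rw [map_add, hP.2, hQ.2, add_zero]⟩

lemma isHarm_zero (n : ℕ) : IsHarm n (0 : MvPolynomial (Fin d) ℂ) :=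
  ⟨MvPolynomial.isHomogeneous_zero _ _ _, map_zero _⟩

lemma exists_harm_decomposition [NeZero d] (P : MvPolynomial (Fin d) ℂ) :
    ∃ (s : Finset ℕ) (h : ℕ → MvPolynomial (Fin d) ℂ), (∀ n, IsHarm n (h n)) ∧
      evS P = ∑ n ∈ s, evS (h n) := by
  refine evS_induction (p := fun g => ∃ (s : Finset ℕ) (h : ℕ → MvPolynomial (Fin d) ℂ),
    (∀ n, IsHarm n (h n)) ∧ g = ∑ n ∈ s, evS (h n)) ?_ ?_ P
  · rintro _ _ ⟨s, h, hh, rfl⟩ ⟨s', h', hh', rfl⟩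
    refine ⟨s ∪ s', fun n => (if n ∈ s then h n else 0) + (if n ∈ s' then h' n else 0), ?_, ?_⟩
    · intro n
      refine IsHarm.add ?_ ?_
      · split_ifs; exacts [hh n, isHarm_zero n]
      · split_ifs; exacts [hh' n, isHarm_zero n]
    · have z : evS (0 : MvPolynomial (Fin d) ℂ) = 0 := by ext θ; simp
      simp only [evS_add, Finset.sum_add_distrib, apply_ite evS, z, Finset.sum_ite_mem]
      rw [Finset.inter_eq_right.2 Finset.subset_union_left,
        Finset.inter_eq_right.2 Finset.subset_union_right]
  · intro n P hP
    refine ⟨{n}, fun m => if m = n then P else 0, fun m => ?_, by simp⟩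
    change IsHarm m (if m = n then P else 0)
    split_ifs with h
    · rw [h]; exact hP
    · exact isHarm_zero m

lemma norm_sum_sq_of_pairwise_inner_eq_zero {H : Type*} [NormedAddCommGroup H]
    [InnerProductSpace ℂ H] (s : Finset ℕ) (f : ℕ → H)
    (h : ∀ i j, i ≠ j → inner ℂ (f i) (f j) = 0) :
    ‖∑ i ∈ s, f i‖ ^ 2 = ∑ i ∈ s, ‖f i‖ ^ 2 := by
  induction s using Finset.induction_on with
  | empty => simp
  | insert a s ha ih =>
    rw [Finset.sum_insert ha, Finset.sum_insert ha, ← ih, sq, sq, sq]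
    refine norm_add_sq_eq_norm_sq_add_norm_sq_of_inner_eq_zero (𝕜 := ℂ) _ _ ?_
    rw [inner_sum]
    exact Finset.sum_eq_zero fun i hi => h a i fun e => ha (e ▸ hi)

/-- A polynomial on the sphere is a finite sum of mutually orthogonal harmonics, so Pythagoras
bounds `‖T f‖` term by term; density does the rest. -/
lemma IsMultiplier.norm_le [NeZero d] {c : ℕ → ℝ} {T : L2S d →L[ℂ] L2S d} (hT : IsMultiplier c T)
    {M : ℝ} (hM : ∀ n, |c n| ≤ M) : ‖T‖ ≤ M := by
  have hM0 : 0 ≤ M := (abs_nonneg _).trans (hM 0)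
  refine ContinuousLinearMap.opNorm_le_bound _ hM0 ?_
  refine L2_induction (isClosed_le (by fun_prop) (by fun_prop)) fun P => ?_
  obtain ⟨s, h, hh, e⟩ := exists_harm_decomposition P
  rw [e, map_sum, map_sum]
  have h1 : ∀ n, T (toL2 (evS (h n))) = (c n : ℂ) • toL2 (evS (h n)) := fun n => hT n _ (hh n)
  have h2 := norm_sum_sq_of_pairwise_inner_eq_zero s (fun n => (toL2 (evS (h n)) : L2S d))
    fun i j hij => inner_harm_harm hij (hh i) (hh j)
  have h3 := norm_sum_sq_of_pairwise_inner_eq_zero s (fun n => T (toL2 (evS (h n))))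
    fun i j hij => by rw [h1, h1, inner_smul_left, inner_smul_right,
      inner_harm_harm hij (hh i) (hh j), mul_zero, mul_zero]
  rw [← abs_of_nonneg (norm_nonneg (∑ n ∈ s, T _)), ← abs_of_nonneg (mul_nonneg hM0 (norm_nonneg _)),
    ← sq_le_sq, mul_pow, h2, h3, Finset.mul_sum]
  refine Finset.sum_le_sum fun n _ => ?_
  rw [h1, norm_smul, mul_pow, Complex.norm_real, Real.norm_eq_abs]
  gcongr
  exact hM n

/-- The pairing as a continuous linear functional in the second variable. -/
noncomputable def pairCLM (f : L2S d) : L2S d →L[ℂ] ℂ := innerSL ℂ (star f)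

lemma pairCLM_apply (f g : L2S d) : pairCLM f g = pair f g := by
  rw [pair_eq_inner]; rfl

lemma pair_harm_harm [NeZero d] {n m : ℕ} (hnm : n ≠ m) {P Q : MvPolynomial (Fin d) ℂ}
    (hP : IsHarm n P) (hQ : IsHarm m Q) : pair (toL2 (evS P)) (toL2 (evS Q)) = 0 := by
  rw [pair_toL2]; exact integral_harm_mul_harm hnm hP hQ

/-- Harmonics of different degrees annihilate each other in the bilinear pairing, and in equal
degrees both sides carry the same factor. The general case follows by extending one argument at a
time. -/
lemma IsMultiplier.pair_symm [NeZero d] {c : ℕ → ℝ} {T : L2S d →L[ℂ] L2S d} (hT : IsMultiplier c T)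
    (f g : L2S d) : pair (T f) g = pair f (T g) := by
  have h1 : ∀ (n : ℕ) (P : MvPolynomial (Fin d) ℂ), IsHarm n P → ∀ g,
      pair (T (toL2 (evS P))) g = pair (toL2 (evS P)) (T g) := by
    intro n P hP g
    have : pairCLM (T (toL2 (evS P))) = (pairCLM (toL2 (evS P))).comp T := by
      refine L2_ext_harm fun m Q hQ => ?_
      rw [ContinuousLinearMap.comp_apply, pairCLM_apply, pairCLM_apply, hT n P hP, hT m Q hQ,
        pair_smul_left, pair_smul_right]
      by_cases h : n = m
      · rw [h]
      · rw [pair_harm_harm h hP hQ, mul_zero, mul_zero]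
    have := DFunLike.congr_fun this g
    simpa [pairCLM_apply] using this
  have : (pairCLM g).comp T = pairCLM (T g) := by
    refine L2_ext_harm fun n P hP => ?_
    rw [ContinuousLinearMap.comp_apply, pairCLM_apply, pairCLM_apply, pair_comm, h1 n P hP, pair_comm]
  have := DFunLike.congr_fun this f
  rw [ContinuousLinearMap.comp_apply, pairCLM_apply, pairCLM_apply] at this
  rw [pair_comm, this, pair_comm]

lemma toL2_injective [NeZero d] : Function.Injective (toL2 : C(S d, ℂ) → L2S d) :=
  ContinuousMap.toLp_injective _

/-- The polynomial `(x₀ + i x₁)^n` equals `1` at the first basis vector. Thus every `c n` really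
occurs as an eigenvalue. -/
lemma toL2_harm_ne_zero (hd : 2 ≤ d) [NeZero d] (n : ℕ) :
    ∃ P : MvPolynomial (Fin d) ℂ, IsHarm n P ∧ toL2 (evS P) ≠ 0 := by
  refine ⟨_, isHarm_pow_add_I_mul hd n, fun h => ?_⟩
  have h1 := toL2_injective (h.trans (map_zero toL2).symm)
  have h2 := DFunLike.congr_fun h1 ⟨EuclideanSpace.single (⟨0, by omega⟩ : Fin d) 1, by simp⟩
  simp at h2

/-- If `T f = μ f`, applying the projection onto degree `n` gives `(μ - c_n) Π_n f = 0`. When `μ`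
avoids all `c_n`, the function `f` is orthogonal to every spherical harmonic and hence zero. -/
lemma IsMultiplier.hasEigenvalue_iff (hd : 2 ≤ d) [NeZero d] {c : ℕ → ℝ} {T : L2S d →L[ℂ] L2S d}
    (hT : IsMultiplier c T) (μ : ℂ) :
    Module.End.HasEigenvalue (T : L2S d →ₗ[ℂ] L2S d) μ ↔ ∃ n, μ = (c n : ℂ) := by
  constructor
  · intro h
    obtain ⟨f, hf⟩ := h.exists_hasEigenvector
    have hTf : T f = μ • f := hf.apply_eq_smul
    by_contra! hμ
    have h1 : ∀ n, f ∈ (harmSpace d n)ᗮ := by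
      intro n
      have h2 : (harmSpace d n).starProjection.comp T = (c n : ℂ) • (harmSpace d n).starProjection := by
        refine L2_ext_harm fun m P hP => ?_
        rw [ContinuousLinearMap.comp_apply, hT m P hP, map_smul]
        simp only [smul_apply, starProjection_harm hP]
        split_ifs with h
        · rw [h]
        · simp
      have h3 := DFunLike.congr_fun h2 f
      rw [ContinuousLinearMap.comp_apply, hTf, map_smul, smul_apply,
        ← sub_eq_zero, ← sub_smul, smul_eq_zero] at h3
      have h4 := h3.resolve_left (sub_ne_zero.2 (hμ n))
      rw [← Submodule.ker_starProjection]
      exact h4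
    have h5 : innerSL ℂ f = 0 := by
      refine L2_ext_harm fun n P hP => ?_
      rw [innerSL_apply_apply, ← inner_conj_symm, mem_harmSpace_orthogonal_iff.1 (h1 n) P hP]
      simp
    have h6 := DFunLike.congr_fun h5 f
    rw [innerSL_apply_apply] at h6
    exact hf.2 (inner_self_eq_zero.1 h6)
  · rintro ⟨n, rfl⟩
    obtain ⟨P, hP, hne⟩ := toL2_harm_ne_zero hd n
    exact Module.End.hasEigenvalue_of_hasEigenvector
      (Module.End.hasEigenvector_iff.2 ⟨Module.End.mem_eigenspace_iff.2 (hT n P hP), hne⟩)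

lemma IsMultiplier.norm_ge (hd : 2 ≤ d) [NeZero d] {c : ℕ → ℝ} {T : L2S d →L[ℂ] L2S d}
    (hT : IsMultiplier c T) (n : ℕ) : |c n| ≤ ‖T‖ := by
  obtain ⟨P, hP, hne⟩ := toL2_harm_ne_zero hd n
  have := T.le_opNorm (toL2 (evS P))
  rw [hT n P hP, norm_smul, Complex.norm_real, Real.norm_eq_abs] at this
  exact le_of_mul_le_mul_right this (norm_pos_iff.2 hne)

end Multipliers

end DepthEIT

namespace DepthEIT

variable {d : ℕ}

/-! ### Radial factors and separated solutions in an annulus -/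

section Radial

open Set Metric

lemma hasFDerivAt_norm_sub (a : E d) {x : E d} (hx : x ≠ a) :
    HasFDerivAt (fun y : E d => ‖y - a‖) (‖x - a‖⁻¹ • innerSL ℝ (x - a)) x := by
  have hpos : 0 < ‖x - a‖ := norm_pos_iff.2 (sub_ne_zero.2 hx)
  have h1 : HasFDerivAt (fun y : E d => ‖y - a‖ ^ 2) (2 • innerSL ℝ (x - a)) x := by
    have := (hasStrictFDerivAt_norm_sq (x - a)).hasFDerivAt.comp x ((hasFDerivAt_id x).sub_const a)
    exact this
  have h2 := h1.sqrt (by positivity)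
  simp only [Real.sqrt_sq (norm_nonneg _)] at h2
  refine h2.congr_fderiv ?_
  ext y
  simp
  field_simp

lemma pd_radial {F : ℝ → ℝ} {F' : ℝ} (a : E d) {x : E d} (hx : x ≠ a) (hF : HasDerivAt F F' ‖x - a‖)
    (i : Fin d) : pd i (fun y => ((F ‖y - a‖ : ℝ) : ℂ)) x = ((F' / ‖x - a‖ : ℝ) : ℂ) * (x i - a i) := by
  have h := Complex.ofRealCLM.hasFDerivAt.comp x (hF.comp_hasFDerivAt x (hasFDerivAt_norm_sub a hx))
  rw [show (fun y : E d => ((F ‖y - a‖ : ℝ) : ℂ)) = Complex.ofRealCLM ∘ F ∘ fun y => ‖y - a‖ from rfl,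
    pd_eq_of_hasFDerivAt h]
  simp [EuclideanSpace.inner_single_right]
  ring

lemma contDiffAt_norm_sub (a : E d) {x : E d} (hx : x ≠ a) :
    ContDiffAt ℝ ∞ (fun y : E d => ‖y - a‖) x :=
  ContDiffAt.norm ℝ (contDiffAt_id.sub contDiffAt_const) (sub_ne_zero.2 hx)

lemma contDiffAt_radial {F : ℝ → ℝ} (a : E d) {x : E d} (hx : x ≠ a) (hF : ContDiffAt ℝ ∞ F ‖x - a‖) :
    ContDiffAt ℝ ∞ (fun y : E d => ((F ‖y - a‖ : ℝ) : ℂ)) x :=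
  Complex.ofRealCLM.contDiff.contDiffAt.comp x (hF.comp x (contDiffAt_norm_sub a hx))

lemma norm_sub_sq_eq_sum (x a : E d) :
    ((‖x - a‖ ^ 2 : ℝ) : ℂ) = ∑ i, ((x i : ℂ) - a i) * (x i - a i) := by
  rw [EuclideanSpace.norm_sq_eq]
  push_cast
  refine Finset.sum_congr rfl fun i _ => ?_
  rw [← Complex.ofReal_pow, Real.norm_eq_abs, sq_abs]
  push_cast [PiLp.sub_apply]
  ring

/-- The Laplacian of the product of a radial function with an arbitrary function. -/
lemma lap_radial_mul {w s t H : E d → ℂ} (a : E d) {U : Set (E d)} (hU : IsOpen U)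
    (hw : ∀ y ∈ U, DifferentiableAt ℝ w y) (hs : ∀ y ∈ U, DifferentiableAt ℝ s y)
    (hwp : ∀ y ∈ U, ∀ i, pd i w y = s y * (y i - a i))
    (hsp : ∀ y ∈ U, ∀ i, pd i s y = t y * (y i - a i))
    (hH : ∀ y ∈ U, DifferentiableAt ℝ H y) (hHp : ∀ y ∈ U, ∀ i, DifferentiableAt ℝ (pd i H) y)
    {x : E d} (hx : x ∈ U) :
    lap (fun y => w y * H y) x = (d * s x + ((‖x - a‖ ^ 2 : ℝ) : ℂ) * t x) * H x +
      2 * s x * ∑ i, ((x i : ℂ) - a i) * pd i H x + w x * lap H x := by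
  have key : ∀ i, pd i (pd i fun y => w y * H y) x =
      (s x + t x * ((x i - a i) * (x i - a i))) * H x + 2 * s x * ((x i - a i) * pd i H x) +
        w x * pd i (pd i H) x := by
    intro i
    have hc : ∀ y, DifferentiableAt ℝ (fun y : E d => (y i : ℂ) - a i) y := fun y =>
      ((contDiff_coord i).differentiable (by simp) y).sub (differentiableAt_const _)
    have e1 : (pd i fun y => w y * H y) =ᶠ[𝓝 x]
        fun y => (s y * (y i - a i)) * H y + w y * pd i H y := by
      filter_upwards [hU.mem_nhds hx] with y hy
      rw [pd_mul i (hw y hy) (hH y hy), hwp y hy]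
    have d1 : DifferentiableAt ℝ (fun y => s y * ((y i : ℂ) - a i)) x := (hs x hx).mul (hc x)
    have d2 : DifferentiableAt ℝ (fun y => s y * ((y i : ℂ) - a i) * H y) x := d1.mul (hH x hx)
    have d3 : DifferentiableAt ℝ (fun y => w y * pd i H y) x := (hw x hx).mul (hHp x hx i)
    rw [pd_congr i e1, pd_add i d2 d3, pd_mul i d1 (hH x hx), pd_mul i (hs x hx) (hc x),
      pd_mul i (hw x hx) (hHp x hx i), hwp x hx, hsp x hx,
      pd_sub i ((contDiff_coord i).differentiable (by simp) x) (differentiableAt_const _), pd_coord,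
      pd_const, if_pos rfl]
    ring
  rw [lap, lap, norm_sub_sq_eq_sum]
  simp only [key, Finset.sum_add_distrib, ← Finset.mul_sum, ← Finset.sum_mul, Finset.sum_const,
    Finset.card_univ, Fintype.card_fin, nsmul_eq_mul]
  ring

lemma sum_sub_mul_pd (H : E d → ℂ) (x a : E d) :
    ∑ i, ((x i : ℂ) - a i) * pd i H x = fderiv ℝ H x (x - a) := by
  rw [← sum_pd_mul_coord]
  simp

lemma pd_zpow_norm_sub (c : ℝ) (k : ℤ) {a y : E d} (hy : y ≠ a) (i : Fin d) :
    pd i (fun y => ((c * ‖y - a‖ ^ k : ℝ) : ℂ)) y =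
      ((c * k * ‖y - a‖ ^ (k - 2) : ℝ) : ℂ) * (y i - a i) := by
  have hpos : ‖y - a‖ ≠ 0 := norm_ne_zero_iff.2 (sub_ne_zero.2 hy)
  rw [pd_radial a hy ((hasDerivAt_zpow k _ (Or.inl hpos)).const_mul c) i]
  congr 2
  rw [show k - 2 = k - 1 - 1 by ring, zpow_sub_one₀ hpos (k - 1)]
  ring

lemma contDiffAt_zpow_norm_sub (c : ℝ) (k : ℤ) {a y : E d} (hy : y ≠ a) :
    ContDiffAt ℝ ∞ (fun y => ((c * ‖y - a‖ ^ k : ℝ) : ℂ)) y := by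
  have hpos : ‖y - a‖ ≠ 0 := norm_ne_zero_iff.2 (sub_ne_zero.2 hy)
  refine contDiffAt_radial (F := fun t => c * t ^ k) a hy (contDiffAt_const.mul ?_)
  rcases k with k | k
  · simp only [Int.ofNat_eq_natCast, zpow_natCast]; fun_prop
  · simp only [zpow_negSucc]
    exact (contDiffAt_id.pow _).inv (pow_ne_zero _ hpos)

/-- The radial factor of the solution in an annulus with harmonic boundary values. -/
lemma exists_annulus_radial_factor (hd : 2 ≤ d) {r : ℝ} (hr0 : 0 < r) (hr1 : r < 1) (n : ℕ) :
    ∃ g s t : E d → ℂ, (∀ y, y ≠ 0 → ContDiffAt ℝ ∞ g y) ∧ (∀ y, y ≠ 0 → ContDiffAt ℝ ∞ s y) ∧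
      (∀ y, y ≠ 0 → ∀ i, pd i g y = s y * (y i - (0 : E d) i)) ∧
      (∀ y, y ≠ 0 → ∀ i, pd i s y = t y * (y i - (0 : E d) i)) ∧
      (∀ y, y ≠ 0 → (d + 2 * n) * s y + ((‖y‖ ^ 2 : ℝ) : ℂ) * t y = 0) ∧
      (∀ y, ‖y‖ = r → g y = 0) ∧ (∀ y, ‖y‖ = 1 → g y = 1 ∧ s y = eig d r n) := by
  -- The relation `(d + 2n)s + |y|²t = 0` says that `gP` is harmonic for `P` harmonic and
  -- homogeneous of degree `n`: the cross term contributes `2ns`. The boundary conditions give `gP`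
  -- the values `0` on `|y| = r` and `P` on `|y| = 1`, and `s` is there the radial derivative of
  -- `g`.
  have hlog : Real.log r ≠ 0 := (Real.log_neg hr0 hr1).ne
  have hpow := fun (c : ℝ) (k : ℤ) (y : E d) (hy : y ≠ 0) => pd_zpow_norm_sub c k hy
  have hpowc := fun (c : ℝ) (k : ℤ) (y : E d) (hy : y ≠ 0) => contDiffAt_zpow_norm_sub c k hy
  by_cases h : d = 2 ∧ n = 0
  · obtain ⟨rfl, rfl⟩ := h
    -- In the plane the radial mode is logarithmic.
    refine ⟨fun y => ((1 - Real.log ‖y - 0‖ / Real.log r : ℝ) : ℂ),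
      fun y => ((-1 / Real.log r * ‖y - 0‖ ^ (-2 : ℤ) : ℝ) : ℂ),
      fun y => ((-1 / Real.log r * (-2 : ℤ) * ‖y - 0‖ ^ ((-2 : ℤ) - 2) : ℝ) : ℂ), ?_, hpowc _ _, ?_,
      hpow _ _, ?_, ?_, ?_⟩
    · intro y hy
      have hpos : ‖y - 0‖ ≠ 0 := by rwa [sub_zero, norm_ne_zero_iff]
      exact contDiffAt_radial (F := fun t => 1 - Real.log t / Real.log r) 0 hy
        (contDiffAt_const.sub ((Real.contDiffAt_log.2 hpos).div_const _))
    · intro y hy i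
      have hpos : ‖y - 0‖ ≠ 0 := by rwa [sub_zero, norm_ne_zero_iff]
      rw [pd_radial (F := fun t => 1 - Real.log t / Real.log r) 0 hy
        (((Real.hasDerivAt_log hpos).div_const (Real.log r)).const_sub 1)]
      congr 2
      rw [zpow_neg, zpow_ofNat]
      field_simp
    · intro y hy
      have hpos : ‖y‖ ≠ 0 := by rwa [norm_ne_zero_iff]
      beta_reduce
      rw [sub_zero, ← Complex.ofReal_natCast, ← Complex.ofReal_natCast]
      norm_cast
      rw [show (Int.negSucc 1 - 2 : ℤ) = -((4 : ℕ) : ℤ) by rfl,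
        show (Int.negSucc 1 : ℤ) = -((2 : ℕ) : ℤ) by rfl, zpow_neg, zpow_neg, zpow_natCast, zpow_natCast]
      push_cast
      field_simp
      ring
    · intro y hy
      simp [hy, hlog]
    · intro y hy
      simp [hy, eig]
  · set m : ℕ := 2 * n + d - 2 with hm
    have hm0 : m ≠ 0 := by omega
    have hmd : (m : ℝ) + 2 = 2 * n + d := by
      have : m + 2 = 2 * n + d := by omega
      exact_mod_cast this
    have hrm : 0 < 1 - r ^ m := one_sub_pow_pos hr0 hr1 hm0
    -- The radial solutions are `1` and `|y|^(-m)`, and the boundary conditions select `g = (1 - r^m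
    -- |y|^(-m))/(1 - r^m)`.
    set c : ℝ := -(r ^ m / (1 - r ^ m)) with hc
    refine ⟨fun y => (((1 - r ^ m)⁻¹ : ℝ) : ℂ) + ((c * ‖y - 0‖ ^ (-m : ℤ) : ℝ) : ℂ),
      fun y => ((c * (-m : ℤ) * ‖y - 0‖ ^ (-m - 2 : ℤ) : ℝ) : ℂ),
      fun y => ((c * (-m : ℤ) * (-m - 2 : ℤ) * ‖y - 0‖ ^ ((-m - 2 : ℤ) - 2) : ℝ) : ℂ), ?_,
      hpowc _ _, ?_, hpow _ _, ?_, ?_, ?_⟩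
    · exact fun y hy => contDiffAt_const.add (hpowc _ _ y hy)
    · intro y hy i
      rw [pd_add i (differentiableAt_const _) ((hpowc _ _ y hy).differentiableAt (by simp)), pd_const,
        zero_add, hpow _ _ y hy]
    · intro y hy
      have hpos : ‖y‖ ≠ 0 := by rwa [norm_ne_zero_iff]
      have e : ‖y‖ ^ 2 * ‖y‖ ^ ((-m - 2 : ℤ) - 2) = ‖y‖ ^ (-m - 2 : ℤ) := by
        rw [zpow_sub₀ hpos (-m - 2 : ℤ), zpow_ofNat]; field_simp
      beta_reduce
      rw [sub_zero, ← Complex.ofReal_natCast, ← Complex.ofReal_natCast]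
      have : ((d : ℝ) + 2 * n) * (c * (-m : ℤ) * ‖y‖ ^ (-m - 2 : ℤ)) +
          ‖y‖ ^ 2 * (c * (-m : ℤ) * (-m - 2 : ℤ) * ‖y‖ ^ ((-m - 2 : ℤ) - 2)) = 0 := by
        rw [mul_left_comm (‖y‖ ^ 2), e]
        push_cast
        linear_combination (-(c * (-m : ℝ) * ‖y‖ ^ (-m - 2 : ℤ))) * hmd
      exact_mod_cast this
    · intro y hy
      beta_reduce
      rw [sub_zero, hy, ← Complex.ofReal_add, zpow_neg, zpow_natCast, hc]
      have : r ^ m ≠ 0 := (pow_pos hr0 m).ne'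
      norm_cast
      field_simp
      ring
    · intro y hy
      beta_reduce
      rw [sub_zero, hy, one_zpow, one_zpow, ← Complex.ofReal_add, eig_eq_eigAux hd hr0, ← hm, eigAux,
        if_neg hm0, hc]
      constructor
      · norm_cast
        field_simp
        ring
      · congr 1
        push_cast
        field_simp

end Radial

/-! ### The concentric inclusion -/

section ConcentricData

open Set Metric

/-- Only the boundary values of `p` matter. This is needed because a polynomial agrees with its sum
of harmonic components on the sphere only. -/
lemma SmoothDNData.congr {C : E d} {R : ℝ} {T : L2S d →L[ℂ] L2S d} {p q : E d → ℂ}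
    (h : SmoothDNData C R T p) (hq : ContDiff ℝ ∞ q) (e : ∀ θ : S d, q θ = p θ) :
    SmoothDNData C R T q := by
  obtain ⟨hp, Φ, H, g, sΦ, sH, lH, lΦ, zΦ, hθ, hT⟩ := h
  refine ⟨hq, Φ, H, g, sΦ, sH, lH, lΦ, zΦ, fun θ => ?_, ?_⟩
  · rw [e]; exact hθ θ
  · rw [← hT]
    congr 2
    ext θ
    exact e θ

lemma fderiv_add_apply {f g : E d → ℂ} (hf : ContDiff ℝ ∞ f) (hg : ContDiff ℝ ∞ g) (x y : E d) :
    fderiv ℝ (fun x => f x + g x) x y = fderiv ℝ f x y + fderiv ℝ g x y := by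
  rw [((hf.differentiable (by simp) x).hasFDerivAt.fun_add
    (hg.differentiable (by simp) x).hasFDerivAt).fderiv]
  rfl

lemma SmoothDNData.add {C : E d} {R : ℝ} {T : L2S d →L[ℂ] L2S d} {p q : E d → ℂ}
    (hp : SmoothDNData C R T p) (hq : SmoothDNData C R T q) :
    SmoothDNData C R T (fun x => p x + q x) := by
  obtain ⟨hp, Φ, H, g, sΦ, sH, lH, lΦ, zΦ, hθ, hT⟩ := hp
  obtain ⟨hq, Φ', H', g', sΦ', sH', lH', lΦ', zΦ', hθ', hT'⟩ := hq
  refine ⟨hp.add hq, fun x => Φ x + Φ' x, fun x => H x + H' x, g + g', sΦ.add sΦ', sH.add sH',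
    fun x hx => ?_, fun x hx => ?_, fun x hx => ?_, fun θ => ⟨?_, ?_, ?_⟩, ?_⟩
  · rw [lap_add sH sH', lH x hx, lH' x hx, add_zero]
  · rw [lap_add sΦ sΦ', lΦ x hx, lΦ' x hx, add_zero]
  · beta_reduce
    rw [zΦ x hx, zΦ' x hx, add_zero]
  · beta_reduce
    rw [(hθ θ).1, (hθ' θ).1]
  · beta_reduce
    rw [(hθ θ).2.1, (hθ' θ).2.1]
  · rw [fderiv_add_apply sΦ sΦ', fderiv_add_apply sH sH', ContinuousMap.add_apply, (hθ θ).2.2,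
      (hθ' θ).2.2]
    ring
  · have : resS (fun x => p x + q x) (hp.add hq) = resS p hp + resS q hq := by ext θ; rfl
    rw [this, map_add, map_add, hT, hT', map_add]

/-- The solution with inclusion is `gP`, with `g` the radial factor, and the free solution is `P`.
Since `g = 1` on the unit sphere, their normal derivatives differ by the radial derivative of `g`
times `P`, which is `λ_n P`. -/
lemma smoothDNData_harm (hd : 2 ≤ d) {r : ℝ} (hr0 : 0 < r) (hr1 : r < 1) {T : L2S d →L[ℂ] L2S d}
    (hT : IsMultiplier (eig d r) T) {n : ℕ} {P : MvPolynomial (Fin d) ℂ} (hP : IsHarm n P) :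
    SmoothDNData 0 r T (ev P) := by
  obtain ⟨g, s, t, hg, hs, hgp, hsp, hst, hgr, hg1⟩ := exists_annulus_radial_factor hd hr0 hr1 n
  -- The singularity of `g` at the origin is cut off strictly inside the inclusion, so `Φ` is smooth
  -- everywhere and equals `gP` in a neighbourhood of the closed annulus.
  let B : ContDiffBump (0 : E d) := ⟨r / 3, r / 2, by positivity, by linarith⟩
  set Φ : E d → ℂ := fun x => (1 - (B x : ℂ)) * (g x * ev P x) with hΦ
  have hne : ∀ x : E d, r / 2 < ‖x‖ → x ≠ 0 := fun x hx h => by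
    rw [h, norm_zero] at hx; linarith
  have eΦ : ∀ x : E d, r / 2 < ‖x‖ → Φ =ᶠ[𝓝 x] fun y => g y * ev P y := by
    intro x hx
    filter_upwards [(isOpen_lt continuous_const continuous_norm).mem_nhds hx] with y hy
    have : B y = 0 := B.zero_of_le_dist (by rw [dist_zero_right]; exact le_of_lt hy)
    simp [hΦ, this]
  have sΦ : ContDiff ℝ ∞ Φ := by
    rw [contDiff_iff_contDiffAt]
    intro x
    by_cases hx : x = 0
    · have : Φ =ᶠ[𝓝 x] fun _ => 0 := by
        rw [hx]
        filter_upwards [B.eventuallyEq_one] with y hy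
        simp [hΦ, hy]
      exact contDiffAt_const.congr_of_eventuallyEq this
    · exact (contDiffAt_const.sub (Complex.ofRealCLM.contDiff.comp B.contDiff).contDiffAt).mul
        ((hg x hx).mul (contDiff_ev P).contDiffAt)
  have hD : ∀ θ : S d, fderiv ℝ Φ θ θ = (eig d r n : ℂ) * ev P θ + fderiv ℝ (ev P) θ θ := by
    intro θ
    have h1 : ‖(θ : E d)‖ = 1 := by simp
    have h0 : (θ : E d) ≠ 0 := hne θ (by rw [h1]; linarith)
    rw [fderiv_apply_congr (eΦ θ (by rw [h1]; linarith)), ← sum_pd_mul_coord, ← sum_pd_mul_coord]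
    have h2 := norm_sub_sq_eq_sum (θ : E d) 0
    have hk : ∀ i, ((θ : E d) i : ℂ) * pd i (fun y => g y * ev P y) θ =
        s θ * ev P θ * (((θ : E d) i - (0 : E d) i) * ((θ : E d) i - (0 : E d) i)) +
          g θ * ((θ : E d) i * pd i (ev P) θ) := by
      intro i
      rw [pd_mul i ((hg _ h0).differentiableAt (by simp)) (differentiableAt_ev P _), hgp _ h0]
      simp
      ring
    simp only [hk, Finset.sum_add_distrib, ← Finset.mul_sum]
    rw [← h2, sub_zero, h1, (hg1 _ h1).1, (hg1 _ h1).2]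
    simp
  refine ⟨contDiff_ev P, Φ, ev P, (eig d r n : ℂ) • evS P, sΦ, contDiff_ev P,
    fun x _ => hP.lap_eq_zero x, fun x hx => ?_, fun x hx => ?_, fun θ => ⟨?_, rfl, ?_⟩, ?_⟩
  · have hx' : r < ‖x‖ := by
      have := hx.2
      rwa [mem_closedBall_zero_iff, not_le] at this
    have h0 : x ≠ 0 := hne x (by linarith)
    rw [lap_congr (eΦ x (by linarith)), lap_radial_mul (0 : E d) (isOpen_compl_singleton (x := (0 : E d)))
      (fun y hy => (hg y hy).differentiableAt (by simp))
      (fun y hy => (hs y hy).differentiableAt (by simp)) hgp hsp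
      (fun y _ => differentiableAt_ev P y)
      (fun y _ i => (contDiff_pd_infty (contDiff_ev P) i).differentiable (by simp) y) h0,
      hP.lap_eq_zero, sum_sub_mul_pd, sub_zero, fderiv_ev_self hP.1]
    linear_combination (ev P x) * hst x h0
  · rw [mem_sphere_zero_iff_norm] at hx
    rw [(eΦ x (by rw [hx]; linarith)).self_of_nhds]
    beta_reduce
    rw [hgr x hx, zero_mul]
  · have h1 : ‖(θ : E d)‖ = 1 := by simp
    rw [(eΦ θ (by rw [h1]; linarith)).self_of_nhds]
    beta_reduce
    rw [(hg1 _ h1).1, one_mul]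
  · rw [hD]; simp
  · rw [map_smul, ← hT n P hP]; rfl

lemma smoothDNData_ev [NeZero d] (hd : 2 ≤ d) {r : ℝ} (hr0 : 0 < r) (hr1 : r < 1)
    {T : L2S d →L[ℂ] L2S d} (hT : IsMultiplier (eig d r) T) (P : MvPolynomial (Fin d) ℂ) :
    SmoothDNData 0 r T (ev P) := by
  obtain ⟨p, hp, e⟩ := sphere_harmonic_induction
    (p := fun f => ∃ p, SmoothDNData 0 r T p ∧ ∀ θ : S d, p θ = f θ)
    (fun f g ⟨p, hp, e⟩ ⟨q, hq, e'⟩ => ⟨_, hp.add hq, fun θ => by rw [e, e']⟩)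
    (fun n P hP => ⟨_, smoothDNData_harm hd hr0 hr1 hT hP, fun _ => rfl⟩) P
  exact hp.congr (contDiff_ev P) fun θ => (e θ).symm

/-- The difference of the Dirichlet-to-Neumann maps for a concentric inclusion. -/
theorem extendsDNDiff_zero_iff [NeZero d] (hd : 2 ≤ d) {r : ℝ} (hr0 : 0 < r) (hr1 : r < 1)
    {T : L2S d →L[ℂ] L2S d} (hT : IsMultiplier (eig d r) T) (T' : L2S d →L[ℂ] L2S d) :
    ExtendsDNDiff (0 : E d) r T' ↔ T' = T := by
  refine extendsDNDiff_iff hr0 (by simpa using hr1) hT.pair_symm (fun φ hφ => ?_) T'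
  obtain ⟨P, hP⟩ := exists_polynomial_C1Tendsto hφ
  exact ⟨_, fun k => smoothDNData_ev hd hr0 hr1 hT (P k), hP⟩

end ConcentricData

end DepthEIT

namespace DepthEIT

variable {d : ℕ}

/-! ### The inversion and the Kelvin transform -/

section Kelvin

open EuclideanGeometry

/-- The Jacobian matrix of the inversion in the sphere with center `b` and radius `ρ`. -/
noncomputable def invJac (b : E d) (ρ : ℝ) (i j : Fin d) (x : E d) : ℂ :=
  (if i = j then 1 else 0) * ((ρ ^ 2 * ‖x - b‖ ^ (-2 : ℤ) : ℝ) : ℂ) -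
    ((2 * ρ ^ 2 * ‖x - b‖ ^ (-4 : ℤ) : ℝ) : ℂ) * ((x i - b i) * (x j - b j))

lemma fderiv_inversion_apply {b x : E d} (ρ : ℝ) (hx : x ≠ b) (v : E d) :
    fderiv ℝ (inversion b ρ) x v =
      (ρ / ‖x - b‖) ^ 2 • (v - (2 * (inner ℝ (x - b) v / ‖x - b‖ ^ 2)) • (x - b)) := by
  rw [(hasFDerivAt_inversion hx).fderiv, ← dist_eq_norm]
  simp only [smul_apply, ContinuousLinearEquiv.coe_coe,
    LinearIsometryEquiv.coe_toContinuousLinearEquiv, Submodule.reflection_orthogonal_apply,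
    Submodule.reflection_singleton_apply]
  congr 1
  rw [neg_sub, dist_eq_norm, two_smul, mul_smul, two_smul]
  simp

lemma contDiffAt_inversion {b x : E d} (ρ : ℝ) (hx : x ≠ b) : ContDiffAt ℝ ∞ (inversion b ρ) x :=
  contDiffAt_const.inversion contDiffAt_const contDiffAt_id hx

lemma fderiv_comp_inversion {b x : E d} (ρ : ℝ) (hx : x ≠ b) {u : E d → ℂ} (hu : ContDiff ℝ ∞ u)
    (v : E d) : fderiv ℝ (fun y => u (inversion b ρ y)) x v =
      fderiv ℝ u (inversion b ρ x) (fderiv ℝ (inversion b ρ) x v) := by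
  have := (hu.differentiable (by simp) (inversion b ρ x)).hasFDerivAt.comp x
    ((contDiffAt_inversion ρ hx).differentiableAt (by simp)).hasFDerivAt
  rw [show (fun y => u (inversion b ρ y)) = u ∘ inversion b ρ from rfl, this.fderiv]
  rfl

lemma pd_comp_inversion {b x : E d} (ρ : ℝ) (hx : x ≠ b) {u : E d → ℂ} (hu : ContDiff ℝ ∞ u)
    (i : Fin d) : pd i (fun y => u (inversion b ρ y)) x =
      ∑ j, pd j u (inversion b ρ x) * invJac b ρ i j x := by
  have hpos : ‖x - b‖ ≠ 0 := norm_ne_zero_iff.2 (sub_ne_zero.2 hx)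
  rw [pd, fderiv_comp_inversion ρ hx hu, ← sum_pd_mul_coord, fderiv_inversion_apply ρ hx]
  refine Finset.sum_congr rfl fun j _ => ?_
  rw [mul_comm, invJac]
  congr 1
  simp only [PiLp.smul_apply, PiLp.sub_apply, PiLp.single_apply, smul_eq_mul,
    EuclideanSpace.inner_single_right, zpow_neg]
  have h2 : ‖x - b‖ ^ (2 : ℤ) = ‖x - b‖ ^ 2 := zpow_ofNat _ 2
  have h4 : ‖x - b‖ ^ (4 : ℤ) = ‖x - b‖ ^ 4 := zpow_ofNat _ 4
  rw [h2, h4]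
  have hpos' : ((‖x - b‖ : ℝ) : ℂ) ≠ 0 := by exact_mod_cast hpos
  by_cases hij : i = j
  · subst hij
    simp
    field_simp
  · simp [hij, Ne.symm hij]
    field_simp

lemma contDiffAt_invJac {b x : E d} (ρ : ℝ) (hx : x ≠ b) (i j : Fin d) :
    ContDiffAt ℝ ∞ (invJac b ρ i j) x :=
  (contDiffAt_const.mul (contDiffAt_zpow_norm_sub _ _ hx)).sub
    ((contDiffAt_zpow_norm_sub _ _ hx).mul (((contDiff_coord i).contDiffAt.sub contDiffAt_const).mul
      ((contDiff_coord j).contDiffAt.sub contDiffAt_const)))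

/-- The derivative of the inversion is `(ρ/|x-b|)²` times a reflection; this is conformality in
coordinates. -/
lemma sum_invJac_mul_invJac {b x : E d} (ρ : ℝ) (hx : x ≠ b) (j k : Fin d) :
    ∑ i, invJac b ρ i j x * invJac b ρ i k x =
      (if j = k then 1 else 0) * (((ρ / ‖x - b‖) ^ 4 : ℝ) : ℂ) := by
  have hpos : ‖x - b‖ ≠ 0 := norm_ne_zero_iff.2 (sub_ne_zero.2 hx)
  have hpos' : ((‖x - b‖ : ℝ) : ℂ) ≠ 0 := by exact_mod_cast hpos
  have h2 : ‖x - b‖ ^ (2 : ℤ) = ‖x - b‖ ^ 2 := zpow_ofNat _ 2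
  have h4 : ‖x - b‖ ^ (4 : ℤ) = ‖x - b‖ ^ 4 := zpow_ofNat _ 4
  set p : ℂ := ((ρ ^ 2 * ‖x - b‖ ^ (-2 : ℤ) : ℝ) : ℂ) with hp
  set q : ℂ := ((2 * ρ ^ 2 * ‖x - b‖ ^ (-4 : ℤ) : ℝ) : ℂ) with hq
  set y : Fin d → ℂ := fun i => (x i : ℂ) - b i with hy
  have e : ∀ i, invJac b ρ i j x * invJac b ρ i k x =
      (if i = j then (if j = k then 1 else 0) * p ^ 2 - p * q * (y j * y k) else 0) -
      (if i = k then p * q * (y j * y k) else 0) + q ^ 2 * (y j * y k) * (y i * y i) := by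
    intro i
    simp only [invJac, ← hp, ← hq]
    by_cases h1 : i = j
    · subst h1
      by_cases h3 : i = k
      · subst h3; simp [hy]; ring
      · simp [h3, hy]; ring
    · by_cases h3 : i = k
      · subst h3; simp [h1, hy]; ring
      · simp [h1, h3, hy]; ring
  simp only [e, Finset.sum_add_distrib, Finset.sum_sub_distrib, Finset.sum_ite_eq',
    Finset.mem_univ, if_true, ← Finset.mul_sum]
  rw [show ∑ i, y i * y i = ((‖x - b‖ ^ 2 : ℝ) : ℂ) from (norm_sub_sq_eq_sum x b).symm, hp, hq,
    zpow_neg, zpow_neg, h2, h4]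
  push_cast
  field_simp
  ring

/-- The reflection reverses the radial direction `x - b`. -/
lemma sum_sub_mul_invJac {b x : E d} (ρ : ℝ) (hx : x ≠ b) (j : Fin d) :
    ∑ i, ((x i : ℂ) - b i) * invJac b ρ i j x = -(((ρ / ‖x - b‖) ^ 2 : ℝ) : ℂ) * (x j - b j) := by
  have hpos : ‖x - b‖ ≠ 0 := norm_ne_zero_iff.2 (sub_ne_zero.2 hx)
  have hpos' : ((‖x - b‖ : ℝ) : ℂ) ≠ 0 := by exact_mod_cast hpos
  have h2 : ‖x - b‖ ^ (2 : ℤ) = ‖x - b‖ ^ 2 := zpow_ofNat _ 2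
  have h4 : ‖x - b‖ ^ (4 : ℤ) = ‖x - b‖ ^ 4 := zpow_ofNat _ 4
  set p : ℂ := ((ρ ^ 2 * ‖x - b‖ ^ (-2 : ℤ) : ℝ) : ℂ) with hp
  set q : ℂ := ((2 * ρ ^ 2 * ‖x - b‖ ^ (-4 : ℤ) : ℝ) : ℂ) with hq
  have e : ∀ i, ((x i : ℂ) - b i) * invJac b ρ i j x =
      (if i = j then p * (x j - b j) else 0) - q * (x j - b j) * ((x i - b i) * (x i - b i)) := by
    intro i
    simp only [invJac, ← hp, ← hq]
    by_cases h1 : i = j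
    · subst h1; simp; ring
    · simp [h1]; ring
  simp only [e, Finset.sum_sub_distrib, Finset.sum_ite_eq', Finset.mem_univ, if_true,
    ← Finset.mul_sum]
  rw [← norm_sub_sq_eq_sum, hp, hq, zpow_neg, zpow_neg, h2, h4]
  push_cast
  field_simp
  ring

/-- This is the Laplacian of the `j`-th component of the inversion. It vanishes for `d = 2`, where
the inversion is anti-holomorphic; for `d > 2` it is the defect that the Kelvin weight compensates.
-/
lemma sum_pd_invJac {b x : E d} (ρ : ℝ) (hx : x ≠ b) (j : Fin d) :
    ∑ i, pd i (invJac b ρ i j) x =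
      (4 - 2 * d) * ((ρ ^ 2 / ‖x - b‖ ^ 4 : ℝ) : ℂ) * (x j - b j) := by
  have hpos : ‖x - b‖ ≠ 0 := norm_ne_zero_iff.2 (sub_ne_zero.2 hx)
  have hpos' : ((‖x - b‖ : ℝ) : ℂ) ≠ 0 := by exact_mod_cast hpos
  have h4 : ‖x - b‖ ^ (4 : ℤ) = ‖x - b‖ ^ 4 := zpow_ofNat _ 4
  have h6 : ‖x - b‖ ^ (6 : ℤ) = ‖x - b‖ ^ 6 := zpow_ofNat _ 6
  set q : ℂ := ((2 * ρ ^ 2 * ‖x - b‖ ^ (-4 : ℤ) : ℝ) : ℂ) with hq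
  set p' : ℂ := ((ρ ^ 2 * (-2 : ℤ) * ‖x - b‖ ^ ((-2 : ℤ) - 2) : ℝ) : ℂ) with hp'
  set q' : ℂ := ((2 * ρ ^ 2 * (-4 : ℤ) * ‖x - b‖ ^ ((-4 : ℤ) - 2) : ℝ) : ℂ) with hq'
  have hc : ∀ k, DifferentiableAt ℝ (fun y : E d => (y k : ℂ) - b k) x := fun k =>
    ((contDiff_coord k).differentiable (by simp) x).sub (differentiableAt_const _)
  have hcp : ∀ i k, pd i (fun y : E d => (y k : ℂ) - b k) x = if i = k then 1 else 0 := fun i k => by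
    rw [pd_sub i ((contDiff_coord k).differentiable (by simp) x) (differentiableAt_const _), pd_coord,
      pd_const, sub_zero]
  have dz : ∀ (c : ℝ) (k : ℤ), DifferentiableAt ℝ (fun y : E d => ((c * ‖y - b‖ ^ k : ℝ) : ℂ)) x :=
    fun c k => (contDiffAt_zpow_norm_sub c k hx).differentiableAt (by simp)
  have e : ∀ i, pd i (invJac b ρ i j) x = (if i = j then (p' - q) * (x j - b j) else 0) -
      q * (x j - b j) - q' * (x j - b j) * ((x i - b i) * (x i - b i)) := by
    intro i
    have d1 : DifferentiableAt ℝ (fun y : E d => ((y i : ℂ) - b i) * (y j - b j)) x :=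
      (hc i).mul (hc j)
    have d2 : DifferentiableAt ℝ (fun y : E d => ((2 * ρ ^ 2 * ‖y - b‖ ^ (-4 : ℤ) : ℝ) : ℂ) *
      (((y i : ℂ) - b i) * (y j - b j))) x := (dz _ _).mul d1
    have d3 : DifferentiableAt ℝ (fun y : E d =>
      (if i = j then 1 else 0) * ((ρ ^ 2 * ‖y - b‖ ^ (-2 : ℤ) : ℝ) : ℂ)) x :=
      (differentiableAt_const _).mul (dz _ _)
    rw [show invJac b ρ i j = fun y => (if i = j then 1 else 0) *
      ((ρ ^ 2 * ‖y - b‖ ^ (-2 : ℤ) : ℝ) : ℂ) - ((2 * ρ ^ 2 * ‖y - b‖ ^ (-4 : ℤ) : ℝ) : ℂ) *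
        ((y i - b i) * (y j - b j)) from rfl, pd_sub i d3 d2, pd_const_mul i _ (dz _ _),
      pd_mul i (dz _ _) d1, pd_mul i (hc i) (hc j), hcp, hcp, pd_zpow_norm_sub _ _ hx,
      pd_zpow_norm_sub _ _ hx, ← hq, ← hp', ← hq', if_pos rfl]
    by_cases h1 : i = j
    · subst h1; simp; ring
    · simp [h1]; ring
  simp only [e, Finset.sum_sub_distrib, Finset.sum_ite_eq', Finset.mem_univ, if_true,
    ← Finset.mul_sum, Finset.sum_const, Finset.card_univ, Fintype.card_fin, nsmul_eq_mul]
  rw [← norm_sub_sq_eq_sum, hp', hq, hq', show (-2 : ℤ) - 2 = -4 by rfl,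
    show (-4 : ℤ) - 2 = -6 by rfl, zpow_neg, zpow_neg, h6, h4]
  push_cast
  field_simp
  ring

/-- In the chain rule, conformality collapses the second-order terms to a multiple of `Δu`, and the
Laplacians of the components give the first-order term. -/
lemma lap_comp_inversion {b x : E d} (ρ : ℝ) (hx : x ≠ b) {u : E d → ℂ} (hu : ContDiff ℝ ∞ u) :
    lap (fun y => u (inversion b ρ y)) x =
      (((ρ / ‖x - b‖) ^ 4 : ℝ) : ℂ) * lap u (inversion b ρ x) +
        (4 - 2 * d) * ((ρ ^ 2 / ‖x - b‖ ^ 4 : ℝ) : ℂ) *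
          ∑ j, pd j u (inversion b ρ x) * (x j - b j) := by
  have h1 : ∀ i, pd i (pd i fun y => u (inversion b ρ y)) x =
      ∑ j, ((∑ k, pd k (pd j u) (inversion b ρ x) * invJac b ρ i k x) * invJac b ρ i j x +
        pd j u (inversion b ρ x) * pd i (invJac b ρ i j) x) := by
    intro i
    have e1 : (pd i fun y => u (inversion b ρ y)) =ᶠ[𝓝 x]
        fun y => ∑ j, pd j u (inversion b ρ y) * invJac b ρ i j y := by
      filter_upwards [isOpen_compl_singleton.mem_nhds hx] with y hy
      exact pd_comp_inversion ρ hy hu i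
    have dj : ∀ j, DifferentiableAt ℝ (fun y => pd j u (inversion b ρ y)) x := fun j =>
      (((contDiff_pd_infty hu j).contDiffAt).comp x (contDiffAt_inversion ρ hx)).differentiableAt
        (by simp)
    have dJ : ∀ j, DifferentiableAt ℝ (invJac b ρ i j) x := fun j =>
      (contDiffAt_invJac ρ hx i j).differentiableAt (by simp)
    have dm : ∀ j, DifferentiableAt ℝ (fun y => pd j u (inversion b ρ y) * invJac b ρ i j y) x :=
      fun j => (dj j).mul (dJ j)
    rw [pd_congr i e1, pd_sum Finset.univ i fun j _ => dm j]
    refine Finset.sum_congr rfl fun j _ => ?_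
    rw [pd_mul i (dj j) (dJ j), pd_comp_inversion ρ hx (contDiff_pd_infty hu j)]
  rw [lap]
  simp only [h1, Finset.sum_add_distrib, Finset.sum_mul]
  congr 1
  · rw [lap, Finset.sum_comm, Finset.mul_sum]
    refine Finset.sum_congr rfl fun j _ => ?_
    rw [Finset.sum_comm]
    have : ∀ k, ∑ i, pd k (pd j u) (inversion b ρ x) * invJac b ρ i k x * invJac b ρ i j x =
        if k = j then pd k (pd j u) (inversion b ρ x) * (((ρ / ‖x - b‖) ^ 4 : ℝ) : ℂ) else 0 := by
      intro k
      simp only [mul_assoc, ← Finset.mul_sum]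
      rw [sum_invJac_mul_invJac ρ hx]
      split_ifs <;> simp
    simp only [this, Finset.sum_ite_eq', Finset.mem_univ, if_true]
    ring
  · rw [Finset.sum_comm, Finset.mul_sum]
    refine Finset.sum_congr rfl fun j _ => ?_
    rw [← Finset.mul_sum, sum_pd_invJac ρ hx]
    ring

/-- The Kelvin transform preserves harmonicity. -/
theorem lap_kelvin (hd : 2 ≤ d) {b x : E d} (ρ : ℝ) (hx : x ≠ b) {u : E d → ℂ}
    (hu : ContDiff ℝ ∞ u) :
    lap (fun y => (((ρ / ‖y - b‖) ^ (d - 2) : ℝ) : ℂ) * u (inversion b ρ y)) x =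
      (((ρ / ‖x - b‖) ^ (d + 2) : ℝ) : ℂ) * lap u (inversion b ρ x) := by
  obtain ⟨m, rfl⟩ : ∃ m, d = m + 2 := ⟨d - 2, by omega⟩
  have hpos : ‖x - b‖ ≠ 0 := norm_ne_zero_iff.2 (sub_ne_zero.2 hx)
  have hpos' : ((‖x - b‖ : ℝ) : ℂ) ≠ 0 := by exact_mod_cast hpos
  have hcd : ∀ y, y ≠ b → ContDiffAt ℝ ∞ (fun y => u (inversion b ρ y)) y := fun y hy =>
    hu.contDiffAt.comp y (contDiffAt_inversion ρ hy)
  have e : (fun y => (((ρ / ‖y - b‖) ^ (m + 2 - 2) : ℝ) : ℂ) * u (inversion b ρ y)) =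
      fun y => ((ρ ^ m * ‖y - b‖ ^ (-m : ℤ) : ℝ) : ℂ) * u (inversion b ρ y) := by
    ext y
    rw [Nat.add_sub_cancel, div_pow, zpow_neg, zpow_natCast, div_eq_mul_inv]
  rw [e, lap_radial_mul b (isOpen_compl_singleton (x := b))
    (fun y hy => (contDiffAt_zpow_norm_sub _ _ hy).differentiableAt (by simp))
    (fun y hy => (contDiffAt_zpow_norm_sub _ _ hy).differentiableAt (by simp))
    (fun y hy => pd_zpow_norm_sub _ _ hy) (fun y hy => pd_zpow_norm_sub _ _ hy)
    (fun y hy => (hcd y hy).differentiableAt (by simp)) ?_ hx, lap_comp_inversion ρ hx hu]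
  -- The weight is a multiple of `|x-b|^(2-d)` and hence harmonic. Its cross term with `u ∘ I` is
  -- the opposite of the first-order term in `lap_comp_inversion`, so only `Δu` survives.
  · have h1 : ∑ i, ((x i : ℂ) - b i) * pd i (fun y => u (inversion b ρ y)) x =
        -(((ρ / ‖x - b‖) ^ 2 : ℝ) : ℂ) * ∑ j, pd j u (inversion b ρ x) * (x j - b j) := by
      simp only [pd_comp_inversion ρ hx hu, Finset.mul_sum]
      rw [Finset.sum_comm]
      refine Finset.sum_congr rfl fun j _ => ?_
      simp only [mul_left_comm _ (pd j u (inversion b ρ x)), ← Finset.mul_sum]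
      rw [sum_sub_mul_invJac ρ hx]
    have e1 : ‖x - b‖ ^ (-m - 2 : ℤ) = (‖x - b‖ ^ (m + 2))⁻¹ := by
      rw [← zpow_natCast, ← zpow_neg]; congr 1; push_cast; ring
    have e2 : ‖x - b‖ ^ (-m - 2 - 2 : ℤ) = (‖x - b‖ ^ (m + 4))⁻¹ := by
      rw [← zpow_natCast, ← zpow_neg]; congr 1; push_cast; ring
    rw [h1, e1, e2, zpow_neg, zpow_natCast, div_pow _ _ (m + 2 + 2)]
    push_cast
    field_simp
    ring
  · intro y hy i
    have e1 : (pd i fun y => u (inversion b ρ y)) =ᶠ[𝓝 y]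
        fun y => ∑ j, pd j u (inversion b ρ y) * invJac b ρ i j y := by
      filter_upwards [isOpen_compl_singleton.mem_nhds hy] with z hz
      exact pd_comp_inversion ρ hz hu i
    refine DifferentiableAt.congr_of_eventuallyEq (DifferentiableAt.fun_sum fun j _ => ?_) e1
    exact ((((contDiff_pd_infty hu j).contDiffAt).comp y (contDiffAt_inversion ρ hy)).mul
      (contDiffAt_invJac ρ hy i j)).differentiableAt (by simp)

end Kelvin

end DepthEIT

namespace DepthEIT

variable {d : ℕ} {b : E d}

/-! ### The inversion preserving the unit ball -/

section BallInversion

open EuclideanGeometry Set Metric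

/-- The inversion with center `b` that preserves the unit ball. -/
noncomputable def ballInv (b : E d) : E d → E d := inversion b √(‖b‖ ^ 2 - 1)

/-- The conformal factor of the inversion is the square of this function. -/
noncomputable def kel (b x : E d) : ℝ := √(‖b‖ ^ 2 - 1) / ‖x - b‖

lemma sq_sqrt_norm_sq_sub_one (hb : 1 < ‖b‖) : √(‖b‖ ^ 2 - 1) ^ 2 = ‖b‖ ^ 2 - 1 :=
  Real.sq_sqrt (by nlinarith)

lemma sqrt_norm_sq_sub_one_pos (hb : 1 < ‖b‖) : 0 < √(‖b‖ ^ 2 - 1) := Real.sqrt_pos.2 (by nlinarith)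

lemma ne_of_norm_lt {x : E d} (hx : ‖x‖ < ‖b‖) : x ≠ b := fun h => by rw [h] at hx; exact hx.false

lemma norm_sub_pos {x : E d} (hx : x ≠ b) : 0 < ‖x - b‖ := norm_pos_iff.2 (sub_ne_zero.2 hx)

lemma kel_pos (hb : 1 < ‖b‖) {x : E d} (hx : x ≠ b) : 0 < kel b x :=
  div_pos (sqrt_norm_sq_sub_one_pos hb) (norm_sub_pos hx)

lemma kel_sq_mul (hb : 1 < ‖b‖) {x : E d} (hx : x ≠ b) :
    kel b x ^ 2 * ‖x - b‖ ^ 2 = ‖b‖ ^ 2 - 1 := by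
  rw [← mul_pow, kel, div_mul_cancel₀ _ (norm_sub_pos hx).ne', sq_sqrt_norm_sq_sub_one hb]

lemma ballInv_eq (b x : E d) : ballInv b x = kel b x ^ 2 • (x - b) + b := by
  rw [ballInv, inversion, dist_eq_norm, kel]; rfl

lemma ballInv_ballInv (hb : 1 < ‖b‖) (x : E d) : ballInv b (ballInv b x) = x :=
  inversion_inversion b (sqrt_norm_sq_sub_one_pos hb).ne' x

lemma kel_ballInv (hb : 1 < ‖b‖) {x : E d} (hx : x ≠ b) : kel b (ballInv b x) = (kel b x)⁻¹ := by
  have h1 := norm_sub_pos hx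
  have h2 := sqrt_norm_sq_sub_one_pos hb
  rw [kel, ballInv, ← dist_eq_norm, dist_inversion_center, dist_eq_norm, kel]
  field_simp

/-- The radius `√(|b|²-1)` makes the inversion sphere orthogonal to the unit sphere. The identity
shows at once that the ball and its boundary are preserved. -/
lemma one_sub_norm_ballInv_sq (hb : 1 < ‖b‖) {x : E d} (hx : x ≠ b) :
    1 - ‖ballInv b x‖ ^ 2 = kel b x ^ 2 * (1 - ‖x‖ ^ 2) := by
  have h1 := kel_sq_mul hb hx
  have h2 : ‖x‖ ^ 2 = ‖x - b‖ ^ 2 + 2 * inner ℝ (x - b) b + ‖b‖ ^ 2 := by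
    rw [← norm_add_sq_real, sub_add_cancel]
  rw [ballInv_eq, norm_add_sq_real, norm_smul, inner_smul_left, h2, Real.norm_of_nonneg (sq_nonneg _)]
  simp only [conj_trivial]
  linear_combination (1 - kel b x ^ 2) * h1

lemma ballInv_mem_ball (hb : 1 < ‖b‖) {x : E d} (hx : x ∈ ball (0 : E d) 1) :
    ballInv b x ∈ ball (0 : E d) 1 := by
  rw [mem_ball_zero_iff] at *
  have hne := ne_of_norm_lt (hx.trans hb)
  have h := one_sub_norm_ballInv_sq hb hne
  have h2 : 0 < kel b x ^ 2 * (1 - ‖x‖ ^ 2) :=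
    mul_pos (pow_pos (kel_pos hb hne) 2) (by nlinarith [norm_nonneg x])
  nlinarith [norm_nonneg (ballInv b x)]

lemma ballInv_mem_sphere (hb : 1 < ‖b‖) {x : E d} (hx : x ∈ sphere (0 : E d) 1) :
    ballInv b x ∈ sphere (0 : E d) 1 := by
  rw [mem_sphere_zero_iff_norm] at *
  have h := one_sub_norm_ballInv_sq hb (ne_of_norm_lt (hx.trans_lt hb))
  rw [hx] at h
  nlinarith [norm_nonneg (ballInv b x)]

lemma ballInv_mem_closedBall (hb : 1 < ‖b‖) {x : E d} (hx : x ∈ closedBall (0 : E d) 1) :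
    ballInv b x ∈ closedBall (0 : E d) 1 := by
  rw [← ball_union_sphere] at *
  exact hx.imp (ballInv_mem_ball hb) (ballInv_mem_sphere hb)

/-- A conformal map preserving the ball sends outward normals to outward normals, scaled by the
conformal factor `k²`. Hence Neumann data pick up two more powers of `k` than Dirichlet data. -/
lemma fderiv_ballInv_self (hb : 1 < ‖b‖) {x : E d} (hx : ‖x‖ = 1) :
    fderiv ℝ (ballInv b) x x = kel b x ^ 2 • ballInv b x := by
  have hne := ne_of_norm_lt (hx.trans_lt hb)
  have hpos := norm_sub_pos hne
  have h1 := kel_sq_mul hb hne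
  rw [ballInv, fderiv_inversion_apply _ hne, ← ballInv, ← kel]
  congr 1
  have h2 : 2 * inner ℝ (x - b) x = ‖x - b‖ ^ 2 + 1 - ‖b‖ ^ 2 := by
    have := norm_sub_sq_real (x - b) x
    rw [sub_sub_cancel_left, norm_neg, hx] at this
    linarith
  have h3 : 2 * (inner ℝ (x - b) x / ‖x - b‖ ^ 2) = 1 - kel b x ^ 2 := by
    field_simp
    linarith
  rw [h3, ballInv_eq, sub_smul, one_smul]
  abel

lemma contDiffAt_ballInv {x : E d} (hx : x ≠ b) : ContDiffAt ℝ ∞ (ballInv b) x :=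
  contDiffAt_inversion _ hx

lemma contDiffAt_kel_pow {x : E d} (hx : x ≠ b) (m : ℕ) :
    ContDiffAt ℝ ∞ (fun y => ((kel b y ^ m : ℝ) : ℂ)) x := by
  refine contDiffAt_radial (F := fun t => (√(‖b‖ ^ 2 - 1) / t) ^ m) b hx ?_
  exact (contDiffAt_const.div contDiffAt_id (norm_sub_pos hx).ne').pow m

/-- The Kelvin transform, cut off near the center of the inversion. -/
noncomputable def kelvin (hb : 1 < ‖b‖) (u : E d → ℂ) (x : E d) : ℂ :=
  (1 - ((⟨(‖b‖ - 1) / 3, (‖b‖ - 1) / 2, by linarith, by linarith⟩ : ContDiffBump b) x : ℂ)) *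
    (((kel b x ^ (d - 2) : ℝ) : ℂ) * u (ballInv b x))

/-- The threshold is halfway between the unit sphere and `b`, and the bump around `b` has outer
radius `(|b|-1)/2`. The cutoff is therefore invisible on an open neighbourhood of the closed unit
ball, and derivatives up to the boundary are unaffected. -/
lemma kelvin_of_norm_lt (hb : 1 < ‖b‖) (u : E d → ℂ) {x : E d} (hx : ‖x‖ < (1 + ‖b‖) / 2) :
    kelvin hb u x = ((kel b x ^ (d - 2) : ℝ) : ℂ) * u (ballInv b x) := by
  have h : (‖b‖ - 1) / 2 ≤ dist x b := by
    have := norm_sub_norm_le b x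
    rw [dist_comm, dist_eq_norm]
    linarith
  rw [kelvin, ContDiffBump.zero_of_le_dist _ h]
  simp

lemma isOpen_norm_lt (b : E d) : IsOpen {x : E d | ‖x‖ < (1 + ‖b‖) / 2} :=
  isOpen_lt continuous_norm continuous_const

lemma norm_lt_of_mem_closedBall (hb : 1 < ‖b‖) {x : E d} (hx : x ∈ closedBall (0 : E d) 1) :
    ‖x‖ < (1 + ‖b‖) / 2 := by
  rw [mem_closedBall_zero_iff] at hx
  linarith

lemma ne_of_mem_closedBall (hb : 1 < ‖b‖) {x : E d} (hx : x ∈ closedBall (0 : E d) 1) : x ≠ b :=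
  ne_of_norm_lt ((mem_closedBall_zero_iff.1 hx).trans_lt hb)

lemma kelvin_eventuallyEq (hb : 1 < ‖b‖) (u : E d → ℂ) {x : E d} (hx : x ∈ closedBall (0 : E d) 1) :
    kelvin hb u =ᶠ[𝓝 x] fun y => ((kel b y ^ (d - 2) : ℝ) : ℂ) * u (ballInv b y) := by
  filter_upwards [(isOpen_norm_lt b).mem_nhds (norm_lt_of_mem_closedBall hb hx)] with y hy
  exact kelvin_of_norm_lt hb u hy

lemma kelvin_apply (hb : 1 < ‖b‖) (u : E d → ℂ) {x : E d} (hx : x ∈ closedBall (0 : E d) 1) :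
    kelvin hb u x = ((kel b x ^ (d - 2) : ℝ) : ℂ) * u (ballInv b x) :=
  kelvin_of_norm_lt hb u (norm_lt_of_mem_closedBall hb hx)

lemma contDiff_kelvin (hb : 1 < ‖b‖) {u : E d → ℂ} (hu : ContDiff ℝ ∞ u) :
    ContDiff ℝ ∞ (kelvin hb u) := by
  rw [contDiff_iff_contDiffAt]
  intro x
  by_cases hx : x = b
  · have : kelvin hb u =ᶠ[𝓝 x] fun _ => 0 := by
      rw [hx]
      filter_upwards [ContDiffBump.eventuallyEq_one
        (⟨(‖b‖ - 1) / 3, (‖b‖ - 1) / 2, by linarith, by linarith⟩ : ContDiffBump b)] with y hy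
      simp [kelvin, hy]
    exact contDiffAt_const.congr_of_eventuallyEq this
  · exact (contDiffAt_const.sub
      (Complex.ofRealCLM.contDiff.comp (ContDiffBump.contDiff _)).contDiffAt).mul
      ((contDiffAt_kel_pow hx _).mul (hu.contDiffAt.comp x (contDiffAt_ballInv hx)))

lemma lap_kelvin_eq (hd : 2 ≤ d) (hb : 1 < ‖b‖) {u : E d → ℂ} (hu : ContDiff ℝ ∞ u) {x : E d}
    (hx : x ∈ closedBall (0 : E d) 1) :
    lap (kelvin hb u) x = ((kel b x ^ (d + 2) : ℝ) : ℂ) * lap u (ballInv b x) := by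
  rw [lap_congr (kelvin_eventuallyEq hb u hx)]
  exact lap_kelvin hd _ (ne_of_mem_closedBall hb hx) hu

lemma kelvin_kelvin_eventuallyEq (hb : 1 < ‖b‖) (u : E d → ℂ) {x : E d}
    (hx : x ∈ closedBall (0 : E d) 1) : kelvin hb (kelvin hb u) =ᶠ[𝓝 x] u := by
  have hne := ne_of_mem_closedBall hb hx
  filter_upwards [(isOpen_norm_lt b).mem_nhds (norm_lt_of_mem_closedBall hb hx),
    (contDiffAt_ballInv hne).continuousAt ((isOpen_norm_lt b).mem_nhds
      (norm_lt_of_mem_closedBall hb (ballInv_mem_closedBall hb hx))),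
    isOpen_compl_singleton.mem_nhds hne] with y h1 h2 h3
  have h4 : ((kel b y : ℝ) : ℂ) ≠ 0 := by exact_mod_cast (kel_pos hb h3).ne'
  rw [kelvin_of_norm_lt hb _ h1, kelvin_of_norm_lt hb _ h2, ballInv_ballInv hb, kel_ballInv hb h3]
  push_cast
  rw [← mul_assoc, ← mul_pow, mul_inv_cancel₀ h4, one_pow, one_mul]

lemma pd_kelvin (hb : 1 < ‖b‖) {u : E d → ℂ} (hu : ContDiff ℝ ∞ u) {x : E d}
    (hx : x ∈ closedBall (0 : E d) 1) (i : Fin d) :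
    pd i (kelvin hb u) x = pd i (fun y => ((kel b y ^ (d - 2) : ℝ) : ℂ)) x * u (ballInv b x) +
      ((kel b x ^ (d - 2) : ℝ) : ℂ) *
        ∑ j, pd j u (ballInv b x) * invJac b √(‖b‖ ^ 2 - 1) i j x := by
  have hne := ne_of_mem_closedBall hb hx
  have dc : DifferentiableAt ℝ (fun y => u (ballInv b y)) x :=
    (hu.contDiffAt.comp x (contDiffAt_ballInv hne)).differentiableAt (by simp)
  rw [pd_congr i (kelvin_eventuallyEq hb u hx),
    pd_mul i ((contDiffAt_kel_pow hne _).differentiableAt (by simp)) dc]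
  congr 2
  exact pd_comp_inversion _ hne hu i

/-- The derivative of the weight multiplies only the value of `u`, so it cancels between two
functions with equal Dirichlet data. In the other term the exponents add up to `(d-2) + 2 = d`. -/
lemma fderiv_kelvin_self (hd : 2 ≤ d) (hb : 1 < ‖b‖) {u : E d → ℂ} (hu : ContDiff ℝ ∞ u) (θ : S d) :
    fderiv ℝ (kelvin hb u) θ θ =
      fderiv ℝ (fun y => ((kel b y ^ (d - 2) : ℝ) : ℂ)) θ θ * u (ballInv b θ) +
      ((kel b θ ^ d : ℝ) : ℂ) * fderiv ℝ u (ballInv b θ) (ballInv b θ) := by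
  have hne := ne_of_mem_closedBall hb (sphere_mem_closedBall θ)
  have h1 : fderiv ℝ (fun y => u (ballInv b y)) θ θ =
      ((kel b θ ^ 2 : ℝ) : ℂ) * fderiv ℝ u (ballInv b θ) (ballInv b θ) := by
    have := fderiv_comp_inversion √(‖b‖ ^ 2 - 1) hne hu θ
    rw [← ballInv, fderiv_ballInv_self hb (by simp), map_smul] at this
    rw [this, Complex.real_smul]
  have dc : DifferentiableAt ℝ (fun y => u (ballInv b y)) θ :=
    (hu.contDiffAt.comp _ (contDiffAt_ballInv hne)).differentiableAt (by simp)
  rw [fderiv_apply_congr (kelvin_eventuallyEq hb u (sphere_mem_closedBall θ)), fderiv_fun_mul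
    ((contDiffAt_kel_pow hne _).differentiableAt (by simp)) dc]
  simp only [add_apply, smul_apply, smul_eq_mul]
  rw [h1, ← mul_assoc, ← Complex.ofReal_mul, ← pow_add, Nat.sub_add_cancel hd]
  ring

/-- On the closed ball, the transform and its first derivatives are combinations of `u` and its
first derivatives at the inverted point, with coefficients bounded by compactness. -/
lemma C1Tendsto.kelvin (hb : 1 < ‖b‖) {p : ℕ → E d → ℂ} {φ : E d → ℂ} (h : C1Tendsto p φ)
    (hp : ∀ k, ContDiff ℝ ∞ (p k)) (hφ : ContDiff ℝ ∞ φ) :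
    C1Tendsto (fun k => kelvin hb (p k)) (kelvin hb φ) := by
  obtain ⟨h1, h2, M, hM⟩ := h
  set B := closedBall (0 : E d) 1 with hB
  have hJ : ∀ x ∈ B, ballInv b x ∈ B := fun x hx => ballInv_mem_closedBall hb hx
  set w : E d → ℂ := fun y => ((kel b y ^ (d - 2) : ℝ) : ℂ) with hw
  have bd : ∀ f : E d → ℂ, (∀ x ∈ B, ContinuousAt f x) → ∃ K, ∀ x ∈ B, ‖f x‖ ≤ K := fun f hf =>
    (isCompact_closedBall (0 : E d) 1).exists_bound_of_continuousOn fun x hx =>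
      (hf x hx).continuousWithinAt
  obtain ⟨K, hK⟩ := bd w fun x hx =>
    (contDiffAt_kel_pow (ne_of_mem_closedBall hb hx) _).continuousAt
  have hK' := fun i => bd (pd i w) fun x hx => by
    have := ((contDiffAt_kel_pow (ne_of_mem_closedBall hb hx) (d - 2)).fderiv_right
      (m := 0) (by simp)).continuousAt
    exact this.clm_apply continuousAt_const
  choose K' hK' using hK'
  have hL := fun i j => bd (invJac b √(‖b‖ ^ 2 - 1) i j) fun x hx =>
    (contDiffAt_invJac _ (ne_of_mem_closedBall hb hx) i j).continuousAt
  choose L hL using hL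
  have h0 : (0 : E d) ∈ B := by simp [hB]
  have hM0 : 0 ≤ M := (norm_nonneg _).trans (hM 0 0 h0).1
  have hK0 : 0 ≤ K := (norm_nonneg _).trans (hK 0 h0)
  have hK'0 : ∀ i, 0 ≤ K' i := fun i => (norm_nonneg _).trans (hK' i 0 h0)
  have hL0 : ∀ i j, 0 ≤ L i j := fun i j => (norm_nonneg _).trans (hL i j 0 h0)
  refine ⟨fun x hx => ?_, fun i x hx => ?_, K * M + ∑ i, (K' i * M + K * ∑ j, M * L i j),
    fun k x hx => ⟨?_, fun i => ?_⟩⟩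
  · simp only [kelvin_apply hb _ hx]
    exact (h1 _ (hJ x hx)).const_mul _
  · simp only [pd_kelvin hb (hp _) hx, pd_kelvin hb hφ hx]
    exact ((h1 _ (hJ x hx)).const_mul _).add
      ((tendsto_finsetSum _ fun j _ => (h2 j _ (hJ x hx)).mul_const _).const_mul _)
  · have : 0 ≤ ∑ i, (K' i * M + K * ∑ j, M * L i j) := Finset.sum_nonneg fun i _ =>
      add_nonneg (mul_nonneg (hK'0 i) hM0) (mul_nonneg hK0 (Finset.sum_nonneg fun j _ =>
        mul_nonneg hM0 (hL0 i j)))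
    beta_reduce
    rw [kelvin_apply hb _ hx, norm_mul]
    have : ‖w x‖ * ‖p k (ballInv b x)‖ ≤ K * M := by
      gcongr
      exacts [hK x hx, (hM k _ (hJ x hx)).1]
    linarith
  · have e : K' i * M + K * ∑ j, M * L i j ≤ ∑ i, (K' i * M + K * ∑ j, M * L i j) :=
      Finset.single_le_sum (f := fun i => K' i * M + K * ∑ j, M * L i j) (fun i _ =>
      add_nonneg (mul_nonneg (hK'0 i) hM0) (mul_nonneg hK0 (Finset.sum_nonneg fun j _ =>
        mul_nonneg hM0 (hL0 i j)))) (Finset.mem_univ i)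
    beta_reduce
    rw [pd_kelvin hb (hp _) hx]
    refine (norm_add_le _ _).trans ?_
    have e1 : ‖pd i w x * p k (ballInv b x)‖ ≤ K' i * M := by
      rw [norm_mul]
      gcongr
      exacts [hK'0 i, hK' i x hx, (hM k _ (hJ x hx)).1]
    have e2 : ‖w x * ∑ j, pd j (p k) (ballInv b x) * invJac b √(‖b‖ ^ 2 - 1) i j x‖ ≤
        K * ∑ j, M * L i j := by
      rw [norm_mul]
      gcongr
      · exact hK x hx
      · refine (norm_sum_le _ _).trans (Finset.sum_le_sum fun j _ => ?_)
        rw [norm_mul]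
        gcongr
        exacts [(hM k _ (hJ x hx)).2 j, hL i j x hx]
    nlinarith [mul_nonneg hK0 hM0]

/-- The data with explicit solutions for `B(C,R)` are Kelvin transforms of polynomials. They are
dense because the Kelvin transform is an involution: approximate the transform of `φ` by polynomials
and transform back. -/
lemma exists_polynomial_kelvin_C1Tendsto (hb : 1 < ‖b‖) {φ : E d → ℂ} (hφ : ContDiff ℝ ∞ φ) :
    ∃ P : ℕ → MvPolynomial (Fin d) ℂ, C1Tendsto (fun k => DepthEIT.kelvin hb (ev (P k))) φ := by
  obtain ⟨P, hP⟩ := exists_polynomial_C1Tendsto (contDiff_kelvin hb hφ)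
  obtain ⟨h1, h2, h3⟩ := hP.kelvin hb (fun k => contDiff_ev (P k)) (contDiff_kelvin hb hφ)
  refine ⟨P, fun x hx => ?_, fun i x hx => ?_, h3⟩
  · rw [← (kelvin_kelvin_eventuallyEq hb φ hx).self_of_nhds]
    exact h1 x hx
  · rw [← pd_congr i (kelvin_kelvin_eventuallyEq hb φ hx)]
    exact h2 i x hx

end BallInversion

end DepthEIT

namespace DepthEIT

variable {d : ℕ} {b : E d}

/-! ### Change of variables on the unit sphere -/

section SphereInversion

open Set Metric

/-- The inversion with center `b` as a map of the unit sphere. -/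
noncomputable def sphereInv (hb : 1 < ‖b‖) : C(S d, S d) where
  toFun θ := ⟨ballInv b θ, ballInv_mem_sphere hb θ.2⟩
  continuous_toFun := Continuous.subtype_mk (continuous_iff_continuousAt.2 fun θ =>
    ContinuousAt.comp (f := fun θ : S d => (θ : E d)) (contDiffAt_ballInv
      (ne_of_mem_closedBall hb (sphere_mem_closedBall θ))).continuousAt
      continuous_subtype_val.continuousAt) _

/-- The square root of the conformal factor on the unit sphere. -/
noncomputable def sphereKel (hb : 1 < ‖b‖) : C(S d, ℝ) where
  toFun θ := kel b θ
  continuous_toFun := continuous_const.div (continuous_subtype_val.sub continuous_const).norm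
    fun θ => (norm_sub_pos (ne_of_mem_closedBall hb (sphere_mem_closedBall θ))).ne'

lemma sphereKel_apply (hb : 1 < ‖b‖) (θ : S d) : sphereKel hb θ = kel b θ := rfl

lemma coe_sphereInv (hb : 1 < ‖b‖) (θ : S d) : (sphereInv hb θ : E d) = ballInv b θ := rfl

lemma sphereKel_pos (hb : 1 < ‖b‖) (θ : S d) : 0 < sphereKel hb θ :=
  kel_pos hb (ne_of_mem_closedBall hb (sphere_mem_closedBall θ))

lemma sphereInv_sphereInv (hb : 1 < ‖b‖) (θ : S d) : sphereInv hb (sphereInv hb θ) = θ :=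
  Subtype.ext (ballInv_ballInv hb θ)

lemma sphereKel_sphereInv (hb : 1 < ‖b‖) (θ : S d) :
    sphereKel hb (sphereInv hb θ) = (sphereKel hb θ)⁻¹ :=
  kel_ballInv hb (ne_of_mem_closedBall hb (sphere_mem_closedBall θ))

/-- Composition with the inversion, weighted by a power of the conformal factor. -/
noncomputable def wcomp (hb : 1 < ‖b‖) (m : ℕ) : C(S d, ℂ) →ₗ[ℂ] C(S d, ℂ) where
  toFun g := ⟨fun θ => ((sphereKel hb θ ^ m : ℝ) : ℂ) * g (sphereInv hb θ),
    (Complex.continuous_ofReal.comp ((sphereKel hb).continuous.pow m)).mul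
      (g.continuous.comp (sphereInv hb).continuous)⟩
  map_add' f g := by ext θ; simp [mul_add]
  map_smul' c g := by ext θ; simp; ring

lemma wcomp_apply (hb : 1 < ‖b‖) (m : ℕ) (g : C(S d, ℂ)) (θ : S d) :
    wcomp hb m g θ = ((sphereKel hb θ ^ m : ℝ) : ℂ) * g (sphereInv hb θ) := rfl

/-- The inversion is an involution that replaces `k` by `k⁻¹`, so the weights cancel for every
exponent. The exponents that matter are `d - 2` for Dirichlet data, `d` for Neumann data and `2d -
2` for the surface measure. -/
lemma wcomp_wcomp (hb : 1 < ‖b‖) (m : ℕ) (g : C(S d, ℂ)) : wcomp hb m (wcomp hb m g) = g := by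
  ext θ
  have h4 : ((sphereKel hb θ : ℝ) : ℂ) ≠ 0 := by exact_mod_cast (sphereKel_pos hb θ).ne'
  rw [wcomp_apply, wcomp_apply, sphereInv_sphereInv, sphereKel_sphereInv]
  push_cast
  rw [← mul_assoc, ← mul_pow, mul_inv_cancel₀ h4, one_pow, one_mul]

lemma continuous_wcomp (hb : 1 < ‖b‖) (m : ℕ) : Continuous (wcomp hb m) := by
  let c : C(S d, ℂ) := ⟨fun θ => ((sphereKel hb θ ^ m : ℝ) : ℂ),
    Complex.continuous_ofReal.comp ((sphereKel hb).continuous.pow m)⟩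
  have : (wcomp hb m : C(S d, ℂ) → C(S d, ℂ)) = fun g => c * g.comp (sphereInv hb) := rfl
  rw [this]
  exact continuous_const.mul (ContinuousMap.continuous_precomp _)

lemma continuous_integral_sphere : Continuous fun g : C(S d, ℂ) => ∫ θ, g θ ∂(surf d) := by
  have h : ∀ g : C(S d, ℂ), ∫ θ, g θ ∂(surf d) = pair (toL2 1) (toL2 g) := fun g => by
    rw [pair_toL2]; simp
  simp only [h]
  exact (continuous_pair_right _).comp toL2.continuous

lemma IsHarm.exists_evS_eq_smul_one {P : MvPolynomial (Fin d) ℂ} (hP : IsHarm 0 P) :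
    ∃ c : ℂ, evS P = c • 1 := by
  have h := hP.1
  rw [← MvPolynomial.totalDegree_zero_iff_isHomogeneous,
    MvPolynomial.totalDegree_eq_zero_iff_eq_C] at h
  rw [h]
  exact ⟨MvPolynomial.coeff 0 P, by ext θ; simp⟩

/-- Green's symmetry is applied to the Kelvin transforms of `1` and `P`. The derivatives of the
weight cancel, and what remains is `n` times the integral in question. -/
lemma integral_wcomp_harm [NeZero d] (hd : 2 ≤ d) (hb : 1 < ‖b‖) {n : ℕ} (hn : n ≠ 0)
    {P : MvPolynomial (Fin d) ℂ} (hP : IsHarm n P) :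
    ∫ θ, wcomp hb (d - 2 + d) (evS P) θ ∂(surf d) = 0 := by
  have c1 := contDiff_kelvin hb (contDiff_ev (1 : MvPolynomial (Fin d) ℂ))
  have c2 := contDiff_kelvin hb (contDiff_ev P)
  have h := integral_mul_fderiv_comm c1 c2
    (fun x hx => by rw [lap_kelvin_eq hd hb (contDiff_ev _) (ball_subset_closedBall hx),
      isHarm_one.lap_eq_zero, mul_zero])
    (fun x hx => by rw [lap_kelvin_eq hd hb (contDiff_ev _) (ball_subset_closedBall hx),
      hP.lap_eq_zero, mul_zero])
  have e : ∀ θ : S d, kelvin hb (ev 1) θ * fderiv ℝ (kelvin hb (ev P)) θ θ =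
      kelvin hb (ev P) θ * fderiv ℝ (kelvin hb (ev 1)) θ θ +
        n * wcomp hb (d - 2 + d) (evS P) θ := by
    intro θ
    rw [fderiv_kelvin_self hd hb (contDiff_ev P), fderiv_kelvin_self hd hb (contDiff_ev _),
      fderiv_ev_self hP.1, fderiv_ev_self isHarm_one.1, kelvin_apply hb _ (sphere_mem_closedBall θ),
      kelvin_apply hb _ (sphere_mem_closedBall θ), wcomp_apply, evS_apply, coe_sphereInv,
      sphereKel_apply, pow_add]
    simp
    ring
  simp only [e] at h
  rw [integral_add (integrable_sphere ?_) (integrable_sphere ?_), add_eq_left,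
    integral_const_mul, mul_eq_zero] at h
  · exact h.resolve_left (by exact_mod_cast hn)
  · exact (c2.continuous.comp continuous_subtype_val).mul (continuous_fderiv_self c1)
  · exact continuous_const.mul (wcomp hb _ _).continuous

/-- The change of variables formula for the inversion on the unit sphere. -/
theorem integral_wcomp [NeZero d] (hd : 2 ≤ d) (hb : 1 < ‖b‖) (g : C(S d, ℂ)) :
    ∫ θ, wcomp hb (d - 2 + d) g θ ∂(surf d) = ∫ θ, g θ ∂(surf d) := by
  set I : C(S d, ℂ) → ℂ := fun g => ∫ θ, g θ ∂(surf d) with hI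
  have hIc : Continuous I := continuous_integral_sphere
  have hIa : ∀ f g, I (f + g) = I f + I g := fun f g =>
    integral_add (integrable_sphere f.continuous) (integrable_sphere g.continuous)
  set U := wcomp hb (d - 2 + d) with hU
  -- Both integrals vanish on harmonics of positive degree, so by density `g ↦ I (U g)` is
  -- proportional to `I`. This yields the Jacobian without charts on the sphere.
  have h1 : ∀ g, I (U g) * I 1 = I (U 1) * I g := by
    intro g
    refine evS_denseRange.induction_on g (isClosed_eq ?_ ?_) fun P => ?_
    · exact (hIc.comp (continuous_wcomp hb _)).mul continuous_const
    · exact continuous_const.mul hIc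
    · refine evS_induction (p := fun g => I (U g) * I 1 = I (U 1) * I g) ?_ ?_ P
      · intro f g hf hg
        rw [map_add, hIa, hIa, add_mul, mul_add, hf, hg]
      · intro n P hP
        by_cases hn : n = 0
        · subst hn
          obtain ⟨c, e⟩ := hP.exists_evS_eq_smul_one
          have hs : ∀ g, I (c • g) = c * I g := fun g => integral_const_mul c g
          rw [e, map_smul, hs, hs]
          ring
        · have e1 : I (U (evS P)) = 0 := integral_wcomp_harm hd hb hn hP
          have e2 : I (evS P) = 0 := by
            have := integral_harm_mul_harm hn hP isHarm_one
            simpa [hI] using this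
          rw [e1, e2]
          ring
  have hpos : ∀ f : C(S d, ℝ), (∀ θ, 0 < f θ) → 0 < ∫ θ, f θ ∂(surf d) := by
    intro f hf
    obtain ⟨θ⟩ : Nonempty (S d) :=
      ⟨⟨EuclideanSpace.single 0 1, by simp⟩⟩
    exact f.continuous.integral_pos_of_hasCompactSupport_nonneg_nonzero
      (HasCompactSupport.of_compactSpace _) (fun θ => (hf θ).le) (hf θ).ne'
  obtain ⟨s, hs, hs'⟩ : ∃ s : ℝ, 0 < s ∧ I 1 = s := by
    refine ⟨_, hpos 1 fun θ => one_pos, ?_⟩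
    rw [← integral_complex_ofReal]; simp [hI]
  obtain ⟨t, ht, ht'⟩ : ∃ t : ℝ, 0 < t ∧ I (U 1) = t := by
    refine ⟨_, hpos (sphereKel hb ^ (d - 2 + d)) fun θ => pow_pos (sphereKel_pos hb θ) _, ?_⟩
    rw [← integral_complex_ofReal]
    simp [hI, hU, wcomp_apply]
  -- Since `U` is an involution, the choice `g = U 1` gives `I(1)² = I(U 1)²`; both numbers are
  -- positive, so the proportionality constant is `1`.
  have h2 := h1 (U 1)
  rw [hU, wcomp_wcomp, ← hU, ht', hs'] at h2
  have h3 : s = t := by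
    have : s * s = t * t := by exact_mod_cast h2
    nlinarith
  have h4 := h1 g
  rw [ht', hs', h3, mul_comm] at h4
  exact mul_left_cancel₀ (by exact_mod_cast ht.ne') h4

end SphereInversion

end DepthEIT

namespace DepthEIT

variable {d : ℕ} {b : E d}

/-! ### The Kelvin transform on `L²(∂𝔹)` and the conjugated operator -/

section KelvinOperators

open Set Metric

lemma integral_wcomp_comp_mul [NeZero d] (hd : 2 ≤ d) (hb : 1 < ‖b‖) (f g : C(S d, ℂ)) :
    ∫ θ, wcomp hb d f θ * g θ ∂(surf d) = ∫ θ, f θ * wcomp hb (d - 2) g θ ∂(surf d) := by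
  rw [show ∫ θ, f θ * wcomp hb (d - 2) g θ ∂(surf d) =
    ∫ θ, (f * wcomp hb (d - 2) g) θ ∂(surf d) from rfl, ← integral_wcomp hd hb]
  refine integral_congr_ae (Eventually.of_forall fun θ => ?_)
  have h4 : ((sphereKel hb θ : ℝ) : ℂ) ≠ 0 := by exact_mod_cast (sphereKel_pos hb θ).ne'
  simp only [wcomp_apply, ContinuousMap.mul_apply, sphereInv_sphereInv, sphereKel_sphereInv]
  push_cast
  rw [pow_add, inv_pow]
  field_simp

lemma integral_wcomp_real [NeZero d] (hd : 2 ≤ d) (hb : 1 < ‖b‖) {f : S d → ℝ}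
    (hf : Continuous f) : ∫ θ, sphereKel hb θ ^ (d - 2 + d) * f (sphereInv hb θ) ∂(surf d) = ∫ θ, f θ ∂(surf d) := by
  have h := integral_wcomp hd hb
    (⟨fun θ => (f θ : ℂ), Complex.continuous_ofReal.comp hf⟩ : C(S d, ℂ))
  simp only [wcomp_apply, ContinuousMap.coe_mk, ← Complex.ofReal_mul, integral_complex_ofReal] at h
  exact_mod_cast h

/-- Squaring the weight gives `k^(2d-4)`, two powers short of the Jacobian `k^(2d-2)`. The missing
`k⁻²` becomes `k²` after the change of variables. -/
lemma norm_toL2_wcomp_sub_two_sq [NeZero d] (hd : 2 ≤ d) (hb : 1 < ‖b‖) (g : C(S d, ℂ)) :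
    ‖toL2 (wcomp hb (d - 2) g)‖ ^ 2 = ∫ θ, sphereKel hb θ ^ 2 * ‖g θ‖ ^ 2 ∂(surf d) := by
  rw [norm_toL2_sq, ← integral_wcomp_real hd hb
    (f := fun θ => sphereKel hb θ ^ 2 * ‖g θ‖ ^ 2) (by fun_prop)]
  refine integral_congr_ae (Eventually.of_forall fun θ => ?_)
  obtain ⟨m, rfl⟩ : ∃ m, d = m + 2 := ⟨d - 2, by omega⟩
  have h := (sphereKel_pos hb θ).ne'
  simp only [wcomp_apply, norm_mul, Complex.norm_real, sphereKel_sphereInv,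
    Real.norm_eq_abs, mul_pow, sq_abs, Nat.add_sub_cancel]
  field_simp
  ring

/-- Here the squared weight `k^(2d)` exceeds the Jacobian by `k²`, which becomes `k⁻²` after the
change of variables. -/
lemma norm_toL2_wcomp_sq [NeZero d] (hd : 2 ≤ d) (hb : 1 < ‖b‖) (g : C(S d, ℂ)) :
    ‖toL2 (wcomp hb d g)‖ ^ 2 = ∫ θ, (sphereKel hb θ)⁻¹ ^ 2 * ‖g θ‖ ^ 2 ∂(surf d) := by
  have hc : Continuous fun θ => (sphereKel hb θ)⁻¹ ^ 2 * ‖g θ‖ ^ 2 :=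
    (((sphereKel hb).continuous.inv₀ fun θ => (sphereKel_pos hb θ).ne').pow 2).mul (by fun_prop)
  rw [norm_toL2_sq, ← integral_wcomp_real hd hb hc]
  refine integral_congr_ae (Eventually.of_forall fun θ => ?_)
  obtain ⟨m, rfl⟩ : ∃ m, d = m + 2 := ⟨d - 2, by omega⟩
  have h := (sphereKel_pos hb θ).ne'
  simp only [wcomp_apply, norm_mul, Complex.norm_real, sphereKel_sphereInv,
    Real.norm_eq_abs, mul_pow, sq_abs, Nat.add_sub_cancel]
  field_simp
  ring

/-- The maximum of the conformal factor. -/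
noncomputable def kelMax (b : E d) : ℝ := (‖b‖ + 1) / (‖b‖ - 1)

lemma kelMax_pos (hb : 1 < ‖b‖) : 0 < kelMax b := div_pos (by linarith) (by linarith)

lemma sphereKel_sq_le (hb : 1 < ‖b‖) (θ : S d) : sphereKel hb θ ^ 2 ≤ kelMax b := by
  have hne := ne_of_mem_closedBall hb (sphere_mem_closedBall θ)
  have h1 := kel_sq_mul hb hne
  have h2 : ‖b‖ - 1 ≤ ‖(θ : E d) - b‖ := by
    have := norm_sub_norm_le b θ
    rw [norm_sub_rev] at this
    simpa using this
  have h3 := sphereKel_pos hb θ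
  rw [sphereKel_apply] at *
  rw [kelMax, le_div_iff₀ (by linarith)]
  have h4 : kel b θ ^ 2 * (‖b‖ - 1) ^ 2 ≤ kel b θ ^ 2 * ‖(θ : E d) - b‖ ^ 2 := by
    gcongr
  have h5 : kel b θ ^ 2 * (‖b‖ - 1) * (‖b‖ - 1) ≤ (‖b‖ + 1) * (‖b‖ - 1) := by nlinarith
  exact le_of_mul_le_mul_right h5 (by linarith)

/-- The inversion permutes the sphere and inverts `k`, so `k²` and `k⁻²` have the same range. -/
lemma inv_sphereKel_sq_le (hb : 1 < ‖b‖) (θ : S d) : (sphereKel hb θ)⁻¹ ^ 2 ≤ kelMax b := by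
  rw [← sphereKel_sphereInv]; exact sphereKel_sq_le hb _

lemma norm_le_of_sq_integral_le (K : ℝ) {f : S d → ℝ} (hf : ∀ θ, f θ ≤ K) (hfc : Continuous f)
    {g h : C(S d, ℂ)} (e : ‖toL2 h‖ ^ 2 = ∫ θ, f θ * ‖g θ‖ ^ 2 ∂(surf d)) :
    ‖toL2 h‖ ≤ √K * ‖toL2 g‖ := by
  by_cases hK : 0 ≤ K
  · refine abs_le_of_sq_le_sq' ?_ (by positivity) |>.2
    rw [mul_pow, Real.sq_sqrt hK, e, norm_toL2_sq, ← integral_const_mul]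
    refine integral_mono ?_ ?_ fun θ => ?_
    · exact (hfc.mul (by fun_prop)).integrable_of_hasCompactSupport (HasCompactSupport.of_compactSpace _)
    · exact Continuous.integrable_of_hasCompactSupport (by fun_prop) (HasCompactSupport.of_compactSpace _)
    · exact mul_le_mul_of_nonneg_right (hf θ) (by positivity)
  · have : ‖toL2 h‖ ^ 2 ≤ 0 := by
      rw [e]
      exact integral_nonpos fun θ => mul_nonpos_of_nonpos_of_nonneg
        ((hf θ).trans (not_le.1 hK).le) (by positivity)
    have h0 : ‖toL2 h‖ = 0 := by nlinarith [norm_nonneg (toL2 h)]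
    rw [h0]; positivity

lemma exists_kelvin_op [NeZero d] (hd : 2 ≤ d) (hb : 1 < ‖b‖) : ∃ W : L2S d →L[ℂ] L2S d,
    (∀ g, W (toL2 g) = toL2 (wcomp hb (d - 2) g)) ∧ ‖W‖ ≤ √(kelMax b) :=
  exists_L2_extension ((toL2 : C(S d, ℂ) →L[ℂ] L2S d).toLinearMap ∘ₗ wcomp hb (d - 2)) _
    (Real.sqrt_nonneg _) fun g => norm_le_of_sq_integral_le _ (sphereKel_sq_le hb) (by fun_prop)
      (norm_toL2_wcomp_sub_two_sq hd hb g)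

lemma exists_kelvin_adjoint_op [NeZero d] (hd : 2 ≤ d) (hb : 1 < ‖b‖) : ∃ V : L2S d →L[ℂ] L2S d,
    (∀ g, V (toL2 g) = toL2 (wcomp hb d g)) ∧ ‖V‖ ≤ √(kelMax b) :=
  exists_L2_extension ((toL2 : C(S d, ℂ) →L[ℂ] L2S d).toLinearMap ∘ₗ wcomp hb d) _
    (Real.sqrt_nonneg _) fun g => norm_le_of_sq_integral_le _ (inv_sphereKel_sq_le hb)
      (((sphereKel hb).continuous.inv₀ fun θ => (sphereKel_pos hb θ).ne').pow 2)
      (norm_toL2_wcomp_sq hd hb g)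

/-- The Kelvin transform on `L²(∂𝔹)`. -/
noncomputable def kelvinOp [NeZero d] (hd : 2 ≤ d) (hb : 1 < ‖b‖) : L2S d →L[ℂ] L2S d :=
  (exists_kelvin_op hd hb).choose

lemma kelvinOp_toL2 [NeZero d] (hd : 2 ≤ d) (hb : 1 < ‖b‖) (g : C(S d, ℂ)) :
    kelvinOp hd hb (toL2 g) = toL2 (wcomp hb (d - 2) g) := (exists_kelvin_op hd hb).choose_spec.1 g

lemma norm_kelvinOp_le [NeZero d] (hd : 2 ≤ d) (hb : 1 < ‖b‖) : ‖kelvinOp hd hb‖ ≤ √(kelMax b) :=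
  (exists_kelvin_op hd hb).choose_spec.2

/-- The transpose of the Kelvin transform on `L²(∂𝔹)`. -/
noncomputable def kelvinAdj [NeZero d] (hd : 2 ≤ d) (hb : 1 < ‖b‖) : L2S d →L[ℂ] L2S d :=
  (exists_kelvin_adjoint_op hd hb).choose

lemma kelvinAdj_toL2 [NeZero d] (hd : 2 ≤ d) (hb : 1 < ‖b‖) (g : C(S d, ℂ)) :
    kelvinAdj hd hb (toL2 g) = toL2 (wcomp hb d g) := (exists_kelvin_adjoint_op hd hb).choose_spec.1 g

lemma norm_kelvinAdj_le [NeZero d] (hd : 2 ≤ d) (hb : 1 < ‖b‖) : ‖kelvinAdj hd hb‖ ≤ √(kelMax b) :=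
  (exists_kelvin_adjoint_op hd hb).choose_spec.2

lemma pair_kelvinAdj [NeZero d] (hd : 2 ≤ d) (hb : 1 < ‖b‖) (f g : L2S d) :
    pair (kelvinAdj hd hb f) g = pair f (kelvinOp hd hb g) := by
  refine toL2_denseRange.induction_on f (isClosed_eq
    ((continuous_pair_left _).comp (kelvinAdj hd hb).continuous) (continuous_pair_left _)) fun f => ?_
  refine toL2_denseRange.induction_on g (isClosed_eq (continuous_pair_right _)
    ((continuous_pair_right _).comp (kelvinOp hd hb).continuous)) fun g => ?_
  rw [kelvinAdj_toL2, kelvinOp_toL2, pair_toL2, pair_toL2, integral_wcomp_comp_mul hd]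

/-- The conjugation of an operator on `L²(∂𝔹)` with the Kelvin transform. -/
noncomputable def kelvinConj [NeZero d] (hd : 2 ≤ d) (hb : 1 < ‖b‖) (T : L2S d →L[ℂ] L2S d) :
    L2S d →L[ℂ] L2S d := kelvinAdj hd hb ∘L T ∘L kelvinOp hd hb

lemma kelvinConj_apply [NeZero d] (hd : 2 ≤ d) (hb : 1 < ‖b‖) (T : L2S d →L[ℂ] L2S d) (f : L2S d) :
    kelvinConj hd hb T f = kelvinAdj hd hb (T (kelvinOp hd hb f)) := rfl

lemma pair_kelvinConj [NeZero d] (hd : 2 ≤ d) (hb : 1 < ‖b‖) {T : L2S d →L[ℂ] L2S d}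
    (hT : ∀ f g, pair (T f) g = pair f (T g)) (f g : L2S d) :
    pair (kelvinConj hd hb T f) g = pair f (kelvinConj hd hb T g) := by
  rw [kelvinConj_apply, pair_kelvinAdj, hT, pair_comm, ← pair_kelvinAdj, pair_comm, kelvinConj_apply]

lemma norm_kelvinConj_le [NeZero d] (hd : 2 ≤ d) (hb : 1 < ‖b‖) (T : L2S d →L[ℂ] L2S d) :
    ‖kelvinConj hd hb T‖ ≤ kelMax b * ‖T‖ := by
  refine (ContinuousLinearMap.opNorm_comp_le _ _).trans ?_
  calc ‖kelvinAdj hd hb‖ * ‖T ∘L kelvinOp hd hb‖ ≤ √(kelMax b) * (‖T‖ * √(kelMax b)) := by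
        gcongr
        · exact norm_kelvinAdj_le hd hb
        · refine (ContinuousLinearMap.opNorm_comp_le _ _).trans ?_
          gcongr
          exact norm_kelvinOp_le hd hb
    _ = (√(kelMax b)) ^ 2 * ‖T‖ := by ring
    _ = kelMax b * ‖T‖ := by rw [Real.sq_sqrt (kelMax_pos hb).le]

/-- The Kelvin transforms of both solutions solve the problems for the image inclusion with equal
Dirichlet data. The difference of their normal derivatives is the old one composed with the
inversion and weighted by `k^d`. -/
lemma SmoothDNData.kelvin [NeZero d] (hd : 2 ≤ d) (hb : 1 < ‖b‖) {C C' : E d} {R R' : ℝ}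
    (hball : ∀ x ∈ dom C R, ballInv b x ∈ dom C' R')
    (hsph : ∀ x ∈ sphere C R, ballInv b x ∈ sphere C' R')
    (hsub : sphere C R ⊆ closedBall 0 1) {T : L2S d →L[ℂ] L2S d} {p : E d → ℂ}
    (h : SmoothDNData C' R' T p) : SmoothDNData C R (kelvinConj hd hb T) (kelvin hb p) := by
  obtain ⟨hp, Φ, H, g, sΦ, sH, lH, lΦ, zΦ, hθ, hT⟩ := h
  refine ⟨contDiff_kelvin hb hp, DepthEIT.kelvin hb Φ, DepthEIT.kelvin hb H, wcomp hb d g,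
    contDiff_kelvin hb sΦ, contDiff_kelvin hb sH, fun x hx => ?_, fun x hx => ?_, fun x hx => ?_,
    fun θ => ⟨?_, ?_, ?_⟩, ?_⟩
  · rw [lap_kelvin_eq hd hb sH (ball_subset_closedBall hx), lH _ (ballInv_mem_ball hb hx), mul_zero]
  · rw [lap_kelvin_eq hd hb sΦ (ball_subset_closedBall hx.1), lΦ _ (hball x hx), mul_zero]
  · rw [kelvin_apply hb _ (hsub hx), zΦ _ (hsph x hx), mul_zero]
  · rw [kelvin_apply hb _ (sphere_mem_closedBall θ), kelvin_apply hb _ (sphere_mem_closedBall θ),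
      ← coe_sphereInv hb, (hθ _).1]
  · rw [kelvin_apply hb _ (sphere_mem_closedBall θ), kelvin_apply hb _ (sphere_mem_closedBall θ),
      ← coe_sphereInv hb, (hθ _).2.1]
  · rw [fderiv_kelvin_self hd hb sΦ, fderiv_kelvin_self hd hb sH, wcomp_apply, (hθ _).2.2,
      ← coe_sphereInv hb, (hθ _).1, (hθ _).2.1, sphereKel_apply]
    ring
  -- The operator `W` undoes the Kelvin transform of the data, so `T` is applied to the original
  -- `p`.
  · have e : wcomp hb (d - 2) (resS (DepthEIT.kelvin hb p) (contDiff_kelvin hb hp)) = resS p hp := by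
      rw [← wcomp_wcomp hb (d - 2) (resS p hp)]
      congr 1
      ext θ
      exact kelvin_apply hb p (sphere_mem_closedBall θ)
    rw [kelvinConj_apply, kelvinOp_toL2, e, hT, kelvinAdj_toL2]

/-- The difference of the Dirichlet-to-Neumann maps for an inclusion that is mapped to a concentric
ball by the inversion. -/
theorem extendsDNDiff_kelvin_iff [NeZero d] (hd : 2 ≤ d) (hb : 1 < ‖b‖) {C : E d} {R r : ℝ}
    (hr0 : 0 < r) (hr1 : r < 1) (hR : 0 < R) (hC : ‖C‖ + R < 1)
    (hball : ∀ x ∈ dom C R, ballInv b x ∈ dom 0 r)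
    (hsph : ∀ x ∈ sphere C R, ballInv b x ∈ sphere 0 r)
    {T : L2S d →L[ℂ] L2S d} (hT : IsMultiplier (eig d r) T) (T' : L2S d →L[ℂ] L2S d) :
    ExtendsDNDiff C R T' ↔ T' = kelvinConj hd hb T := by
  refine extendsDNDiff_iff hR hC (pair_kelvinConj hd hb hT.pair_symm) (fun φ hφ => ?_) T'
  obtain ⟨P, hP⟩ := exists_polynomial_kelvin_C1Tendsto hb hφ
  exact ⟨_, fun k => (smoothDNData_ev hd hr0 hr1 hT (P k)).kelvin hd hb hball hsph
    (sphere_subset_closedBall.trans ((closedBall_subset_unitBall hC).trans ball_subset_closedBall)), hP⟩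

end KelvinOperators

end DepthEIT

namespace DepthEIT

variable {d : ℕ}

/-! ### Geometry of the inverted inclusion -/

section Inclusion

open Set Metric

/-- The center of the inversion `I_a`. -/
noncomputable def invCenter (a : E d) : E d := (‖a‖ ^ 2)⁻¹ • a

lemma norm_invCenter {a : E d} (ha : a ≠ 0) : ‖invCenter a‖ = ‖a‖⁻¹ := by
  have : ‖a‖ ≠ 0 := norm_ne_zero_iff.2 ha
  rw [invCenter, norm_smul, norm_inv, norm_pow, norm_norm]
  field_simp

lemma one_lt_norm_invCenter {a : E d} (ha : a ≠ 0) (ha1 : ‖a‖ < 1) : 1 < ‖invCenter a‖ := by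
  rw [norm_invCenter ha]
  exact (one_lt_inv₀ (norm_pos_iff.2 ha)).2 ha1

lemma inv_eq_ballInv {a : E d} (ha : a ≠ 0) : inv a = ballInv (invCenter a) := by
  rw [inv, ballInv, norm_invCenter ha, inv_pow]
  rfl

variable {b : E d}

/-- The closed balls are the closures of the open ones; continuity and compactness let the image
commute with closure. This locates both the boundary sphere and the complement of the inclusion. -/
lemma closedBall_eq_image_ballInv (hb : 1 < ‖b‖) {C : E d} {R r : ℝ} (hr0 : 0 < r) (hr1 : r < 1)
    (hR : 0 < R) (h : ball C R = ballInv b '' ball 0 r) :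
    closedBall C R = ballInv b '' closedBall 0 r := by
  have hsub : closedBall (0 : E d) r ⊆ closedBall 0 1 := closedBall_subset_closedBall hr1.le
  have hc : ContinuousOn (ballInv b) (closedBall 0 r) := fun x hx =>
    (contDiffAt_ballInv (ne_of_mem_closedBall hb (hsub hx))).continuousAt.continuousWithinAt
  rw [← closure_ball C hR.ne', h]
  refine Subset.antisymm ?_ ?_
  · exact closure_minimal (image_mono ball_subset_closedBall)
      ((isCompact_closedBall 0 r).image_of_continuousOn hc).isClosed
  · rw [← closure_ball (0 : E d) hr0.ne'] at hc ⊢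
    exact hc.image_closure

lemma ballInv_mem_dom (hb : 1 < ‖b‖) {C : E d} {R r : ℝ} (hr0 : 0 < r) (hr1 : r < 1)
    (hR : 0 < R) (h : ball C R = ballInv b '' ball 0 r) {x : E d} (hx : x ∈ dom C R) :
    ballInv b x ∈ dom 0 r := by
  refine ⟨ballInv_mem_ball hb hx.1, fun hx' => hx.2 ?_⟩
  rw [closedBall_eq_image_ballInv hb hr0 hr1 hR h]
  exact ⟨_, hx', ballInv_ballInv hb x⟩

lemma ballInv_mem_sphere_of_ball_eq (hb : 1 < ‖b‖) {C : E d} {R r : ℝ} (hr0 : 0 < r) (hr1 : r < 1)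
    (hR : 0 < R) (h : ball C R = ballInv b '' ball 0 r) {x : E d} (hx : x ∈ sphere C R) :
    ballInv b x ∈ sphere 0 r := by
  have hx1 := sphere_subset_closedBall hx
  rw [closedBall_eq_image_ballInv hb hr0 hr1 hR h] at hx1
  obtain ⟨y, hy, rfl⟩ := hx1
  rw [ballInv_ballInv hb]
  rw [← closedBall_sdiff_ball]
  refine ⟨hy, fun hy' => ?_⟩
  have : ballInv b y ∈ ball C R := by rw [h]; exact mem_image_of_mem _ hy'
  rw [← closedBall_sdiff_ball] at hx
  exact hx.2 this

/-- The point of the closed ball farthest from the origin lies in the direction of its centre, or in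
any direction if the centre is the origin. -/
lemma norm_add_lt_one_of_closedBall_subset [NeZero d] {C : E d} {R : ℝ} (hR : 0 < R)
    (h : closedBall C R ⊆ ball (0 : E d) 1) : ‖C‖ + R < 1 := by
  obtain ⟨u, hu, hC⟩ : ∃ u : E d, ‖u‖ = 1 ∧ C = ‖C‖ • u := by
    by_cases hC : C = 0
    · exact ⟨EuclideanSpace.single 0 1, by simp, by simp [hC]⟩
    · have := norm_ne_zero_iff.2 hC
      exact ⟨‖C‖⁻¹ • C, by simp [norm_smul, this], by simp [smul_smul, this]⟩
  have h1 : C + R • u ∈ ball (0 : E d) 1 := h (by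
    rw [mem_closedBall_iff_norm, add_sub_cancel_left, norm_smul, hu, Real.norm_of_nonneg hR.le, mul_one])
  rw [mem_ball_zero_iff, hC, ← add_smul, norm_smul, hu, mul_one,
    Real.norm_of_nonneg (by positivity)] at h1
  exact h1

lemma norm_add_lt_one [NeZero d] (hb : 1 < ‖b‖) {C : E d} {R r : ℝ} (hr0 : 0 < r) (hr1 : r < 1)
    (hR : 0 < R) (h : ball C R = ballInv b '' ball 0 r) : ‖C‖ + R < 1 := by
  refine norm_add_lt_one_of_closedBall_subset hR ?_
  rw [closedBall_eq_image_ballInv hb hr0 hr1 hR h]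
  rintro _ ⟨x, hx, rfl⟩
  exact ballInv_mem_ball hb (closedBall_subset_ball hr1 hx)

end Inclusion

end DepthEIT

namespace DepthEIT

variable {d : ℕ} {b : E d}

/-! ### Moments of linear forms on the sphere -/

section Moments

open MvPolynomial Metric

/-- The linear form `x ↦ ⟨b, x⟩`. -/
noncomputable def linP (b : E d) : MvPolynomial (Fin d) ℂ := ∑ i, C (b i : ℂ) * X i

lemma ev_linP (b x : E d) : ev (linP b) x = ((inner ℝ b x : ℝ) : ℂ) := by
  rw [linP, ev_sum, PiLp.inner_apply]
  simp [mul_comm]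

lemma isHarm_of_isHomogeneous [NeZero d] {n : ℕ} (hn : n < 2) {P : MvPolynomial (Fin d) ℂ}
    (hP : P.IsHomogeneous n) : IsHarm n P := by
  obtain ⟨h, Q, hh, -, e, hQ⟩ := exists_harm_add_normSqP_mul hP
  rw [hQ hn, mul_zero, add_zero] at e
  exact e ▸ hh

lemma isHomogeneous_linP (b : E d) : (linP b).IsHomogeneous 1 :=
  IsHomogeneous.sum _ _ _ fun i _ => (isHomogeneous_X ℂ i).C_mul _

lemma isHarm_linP [NeZero d] (b : E d) : IsHarm 1 (linP b) :=
  isHarm_of_isHomogeneous one_lt_two (isHomogeneous_linP b)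

lemma integral_harm [NeZero d] {n : ℕ} (hn : n ≠ 0) {P : MvPolynomial (Fin d) ℂ} (hP : IsHarm n P) :
    ∫ θ : S d, ev P θ ∂(surf d) = 0 := by
  simpa using integral_harm_mul_harm hn hP isHarm_one

lemma integral_inner [NeZero d] (b : E d) : ∫ θ : S d, inner ℝ b (θ : E d) ∂(surf d) = 0 := by
  have h := integral_harm one_ne_zero (isHarm_linP b)
  simp only [ev_linP, integral_complex_ofReal] at h
  exact_mod_cast h

/-- On the sphere a cubic form is a sum of harmonics of degrees `3` and `1`, and both have mean
zero. -/
lemma integral_inner_pow_three [NeZero d] (b : E d) :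
    ∫ θ : S d, inner ℝ b (θ : E d) ^ 3 ∂(surf d) = 0 := by
  have hl := (isHomogeneous_linP b).pow 3
  obtain ⟨h, Q, hh, hQ, e, -⟩ := exists_harm_add_normSqP_mul hl
  have e1 : ∀ θ : S d, ((inner ℝ b (θ : E d) ^ 3 : ℝ) : ℂ) = ev h θ + ev Q θ := fun θ => by
    have := congrArg (fun P => ev P (θ : E d)) e
    simpa [ev_normSqP, ev_linP] using this
  have h2 : ∫ θ : S d, ((inner ℝ b (θ : E d) ^ 3 : ℝ) : ℂ) ∂(surf d) = 0 := by
    simp only [e1, ← evS_apply]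
    rw [integral_add (integrable_sphere (evS h).continuous) (integrable_sphere (evS Q).continuous)]
    simp only [evS_apply]
    rw [integral_harm (by norm_num) hh, integral_harm one_ne_zero
      (isHarm_of_isHomogeneous one_lt_two (by simpa using hQ)), add_zero]
  rw [integral_complex_ofReal] at h2
  exact_mod_cast h2

/-- Green's identity with `v = Φ = ⟨b,x⟩` gives `|b|²` times the volume of the ball, and the surface
area is `d` times that volume. -/
lemma integral_inner_sq [NeZero d] (b : E d) :
    ∫ θ : S d, inner ℝ b (θ : E d) ^ 2 ∂(surf d) = ‖b‖ ^ 2 / d * (surf d).real Set.univ := by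
  have hd : (d : ℝ) ≠ 0 := by exact_mod_cast NeZero.ne d
  have h := green_unit_ball (contDiff_ev (linP b)) (contDiff_ev (linP b))
  have h1 : ∀ (i : Fin d) (x : E d), pd i (ev (linP b)) x = b i := fun i x => by
    rw [pd_ev, linP, map_sum, ev_sum, Finset.sum_eq_single i]
    · rw [Derivation.leibniz, pderiv_X_self, pderiv_C]; simp
    · intro j _ hj
      rw [Derivation.leibniz, pderiv_X_of_ne hj, pderiv_C]; simp
    · simp
  have h2 : ∑ i, b i * b i = ‖b‖ ^ 2 := by
    rw [EuclideanSpace.norm_sq_eq]; simp [← sq]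
  simp only [h1, (isHarm_linP b).lap_eq_zero, mul_zero, integral_zero, sub_zero,
    fderiv_ev_self (isHomogeneous_linP b), Nat.cast_one, one_mul, ev_linP, ← Complex.ofReal_mul,
    integral_complex_ofReal, setIntegral_const] at h
  have h3 : (volume : Measure (E d)).real (ball 0 1) * ‖b‖ ^ 2 =
      ∫ θ : S d, inner ℝ b (θ : E d) * inner ℝ b (θ : E d) ∂(surf d) := by
    rw [Complex.real_smul] at h
    rw [← h2]
    exact_mod_cast h
  have h4 : (surf d).real Set.univ = d * (volume : Measure (E d)).real (ball 0 1) := by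
    rw [Measure.real, Measure.toSphere_apply_univ, ENNReal.toReal_mul]
    simp [Measure.real]
  simp only [sq (inner ℝ b _), ← h3, h4]
  field_simp

end Moments

/-! ### The lower bound for the conjugated operator -/

section Bounds

/-- On the sphere `k⁻²` is affine in `⟨b,θ⟩`, so it has harmonic components of degrees `0` and `1`
only. This makes the test function of the lower bound computable. -/
lemma inv_sphereKel_sq (hb : 1 < ‖b‖) (θ : S d) :
    (sphereKel hb θ)⁻¹ ^ 2 = (‖b‖ ^ 2 + 1 - 2 * inner ℝ b (θ : E d)) / (‖b‖ ^ 2 - 1) := by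
  have hne := ne_of_mem_closedBall hb (sphere_mem_closedBall θ)
  have h1 := kel_sq_mul hb hne
  have h2 := (sphereKel_pos hb θ).ne'
  have h3 : ‖(θ : E d) - b‖ ^ 2 = ‖b‖ ^ 2 + 1 - 2 * inner ℝ b (θ : E d) := by
    rw [norm_sub_sq_real, real_inner_comm]
    simp
    ring
  have h4 : ‖b‖ ^ 2 - 1 ≠ 0 := by nlinarith
  rw [sphereKel_apply] at *
  rw [h3] at h1
  field_simp
  linarith

lemma surf_univ_pos [NeZero d] : 0 < (surf d).real Set.univ := by
  have h := norm_toL2_sq (1 : C(S d, ℂ))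
  have h2 : ‖toL2 (1 : C(S d, ℂ))‖ ≠ 0 := by
    rw [norm_ne_zero_iff]
    intro h0
    have h1 := DFunLike.congr_fun (toL2_injective (h0.trans (map_zero toL2).symm))
      ⟨EuclideanSpace.single 0 1, by simp⟩
    simp at h1
  have : ‖toL2 (1 : C(S d, ℂ))‖ ^ 2 = (surf d).real Set.univ := by
    rw [h]; simp
  rw [← this]
  positivity

lemma integral_cubic [NeZero d] (b : E d) (p q s t : ℝ) :
    ∫ θ : S d, (p + q * inner ℝ b (θ : E d) + s * inner ℝ b (θ : E d) ^ 2 +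
      t * inner ℝ b (θ : E d) ^ 3) ∂(surf d) = (p + s * (‖b‖ ^ 2 / d)) * (surf d).real Set.univ := by
  have hi : ∀ f : S d → ℝ, Continuous f → Integrable f (surf d) := fun f hf =>
    hf.integrable_of_hasCompactSupport (HasCompactSupport.of_compactSpace _)
  rw [integral_add (hi _ (by fun_prop)) (hi _ (by fun_prop)), integral_add (hi _ (by fun_prop))
    (hi _ (by fun_prop)), integral_add (hi _ (by fun_prop)) (hi _ (by fun_prop)), integral_const_mul,
    integral_const_mul, integral_const_mul, integral_inner, integral_inner_sq, integral_inner_pow_three,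
    integral_const, smul_eq_mul]
  ring

lemma norm_toL2_wcomp_one_sq [NeZero d] (hd : 2 ≤ d) (hb : 1 < ‖b‖) :
    ‖toL2 (wcomp hb d 1)‖ ^ 2 =
      (‖b‖ ^ 2 + 1) / (‖b‖ ^ 2 - 1) * (surf d).real Set.univ := by
  have h4 : ‖b‖ ^ 2 - 1 ≠ 0 := by nlinarith
  rw [norm_toL2_wcomp_sq hd hb]
  have h := integral_cubic b ((‖b‖ ^ 2 + 1) / (‖b‖ ^ 2 - 1)) (-2 / (‖b‖ ^ 2 - 1)) 0 0
  rw [zero_mul, add_zero] at h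
  rw [← h]
  refine integral_congr_ae (Eventually.of_forall fun θ => ?_)
  simp only [inv_sphereKel_sq, ContinuousMap.one_apply, norm_one]
  field_simp
  ring

/-- Lower bound for the norm of the conjugation of a multiplier with the Kelvin transform. -/
theorem norm_kelvinConj_ge [NeZero d] (hd : 2 ≤ d) (hb : 1 < ‖b‖) {c : ℕ → ℝ}
    {T : L2S d →L[ℂ] L2S d} (hT : IsMultiplier c T) :
    (‖b‖ ^ 2 + 1) ^ 2 * d * c 0 ^ 2 + 4 * ‖b‖ ^ 2 * c 1 * (c 1 + 2 * c 0) ≤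
      (‖b‖ ^ 2 - 1) ^ 2 * d * ‖kelvinConj hd hb T‖ ^ 2 := by
  have hd0 : (0 : ℝ) < d := by exact_mod_cast NeZero.pos d
  set β := ‖b‖ ^ 2 with hβ
  have hβ1 : 0 < β - 1 := by nlinarith
  have hσ := surf_univ_pos (d := d)
  -- The test function is `V 1`. Applying `W` gives `k^(d-2) · k^(-d) = k⁻²`, so `T` acts through
  -- `λ_0` and `λ_1` alone.
  have e1 : wcomp hb (d - 2) (wcomp hb d 1) = (((β + 1) / (β - 1) : ℝ) : ℂ) • evS 1 +
      ((-2 / (β - 1) : ℝ) : ℂ) • evS (linP b) := by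
    ext θ
    have h0 := inv_sphereKel_sq hb θ
    have h1 : sphereKel hb θ ^ (d - 2) * (sphereKel hb θ)⁻¹ ^ d = (sphereKel hb θ)⁻¹ ^ 2 := by
      have h := (sphereKel_pos hb θ).ne'
      obtain ⟨m, rfl⟩ : ∃ m, d = m + 2 := ⟨d - 2, by omega⟩
      rw [Nat.add_sub_cancel, pow_add, ← mul_assoc, ← mul_pow, mul_inv_cancel₀ h, one_pow, one_mul]
    rw [wcomp_apply, wcomp_apply, sphereKel_sphereInv, ContinuousMap.one_apply, mul_one,
      ← Complex.ofReal_mul, h1, h0]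
    simp only [ContinuousMap.add_apply, ContinuousMap.smul_apply, evS_apply, ev_linP, ev_one,
      smul_eq_mul, mul_one, ← hβ]
    push_cast
    ring
  set q : C(S d, ℂ) := ((c 0 * ((β + 1) / (β - 1)) : ℝ) : ℂ) • evS 1 +
      ((c 1 * (-2 / (β - 1)) : ℝ) : ℂ) • evS (linP b) with hq
  have e2 : kelvinConj hd hb T (toL2 (wcomp hb d 1)) = toL2 (wcomp hb d q) := by
    rw [kelvinConj_apply, kelvinOp_toL2, e1, ← kelvinAdj_toL2 hd, hq]
    simp only [map_add, map_smul, hT 0 1 isHarm_one, hT 1 _ (isHarm_linP b), smul_smul]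
    push_cast
    simp only [mul_comm]
  -- The squared norm is `∫ k⁻² q²`, whose integrand is a cubic polynomial in `⟨b,θ⟩`; its odd terms
  -- integrate to zero.
  have e3 : ‖toL2 (wcomp hb d q)‖ ^ 2 = (((β + 1) ^ 3 * c 0 ^ 2 + (4 * (β + 1) * c 1 ^ 2 +
      8 * (β + 1) * c 0 * c 1) * (β / d)) / (β - 1) ^ 3) * (surf d).real Set.univ := by
    rw [norm_toL2_wcomp_sq hd hb]
    have h := integral_cubic b ((β + 1) ^ 3 * c 0 ^ 2 / (β - 1) ^ 3)
      ((-4 * (β + 1) ^ 2 * c 0 * c 1 - 2 * (β + 1) ^ 2 * c 0 ^ 2) / (β - 1) ^ 3)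
      ((4 * (β + 1) * c 1 ^ 2 + 8 * (β + 1) * c 0 * c 1) / (β - 1) ^ 3)
      (-8 * c 1 ^ 2 / (β - 1) ^ 3)
    rw [← hβ] at h
    rw [show (((β + 1) ^ 3 * c 0 ^ 2 + (4 * (β + 1) * c 1 ^ 2 +
      8 * (β + 1) * c 0 * c 1) * (β / d)) / (β - 1) ^ 3) = (β + 1) ^ 3 * c 0 ^ 2 / (β - 1) ^ 3 +
      (4 * (β + 1) * c 1 ^ 2 + 8 * (β + 1) * c 0 * c 1) / (β - 1) ^ 3 * (β / d) by ring, ← h]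
    refine integral_congr_ae (Eventually.of_forall fun θ => ?_)
    have hqθ : q θ = ((c 0 * ((β + 1) / (β - 1)) + c 1 * (-2 / (β - 1)) * inner ℝ b (θ : E d) : ℝ) : ℂ) := by
      simp [hq, ev_linP]
    simp only [inv_sphereKel_sq, hqθ, Complex.norm_real, Real.norm_eq_abs, sq_abs, ← hβ]
    field_simp
    ring
  have h := (kelvinConj hd hb T).le_opNorm (toL2 (wcomp hb d 1))
  have h5 := pow_le_pow_left₀ (norm_nonneg _) h 2
  rw [mul_pow, e2, e3, norm_toL2_wcomp_one_sq hd hb, ← hβ, ← mul_assoc] at h5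
  have h6 := le_of_mul_le_mul_right h5 hσ
  rw [div_le_iff₀ (by positivity)] at h6
  have h7 : ‖kelvinConj hd hb T‖ ^ 2 * ((β + 1) / (β - 1)) * (β - 1) ^ 3 =
      ‖kelvinConj hd hb T‖ ^ 2 * (β - 1) ^ 2 * (β + 1) := by field_simp
  have h8 : (β + 1) ^ 3 * c 0 ^ 2 + (4 * (β + 1) * c 1 ^ 2 + 8 * (β + 1) * c 0 * c 1) * (β / d) =
      ((β + 1) ^ 2 * c 0 ^ 2 + 4 * (c 1 ^ 2 + 2 * c 0 * c 1) * (β / d)) * (β + 1) := by ring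
  rw [h7, h8] at h6
  have h9 := mul_le_mul_of_nonneg_right (le_of_mul_le_mul_right h6 (by positivity)) hd0.le
  have h10 : ((β + 1) ^ 2 * c 0 ^ 2 + 4 * (c 1 ^ 2 + 2 * c 0 * c 1) * (β / d)) * d =
      (β + 1) ^ 2 * d * c 0 ^ 2 + 4 * β * c 1 * (c 1 + 2 * c 0) := by field_simp
  rw [h10] at h9
  linarith

end Bounds

/-! ### The limits `r → 1` and `r → 0` -/

section Limits

lemma IsMultiplier.norm_eq [NeZero d] (hd : 2 ≤ d) {r : ℝ} (hr0 : 0 < r) (hr1 : r < 1)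
    {T : L2S d →L[ℂ] L2S d} (hT : IsMultiplier (eig d r) T) : ‖T‖ = eig d r 0 := by
  have h : ∀ n, |eig d r n| = eig d r n := fun n => abs_of_pos (eig_pos hd hr0 hr1 n)
  refine le_antisymm (hT.norm_le fun n => ?_) ?_
  · rw [h]; exact eig_antitone hd hr0 hr1 (Nat.zero_le n)
  · rw [← h]; exact hT.norm_ge hd 0

/-- The factor `k` is largest at `b/|b|`, the point of the sphere closest to `b`, so `k⁻¹` attains
the same maximum at the inverse of that point. -/
lemma exists_sphereKel_sq_eq [NeZero d] (hb : 1 < ‖b‖) : ∃ θ : S d, (sphereKel hb θ)⁻¹ ^ 2 = kelMax b := by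
  have hb0 : ‖b‖ ≠ 0 := by linarith
  have h1 : ‖b‖ - 1 ≠ 0 := by linarith
  let θ : S d := ⟨‖b‖⁻¹ • b, by simp [norm_smul, hb0]⟩
  refine ⟨sphereInv hb θ, ?_⟩
  have hne := ne_of_mem_closedBall hb (sphere_mem_closedBall θ)
  have h2 : ‖(θ : E d) - b‖ = ‖b‖ - 1 := by
    have : (θ : E d) - b = (‖b‖⁻¹ - 1) • b := by rw [sub_smul, one_smul]
    rw [this, norm_smul, Real.norm_eq_abs, abs_of_neg (by linarith [inv_lt_one_of_one_lt₀ hb])]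
    field_simp
    ring
  have h3 := kel_sq_mul hb hne
  rw [h2] at h3
  rw [sphereKel_sphereInv, inv_inv, sphereKel_apply, kelMax, eq_div_iff h1]
  have : (kel b θ ^ 2 * (‖b‖ - 1)) * (‖b‖ - 1) = (‖b‖ + 1) * (‖b‖ - 1) := by linear_combination h3
  exact mul_right_cancel₀ h1 this

/-- Where `k⁻² > M' > 0`, the weight `k⁻²` of `‖V f‖²` exceeds `M'²` times the weight `k²` of `‖W
f‖²`. A function supported there satisfies `‖V f‖ ≥ M' ‖W f‖`. -/
lemma exists_norm_kelvinAdj_gt [NeZero d] (hd : 2 ≤ d) (hb : 1 < ‖b‖) {M : ℝ} (hM : M < kelMax b) :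
    ∃ P : MvPolynomial (Fin d) ℂ,
      M * ‖kelvinOp hd hb (toL2 (evS P))‖ < ‖kelvinAdj hd hb (toL2 (evS P))‖ := by
  -- The strict inequality is an open condition, so it passes to a polynomial by density.
  suffices h : ∃ f : L2S d, M * ‖kelvinOp hd hb f‖ < ‖kelvinAdj hd hb f‖ by
    exact toL2_evS_denseRange.exists_mem_open
      (isOpen_lt (f := fun f => M * ‖kelvinOp hd hb f‖) (g := fun f => ‖kelvinAdj hd hb f‖)
        (by fun_prop) (by fun_prop)) h
  -- A positive number strictly between `M` and the maximum is chosen so that a strict inequality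
  -- remains at the end.
  obtain ⟨M', hM1, hM2⟩ := exists_between (max_lt hM (kelMax_pos hb))
  rw [max_lt_iff] at hM1
  have hkc : Continuous fun θ => (sphereKel hb θ)⁻¹ ^ 2 :=
    ((sphereKel hb).continuous.inv₀ fun θ => (sphereKel_pos hb θ).ne').pow 2
  let h : C(S d, ℂ) := ⟨fun θ => ((max ((sphereKel hb θ)⁻¹ ^ 2 - M') 0 : ℝ) : ℂ),
    Complex.continuous_ofReal.comp ((hkc.sub continuous_const).max continuous_const)⟩
  have hθ : ∀ θ, M' ^ 2 * (sphereKel hb θ ^ 2 * ‖h θ‖ ^ 2) ≤ (sphereKel hb θ)⁻¹ ^ 2 * ‖h θ‖ ^ 2 := by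
    intro θ
    by_cases hc : (sphereKel hb θ)⁻¹ ^ 2 ≤ M'
    · have : h θ = ((max ((sphereKel hb θ)⁻¹ ^ 2 - M') 0 : ℝ) : ℂ) := rfl
      rw [max_eq_right (by linarith), Complex.ofReal_zero] at this
      simp [this]
    · rw [← mul_assoc]
      refine mul_le_mul_of_nonneg_right ?_ (by positivity)
      have hk := sphereKel_pos hb θ
      rw [not_le] at hc
      have h1 : M' * sphereKel hb θ ^ 2 ≤ 1 := by
        have := mul_le_mul_of_nonneg_right hc.le (sq_nonneg (sphereKel hb θ))
        rwa [← mul_pow, inv_mul_cancel₀ hk.ne', one_pow] at this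
      calc M' ^ 2 * sphereKel hb θ ^ 2 = M' * (M' * sphereKel hb θ ^ 2) := by ring
        _ ≤ M' * 1 := by gcongr; exact hM1.2.le
        _ ≤ _ := by linarith
  have hi : ∀ f : S d → ℝ, Continuous f → Integrable f (surf d) := fun f hf =>
    hf.integrable_of_hasCompactSupport (HasCompactSupport.of_compactSpace _)
  have hle : M' * ‖kelvinOp hd hb (toL2 h)‖ ≤ ‖kelvinAdj hd hb (toL2 h)‖ := by
    refine abs_le_of_sq_le_sq' ?_ (norm_nonneg _) |>.2
    rw [mul_pow, kelvinOp_toL2, kelvinAdj_toL2, norm_toL2_wcomp_sub_two_sq hd, norm_toL2_wcomp_sq hd,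
      ← integral_const_mul]
    exact integral_mono (hi _ (by fun_prop)) (hi _ (hkc.mul (by fun_prop))) hθ
  have hpos : 0 < ‖kelvinAdj hd hb (toL2 h)‖ := by
    rw [norm_pos_iff, kelvinAdj_toL2]
    intro h0
    have h1 := toL2_injective (h0.trans (map_zero toL2).symm)
    have h2 := wcomp_wcomp hb d h
    rw [h1, map_zero] at h2
    obtain ⟨θ, hk⟩ := exists_sphereKel_sq_eq hb
    have h3 := DFunLike.congr_fun h2 θ
    have h4 : (max ((sphereKel hb θ)⁻¹ ^ 2 - M') 0 : ℝ) = 0 := by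
      apply Complex.ofReal_injective
      exact h3.symm
    rw [hk, max_eq_left (by linarith)] at h4
    linarith
  refine ⟨toL2 h, ?_⟩
  rcases (norm_nonneg (kelvinOp hd hb (toL2 h))).eq_or_lt with h0 | h0
  · rw [← h0, mul_zero]; exact hpos
  · exact (mul_lt_mul_of_pos_right hM1.1 h0).trans_le hle

/-- A polynomial involves finitely many degrees, and in each of them `λ_n/λ_0 → 1`. The convergence
is only pointwise: for fixed `r` the eigenvalues tend to `0`. -/
lemma tendsto_multiplier_apply [NeZero d] (hd : 2 ≤ d) {T : ℝ → L2S d →L[ℂ] L2S d}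
    (hT : ∀ r ∈ Set.Ioo (0 : ℝ) 1, IsMultiplier (eig d r) (T r)) (P : MvPolynomial (Fin d) ℂ) :
    Tendsto (fun r => (((eig d r 0)⁻¹ : ℝ) : ℂ) • T r (toL2 (evS P))) (𝓝[<] 1) (𝓝 (toL2 (evS P))) := by
  obtain ⟨s, h, hh, e⟩ := exists_harm_decomposition P
  rw [e, map_sum]
  have h1 : ∀ n ∈ s, Tendsto (fun r => ((eig d r n / eig d r 0 : ℝ) : ℂ) • toL2 (evS (h n))) (𝓝[<] 1)
      (𝓝 (toL2 (evS (h n)))) := fun n _ => by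
    have := ((Complex.continuous_ofReal.tendsto _).comp (tendsto_eig_div_eig hd n)).smul_const
      (toL2 (evS (h n)) : L2S d)
    simpa using this
  refine (tendsto_finsetSum s h1).congr' ?_
  filter_upwards [Ioo_mem_nhdsLT one_pos] with r hr
  rw [map_sum, Finset.smul_sum]
  refine Finset.sum_congr rfl fun n _ => ?_
  rw [hT r hr n _ (hh n), smul_smul, ← Complex.ofReal_mul, div_eq_inv_mul]

lemma kelvinOp_kelvinOp_toL2 [NeZero d] (hd : 2 ≤ d) (hb : 1 < ‖b‖) (g : C(S d, ℂ)) :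
    kelvinOp hd hb (kelvinOp hd hb (toL2 g)) = toL2 g := by
  rw [kelvinOp_toL2, kelvinOp_toL2, wcomp_wcomp]

/-- The upper bound holds for every `r`. For the lower one, the operator is tested on `W P`: since
`W` is an involution, its value is `V T P`, and `V T P/λ_0 → V P`. The quotient `‖V P‖/‖W P‖` can be
made as close to `kelMax b` as desired. -/
theorem tendsto_norm_kelvinConj_one [NeZero d] (hd : 2 ≤ d) (hb : 1 < ‖b‖)
    {T : ℝ → L2S d →L[ℂ] L2S d} (hT : ∀ r ∈ Set.Ioo (0 : ℝ) 1, IsMultiplier (eig d r) (T r)) :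
    Tendsto (fun r => ‖kelvinConj hd hb (T r)‖ / eig d r 0) (𝓝[<] 1) (𝓝 (kelMax b)) := by
  refine tendsto_order.2 ⟨fun M hM => ?_, fun M hM => ?_⟩
  · obtain ⟨P, hP⟩ := exists_norm_kelvinAdj_gt hd hb hM
    have h1 := (((kelvinAdj hd hb).continuous.tendsto _).comp (tendsto_multiplier_apply hd hT P)).norm
    filter_upwards [h1.eventually_const_lt hP, Ioo_mem_nhdsLT one_pos] with r hr hr1
    have hpos := eig_pos hd hr1.1 hr1.2 0
    have h2 := (kelvinConj hd hb (T r)).le_opNorm (kelvinOp hd hb (toL2 (evS P)))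
    rw [kelvinConj_apply, kelvinOp_kelvinOp_toL2] at h2
    simp only [Function.comp, map_smul, norm_smul, Complex.norm_real, norm_inv, Real.norm_eq_abs,
      abs_of_pos hpos] at hr
    have h3 : M * ‖kelvinOp hd hb (toL2 (evS P))‖ <
        ‖kelvinConj hd hb (T r)‖ / eig d r 0 * ‖kelvinOp hd hb (toL2 (evS P))‖ := by
      refine hr.trans_le ?_
      rw [div_eq_inv_mul, mul_assoc]
      gcongr
    exact lt_of_mul_lt_mul_right h3 (norm_nonneg _)
  · filter_upwards [Ioo_mem_nhdsLT one_pos] with r hr1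
    have hpos := eig_pos hd hr1.1 hr1.2 0
    refine lt_of_le_of_lt ?_ hM
    rw [div_le_iff₀ hpos, ← (hT r hr1).norm_eq hd hr1.1 hr1.2]
    exact norm_kelvinConj_le hd hb (T r)

/-- The orthogonal projection onto the constants. -/
noncomputable def meanOp (d : ℕ) : L2S d →L[ℂ] L2S d :=
  (((surf d).real Set.univ : ℂ)⁻¹) • (pairCLM (toL2 1)).smulRight (toL2 1)

lemma meanOp_apply (f : L2S d) :
    meanOp d f = ((((surf d).real Set.univ : ℂ)⁻¹) * pair (toL2 1) f) • toL2 1 := by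
  simp [meanOp, pairCLM_apply, smul_smul]

lemma isMultiplier_meanOp [NeZero d] : IsMultiplier (fun n => if n = 0 then 1 else 0) (meanOp d) := by
  intro n P hP
  have hσ : ((surf d).real Set.univ : ℂ) ≠ 0 := by exact_mod_cast (surf_univ_pos (d := d)).ne'
  rw [meanOp_apply, pair_toL2]
  by_cases hn : n = 0
  · subst hn
    obtain ⟨c, e⟩ := hP.exists_evS_eq_smul_one
    have h1 : ∫ θ : S d, (1 : C(S d, ℂ)) θ * (c • (1 : C(S d, ℂ))) θ ∂(surf d) =
        (surf d).real Set.univ * c := by simp [-Measure.toSphere_real_apply_univ]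
    rw [e, map_smul, h1, inv_mul_cancel_left₀ hσ]
    simp
  · have e2 : ∫ θ : S d, (1 : C(S d, ℂ)) θ * evS P θ ∂(surf d) = 0 := by
      simpa using integral_harm hn hP
    rw [e2]
    simp [hn]

lemma norm_pair_le (f g : L2S d) : ‖pair f g‖ ≤ ‖f‖ * ‖g‖ := by
  rw [pair_eq_inner]
  refine (norm_inner_le_norm _ _).trans_eq ?_
  congr 1
  rw [Lp.norm_def, Lp.norm_def]
  congr 1
  refine eLpNorm_congr_norm_ae ?_
  filter_upwards [Lp.coeFn_star f] with θ hθ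
  rw [hθ, Pi.star_apply, norm_star]

/-- Conjugation turns the mean into the rank-one operator sending `f` to `V 1` times its pairing
with `V 1`, divided by the surface area. Its norm is controlled by `‖V 1‖²` over that area. -/
lemma norm_kelvinConj_meanOp_le [NeZero d] (hd : 2 ≤ d) (hb : 1 < ‖b‖) :
    ‖kelvinConj hd hb (meanOp d)‖ ≤ (‖b‖ ^ 2 + 1) / (‖b‖ ^ 2 - 1) := by
  have hσ := surf_univ_pos (d := d)
  have h4 : 0 < ‖b‖ ^ 2 - 1 := by nlinarith
  refine ContinuousLinearMap.opNorm_le_bound _ (by positivity) fun f => ?_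
  have h1 := norm_toL2_wcomp_one_sq hd hb
  have h2 := norm_pair_le (kelvinAdj hd hb (toL2 1)) f
  rw [kelvinConj_apply, meanOp_apply, ← pair_kelvinAdj, map_smul, norm_smul, norm_mul, norm_inv,
    Complex.norm_real, Real.norm_of_nonneg hσ.le]
  rw [kelvinAdj_toL2] at h2 ⊢
  set v := ‖toL2 (wcomp hb d 1)‖ with hv
  calc ((surf d).real Set.univ)⁻¹ * ‖pair (toL2 (wcomp hb d 1)) f‖ * v
      ≤ ((surf d).real Set.univ)⁻¹ * (v * ‖f‖) * v := by gcongr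
    _ = ((surf d).real Set.univ)⁻¹ * v ^ 2 * ‖f‖ := by ring
    _ = _ := by rw [h1]; field_simp

/-- Up to an error of relative size `λ_1/λ_0`, `T` is `λ_0` times the mean, which gives the upper
estimate; the lower one is `norm_kelvinConj_ge` without its `λ_1` terms. -/
theorem tendsto_norm_kelvinConj_zero [NeZero d] (hd : 2 ≤ d) (hb : 1 < ‖b‖)
    {T : ℝ → L2S d →L[ℂ] L2S d} (hT : ∀ r ∈ Set.Ioo (0 : ℝ) 1, IsMultiplier (eig d r) (T r)) :
    Tendsto (fun r => ‖kelvinConj hd hb (T r)‖ / eig d r 0) (𝓝[>] 0)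
      (𝓝 ((‖b‖ ^ 2 + 1) / (‖b‖ ^ 2 - 1))) := by
  have h4 : 0 < ‖b‖ ^ 2 - 1 := by nlinarith
  have hd0 : (0 : ℝ) < d := by exact_mod_cast NeZero.pos d
  have hlim : Tendsto (fun r => (‖b‖ ^ 2 + 1) / (‖b‖ ^ 2 - 1) + kelMax b * (eig d r 1 / eig d r 0))
      (𝓝[>] 0) (𝓝 ((‖b‖ ^ 2 + 1) / (‖b‖ ^ 2 - 1))) := by
    simpa using ((tendsto_eig_one_div_eig_zero hd).const_mul (kelMax b)).const_add
      ((‖b‖ ^ 2 + 1) / (‖b‖ ^ 2 - 1))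
  refine tendsto_of_tendsto_of_tendsto_of_le_of_le' tendsto_const_nhds hlim ?_ ?_
  · filter_upwards [Ioo_mem_nhdsGT one_pos] with r hr
    have h0 := eig_pos hd hr.1 hr.2 0
    have h1 := eig_pos hd hr.1 hr.2 1
    have h := norm_kelvinConj_ge hd hb (hT r hr)
    set N := ‖kelvinConj hd hb (T r)‖
    have hN : 0 ≤ N := norm_nonneg _
    rw [div_le_div_iff₀ h4 h0]
    refine abs_le_of_sq_le_sq' ?_ (by positivity) |>.2
    have h5 : 0 ≤ 4 * ‖b‖ ^ 2 * eig d r 1 * (eig d r 1 + 2 * eig d r 0) := by positivity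
    have h6 : ((‖b‖ ^ 2 + 1) * eig d r 0) ^ 2 * d ≤ (N * (‖b‖ ^ 2 - 1)) ^ 2 * d := by nlinarith
    exact le_of_mul_le_mul_right h6 hd0
  · filter_upwards [Ioo_mem_nhdsGT one_pos] with r hr
    have h0 := eig_pos hd hr.1 hr.2 0
    have h1 := eig_pos hd hr.1 hr.2 1
    -- Subtracting `λ_0` times the mean removes degree `0`, and by monotonicity the largest
    -- remaining eigenvalue is `λ_1`.
    have hD : ‖T r - (eig d r 0 : ℂ) • meanOp d‖ ≤ eig d r 1 := by
      refine IsMultiplier.norm_le (c := fun n => if n = 0 then 0 else eig d r n) (fun n P hP => ?_)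
        fun n => ?_
      · rw [sub_apply, smul_apply, hT r hr n P hP, isMultiplier_meanOp n P hP]
        by_cases hn : n = 0 <;> simp [hn]
      · by_cases hn : n = 0
        · simp [hn, h1.le]
        · simp only [hn, if_false]
          rw [abs_of_pos (eig_pos hd hr.1 hr.2 n)]
          exact eig_antitone hd hr.1 hr.2 (Nat.one_le_iff_ne_zero.2 hn)
    have e : kelvinConj hd hb (T r) = (eig d r 0 : ℂ) • kelvinConj hd hb (meanOp d) +
        kelvinConj hd hb (T r - (eig d r 0 : ℂ) • meanOp d) := by
      ext1 f
      simp only [kelvinConj_apply, add_apply, sub_apply, smul_apply, map_sub, map_smul]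
      abel
    rw [div_le_iff₀ h0, e]
    refine (norm_add_le _ _).trans ?_
    rw [norm_smul, Complex.norm_real, Real.norm_of_nonneg h0.le]
    have h7 := norm_kelvinConj_meanOp_le hd hb
    have h8 := (norm_kelvinConj_le hd hb (T r - (eig d r 0 : ℂ) • meanOp d)).trans
      (mul_le_mul_of_nonneg_left hD (kelMax_pos hb).le)
    have h9 : ((‖b‖ ^ 2 + 1) / (‖b‖ ^ 2 - 1) + kelMax b * (eig d r 1 / eig d r 0)) * eig d r 0 =
        eig d r 0 * ((‖b‖ ^ 2 + 1) / (‖b‖ ^ 2 - 1)) + kelMax b * eig d r 1 := by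
      field_simp
    rw [h9]
    gcongr

end Limits

end DepthEIT

namespace DepthEIT

variable {d : ℕ}

/-! ### From the centre of inversion back to `a` -/

section Ratio

lemma dnDiff_eq {C : E d} {R : ℝ} {T : L2S d →L[ℂ] L2S d} (h : ∀ T', ExtendsDNDiff C R T' ↔ T' = T) :
    dnDiff C R = T := by
  have hex : ∃ T, ExtendsDNDiff C R T := ⟨T, (h T).2 rfl⟩
  rw [dnDiff, dif_pos hex]
  exact (h _).1 hex.choose_spec

lemma existsUnique_extendsDNDiff {C : E d} {R : ℝ} {T : L2S d →L[ℂ] L2S d}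
    (h : ∀ T', ExtendsDNDiff C R T' ↔ T' = T) : ∃! T, ExtendsDNDiff C R T :=
  ⟨T, (h T).2 rfl, fun T' hT' => (h T').1 hT'⟩

lemma kelMax_invCenter {a : E d} (ha0 : a ≠ 0) :
    kelMax (invCenter a) = (1 + ‖a‖) / (1 - ‖a‖) := by
  have h : ‖a‖ ≠ 0 := norm_ne_zero_iff.2 ha0
  have h1 : ‖a‖⁻¹ - 1 = (1 - ‖a‖) / ‖a‖ := by field_simp
  have h2 : ‖a‖⁻¹ + 1 = (1 + ‖a‖) / ‖a‖ := by field_simp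
  rw [kelMax, norm_invCenter ha0, h1, h2, div_div_div_cancel_right₀ h]

lemma mean_invCenter {a : E d} (ha0 : a ≠ 0) :
    (‖invCenter a‖ ^ 2 + 1) / (‖invCenter a‖ ^ 2 - 1) = (1 + ‖a‖ ^ 2) / (1 - ‖a‖ ^ 2) := by
  have h : ‖a‖ ^ 2 ≠ 0 := pow_ne_zero 2 (norm_ne_zero_iff.2 ha0)
  have h1 : ‖a‖⁻¹ ^ 2 - 1 = (1 - ‖a‖ ^ 2) / ‖a‖ ^ 2 := by rw [inv_pow]; field_simp
  have h2 : ‖a‖⁻¹ ^ 2 + 1 = (1 + ‖a‖ ^ 2) / ‖a‖ ^ 2 := by rw [inv_pow]; field_simp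
  rw [norm_invCenter ha0, h1, h2, div_div_div_cancel_right₀ h]

lemma norm_kelvinConj_ge_invCenter [NeZero d] (hd : 2 ≤ d) {r : ℝ} {a : E d} (ha0 : a ≠ 0)
    (ha1 : ‖a‖ < 1) {T : L2S d →L[ℂ] L2S d} (hT : IsMultiplier (eig d r) T) :
    (1 + ‖a‖ ^ 2) ^ 2 * d * eig d r 0 ^ 2 + 4 * ‖a‖ ^ 2 * eig d r 1 * (eig d r 1 + 2 * eig d r 0) ≤
      (1 - ‖a‖ ^ 2) ^ 2 * d * ‖kelvinConj hd (one_lt_norm_invCenter ha0 ha1) T‖ ^ 2 := by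
  have hn : 0 < ‖a‖ := norm_pos_iff.2 ha0
  have h := norm_kelvinConj_ge hd (one_lt_norm_invCenter ha0 ha1) hT
  set N := ‖kelvinConj hd (one_lt_norm_invCenter ha0 ha1) T‖
  rw [norm_invCenter ha0, inv_pow] at h
  -- Since `|b| = 1/ρ`, multiplication by `ρ⁴` clears all inverse powers.
  have h2 := mul_le_mul_of_nonneg_left h (pow_pos hn 4).le
  have e1 : ‖a‖ ^ 4 * (((‖a‖ ^ 2)⁻¹ + 1) ^ 2 * d * eig d r 0 ^ 2 +
      4 * (‖a‖ ^ 2)⁻¹ * eig d r 1 * (eig d r 1 + 2 * eig d r 0)) = (1 + ‖a‖ ^ 2) ^ 2 * d * eig d r 0 ^ 2 +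
      4 * ‖a‖ ^ 2 * eig d r 1 * (eig d r 1 + 2 * eig d r 0) := by field_simp
  have e2 : ‖a‖ ^ 4 * (((‖a‖ ^ 2)⁻¹ - 1) ^ 2 * d * N ^ 2) = (1 - ‖a‖ ^ 2) ^ 2 * d * N ^ 2 := by
    field_simp
  rwa [e1, e2] at h2

lemma norm_kelvinConj_pos [NeZero d] (hd : 2 ≤ d) {r : ℝ} (hr : r ∈ Set.Ioo (0 : ℝ) 1) {a : E d}
    (ha0 : a ≠ 0) (ha1 : ‖a‖ < 1) {T : L2S d →L[ℂ] L2S d} (hT : IsMultiplier (eig d r) T) :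
    0 < ‖kelvinConj hd (one_lt_norm_invCenter ha0 ha1) T‖ := by
  have h := norm_kelvinConj_ge_invCenter hd ha0 ha1 hT
  have h0 := eig_pos hd hr.1 hr.2 0
  have h1 := eig_pos hd hr.1 hr.2 1
  have hd0 : (0 : ℝ) < d := by exact_mod_cast NeZero.pos d
  refine (norm_nonneg _).lt_of_ne fun h2 => ?_
  rw [← h2] at h
  have : 0 < (1 + ‖a‖ ^ 2) ^ 2 * d * eig d r 0 ^ 2 +
      4 * ‖a‖ ^ 2 * eig d r 1 * (eig d r 1 + 2 * eig d r 0) := by positivity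
  linarith [this.trans_le h]

end Ratio

end DepthEIT

/-! ### Assembly of the theorem -/

theorem theorem4p3 (d : ℕ) (hd : 2 ≤ d) (a : DepthEIT.E d) (ha0 : a ≠ 0) (ha1 : ‖a‖ < 1)
    (ρ : ℝ) (hρ : ρ = ‖a‖) (C : ℝ → DepthEIT.E d) (R : ℝ → ℝ)
    (hCR : ∀ r ∈ Set.Ioo (0 : ℝ) 1, 0 < R r ∧
      Metric.ball (C r) (R r) = DepthEIT.inv a '' Metric.ball 0 r) :
    (∀ r ∈ Set.Ioo (0 : ℝ) 1,
      (∃! T, DepthEIT.ExtendsDNDiff (0 : DepthEIT.E d) r T) ∧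
      (∃! T, DepthEIT.ExtendsDNDiff (C r) (R r) T) ∧
      (∀ μ : ℂ, Module.End.HasEigenvalue
          (DepthEIT.dnDiff (0 : DepthEIT.E d) r : DepthEIT.L2S d →ₗ[ℂ] DepthEIT.L2S d) μ ↔
        ∃ n : ℕ, μ = (DepthEIT.eig d r n : ℂ)) ∧
      (1 - ρ) / (1 + ρ) ≤ DepthEIT.ratio r (C r) (R r) ∧
      DepthEIT.ratio r (C r) (R r) ≤
        Real.sqrt (((1 - ρ ^ 2) ^ 2 * d) /
          ((1 + ρ ^ 2) ^ 2 * d + 4 * ρ ^ 2 * (DepthEIT.eig d r 1 / DepthEIT.eig d r 0) *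
            (DepthEIT.eig d r 1 / DepthEIT.eig d r 0 + 2))) ∧
      Real.sqrt (((1 - ρ ^ 2) ^ 2 * d) /
          ((1 + ρ ^ 2) ^ 2 * d + 4 * ρ ^ 2 * (DepthEIT.eig d r 1 / DepthEIT.eig d r 0) *
            (DepthEIT.eig d r 1 / DepthEIT.eig d r 0 + 2))) ≤ (1 - ρ ^ 2) / (1 + ρ ^ 2)) ∧
    IsGLB ((fun r => DepthEIT.ratio r (C r) (R r)) '' Set.Ioo 0 1) ((1 - ρ) / (1 + ρ)) ∧
    IsLUB ((fun r => DepthEIT.ratio r (C r) (R r)) '' Set.Ioo 0 1)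
      ((1 - ρ ^ 2) / (1 + ρ ^ 2)) ∧
    Tendsto (fun r => DepthEIT.ratio r (C r) (R r)) (𝓝[<] 1) (𝓝 ((1 - ρ) / (1 + ρ))) ∧
    Tendsto (fun r => DepthEIT.ratio r (C r) (R r)) (𝓝[>] 0)
      (𝓝 ((1 - ρ ^ 2) / (1 + ρ ^ 2))) := by
  subst hρ
  have : NeZero d := ⟨by omega⟩
  have hd0 : (0 : ℝ) < d := by exact_mod_cast NeZero.pos d
  have hρ0 : 0 < ‖a‖ := norm_pos_iff.2 ha0
  have hρ2 : 0 < 1 - ‖a‖ ^ 2 := by nlinarith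
  have hb := DepthEIT.one_lt_norm_invCenter ha0 ha1
  have hex : ∀ r, r ∈ Set.Ioo (0 : ℝ) 1 →
      ∃ T : DepthEIT.L2S d →L[ℂ] DepthEIT.L2S d, DepthEIT.IsMultiplier (DepthEIT.eig d r) T :=
    fun r hr => DepthEIT.exists_isMultiplier (DepthEIT.summable_eig hd hr.1 hr.2)
      fun n => (DepthEIT.eig_pos hd hr.1 hr.2 n).le
  choose! T hT using hex
  set N : ℝ → ℝ := fun r => ‖DepthEIT.kelvinConj hd hb (T r)‖ with hN
  have hext0 : ∀ r ∈ Set.Ioo (0 : ℝ) 1, ∀ T',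
      DepthEIT.ExtendsDNDiff (0 : DepthEIT.E d) r T' ↔ T' = T r := fun r hr =>
    DepthEIT.extendsDNDiff_zero_iff hd hr.1 hr.2 (hT r hr)
  have hextC : ∀ r ∈ Set.Ioo (0 : ℝ) 1, ∀ T',
      DepthEIT.ExtendsDNDiff (C r) (R r) T' ↔ T' = DepthEIT.kelvinConj hd hb (T r) := by
    intro r hr
    obtain ⟨hR, hball⟩ := hCR r hr
    rw [DepthEIT.inv_eq_ballInv ha0] at hball
    exact DepthEIT.extendsDNDiff_kelvin_iff hd hb hr.1 hr.2 hR
      (DepthEIT.norm_add_lt_one hb hr.1 hr.2 hR hball)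
      (fun x hx => DepthEIT.ballInv_mem_dom hb hr.1 hr.2 hR hball hx)
      (fun x hx => DepthEIT.ballInv_mem_sphere_of_ball_eq hb hr.1 hr.2 hR hball hx) (hT r hr)
  -- By uniqueness the chosen operators `dnDiff` are `T r` and its Kelvin conjugate, and the
  -- numerator is the largest eigenvalue `λ_0`.
  have hratio : ∀ r ∈ Set.Ioo (0 : ℝ) 1,
      DepthEIT.ratio r (C r) (R r) = DepthEIT.eig d r 0 / N r := fun r hr => by
    rw [DepthEIT.ratio, DepthEIT.dnDiff_eq (hext0 r hr), DepthEIT.dnDiff_eq (hextC r hr),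
      (hT r hr).norm_eq hd hr.1 hr.2]
  have hNpos : ∀ r ∈ Set.Ioo (0 : ℝ) 1, 0 < N r := fun r hr =>
    DepthEIT.norm_kelvinConj_pos hd hr ha0 ha1 (hT r hr)
  have hlow : ∀ r ∈ Set.Ioo (0 : ℝ) 1,
      (1 - ‖a‖) / (1 + ‖a‖) ≤ DepthEIT.ratio r (C r) (R r) := by
    intro r hr
    have h := DepthEIT.norm_kelvinConj_le hd hb (T r)
    rw [DepthEIT.kelMax_invCenter ha0, (hT r hr).norm_eq hd hr.1 hr.2, div_mul_eq_mul_div,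
      le_div_iff₀ (by linarith)] at h
    rw [hratio r hr, div_le_div_iff₀ (by linarith) (hNpos r hr)]
    linarith
  have hmid : ∀ r ∈ Set.Ioo (0 : ℝ) 1, DepthEIT.ratio r (C r) (R r) ≤
      Real.sqrt (((1 - ‖a‖ ^ 2) ^ 2 * d) /
        ((1 + ‖a‖ ^ 2) ^ 2 * d + 4 * ‖a‖ ^ 2 * (DepthEIT.eig d r 1 / DepthEIT.eig d r 0) *
          (DepthEIT.eig d r 1 / DepthEIT.eig d r 0 + 2))) := by
    intro r hr
    have h0 := DepthEIT.eig_pos hd hr.1 hr.2 0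
    have h1 := DepthEIT.eig_pos hd hr.1 hr.2 1
    have h := DepthEIT.norm_kelvinConj_ge_invCenter hd ha0 ha1 (hT r hr)
    rw [hratio r hr]
    apply Real.le_sqrt_of_sq_le
    rw [div_pow, div_le_div_iff₀ (pow_pos (hNpos r hr) 2) (by positivity)]
    refine le_of_eq_of_le ?_ h
    field_simp
  have hup : ∀ r ∈ Set.Ioo (0 : ℝ) 1, Real.sqrt (((1 - ‖a‖ ^ 2) ^ 2 * d) /
        ((1 + ‖a‖ ^ 2) ^ 2 * d + 4 * ‖a‖ ^ 2 * (DepthEIT.eig d r 1 / DepthEIT.eig d r 0) *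
          (DepthEIT.eig d r 1 / DepthEIT.eig d r 0 + 2))) ≤ (1 - ‖a‖ ^ 2) / (1 + ‖a‖ ^ 2) := by
    intro r hr
    have h0 := DepthEIT.eig_pos hd hr.1 hr.2 0
    have h1 := DepthEIT.eig_pos hd hr.1 hr.2 1
    refine Real.sqrt_le_iff.2 ⟨by positivity, ?_⟩
    -- A common factor `d` is inserted so that the two fractions differ only by the nonnegative
    -- `λ_1/λ_0` term in the denominator.
    rw [div_pow, ← mul_div_mul_right ((1 - ‖a‖ ^ 2) ^ 2) ((1 + ‖a‖ ^ 2) ^ 2) hd0.ne']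
    gcongr
    exact le_add_of_nonneg_right (by positivity)
  have ht1 : Tendsto (fun r => DepthEIT.ratio r (C r) (R r)) (𝓝[<] 1)
      (𝓝 ((1 - ‖a‖) / (1 + ‖a‖))) := by
    have h := (DepthEIT.tendsto_norm_kelvinConj_one hd hb hT).inv₀ (DepthEIT.kelMax_pos hb).ne'
    rw [DepthEIT.kelMax_invCenter ha0, inv_div] at h
    refine h.congr' ?_
    filter_upwards [Ioo_mem_nhdsLT one_pos] with r hr
    rw [hratio r hr, inv_div]
  have ht0 : Tendsto (fun r => DepthEIT.ratio r (C r) (R r)) (𝓝[>] 0)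
      (𝓝 ((1 - ‖a‖ ^ 2) / (1 + ‖a‖ ^ 2))) := by
    have h := DepthEIT.tendsto_norm_kelvinConj_zero hd hb hT
    rw [DepthEIT.mean_invCenter ha0] at h
    have h := h.inv₀ (by positivity)
    rw [inv_div] at h
    refine h.congr' ?_
    filter_upwards [Ioo_mem_nhdsGT one_pos] with r hr
    rw [hratio r hr, inv_div]
  refine ⟨fun r hr => ⟨DepthEIT.existsUnique_extendsDNDiff (hext0 r hr),
    DepthEIT.existsUnique_extendsDNDiff (hextC r hr), fun μ => ?_, hlow r hr, hmid r hr, hup r hr⟩,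
    ⟨?_, fun w hw => ?_⟩, ⟨?_, fun w hw => ?_⟩, ht1, ht0⟩
  · rw [DepthEIT.dnDiff_eq (hext0 r hr)]
    exact (hT r hr).hasEigenvalue_iff hd μ
  · rintro _ ⟨r, hr, rfl⟩
    exact hlow r hr
  -- Any lower bound of the ratio passes to its limit at `r → 1`, which is the bound already proved;
  -- the supremum is treated in the same way with `r → 0`.
  · refine ge_of_tendsto ht1 ?_
    filter_upwards [Ioo_mem_nhdsLT one_pos] with r hr
    exact hw ⟨r, hr, rfl⟩
  · rintro _ ⟨r, hr, rfl⟩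
    exact (hmid r hr).trans (hup r hr)
  · refine le_of_tendsto ht0 ?_
    filter_upwards [Ioo_mem_nhdsGT one_pos] with r hr
    exact hw ⟨r, hr, rfl⟩
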